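/- Let $N\ge 2$, let $\Omega\subset\mathbb R^N$ be a bounded domain, and let $p\in(1,2)$, $s_1\in(0,1)$, $s_p\in\left(0,\frac{p-1}{p}\right]$. Notation. For $0<\gamma<1$, $1\le q<\infty$ and $A\subset\mathbb R^N$, $W^{\gamma,q}(A)$ is the space of all $u\in L^q(A)$ with $$[u]_{W^{\gamma,q}(A)}:=\left(\int_A\int_A\frac{|u(x)-u(y)|^q}{|x-y|^{N+\gamma q}}\,dx\,dy\right)^{1/q}<\infty ,$$ and $u\in W^{\gamma,q}_{\rm loc}(\Omega)$ means $u\in W^{\gamma,q}(V)$ for every open $V\subset\subset\Omega$. The space $L^{p-1}_{s_pp}(\mathbb R^N)$ consists of all $u\in L^p_{\rm loc}(\mathbb R^N)$ with $\int_{\mathbb R^N}\frac{|u(x)|^{p-1}}{(1+|x|)^{N+s_pp}}\,dx<\infty$. For a ball $B_R=B_R(x_0)$ put $$\mathrm{Tail}(u;x_0,R):=\left(R^{s_pp}\int_{\mathbb R^N\setminus B_R(x_0)}\frac{|u(x)|^{p-1}}{|x-x_0|^{N+s_pp}}\,dx\right)^{\frac1{p-1}},\qquad \mathcal T:=\|u\|_{L^\infty(B_R(x_0))}+\mathrm{Tail}(u;x_0,R).$$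 Weak solutions. A function $u\in W^{s_1,1}_{\rm loc}(\Omega)\cap W^{s_p,p}_{\rm loc}(\Omega)\cap L^{p-1}_{s_pp}(\mathbb R^N)$ is a weak solution of $$(-\Delta_1)^{s_1}u+(-\Delta_p)^{s_p}u=0\quad\text{in }\Omega$$ if there is $Z\in L^\infty(\mathbb R^N\times\mathbb R^N)$ with $Z(x,y)\in\mathrm{sgn}(u(x)-u(y))$ for a.e. $(x,y)$, where $\mathrm{sgn}(t)=\{t/|t|\}$ for $t\ne0$ and $\mathrm{sgn}(0)=[-1,1]$, such that $$0=\int_{\mathbb R^N}\int_{\mathbb R^N}Z(x,y)\frac{\varphi(x)-\varphi(y)}{|x-y|^{N+s_1}}\,dx\,dy+\int_{\mathbb R^N}\int_{\mathbb R^N}\frac{|u(x)-u(y)|^{p-2}(u(x)-u(y))(\varphi(x)-\varphi(y))}{|x-y|^{N+s_pp}}\,dx\,dy$$ for every $\varphi\in W^{s_1,1}(\mathbb R^N)\cap W^{s_p,p}(\mathbb R^N)$ with compact support in $\Omega$. It is locally bounded if $u\in L^\infty(V)$ for every open $V\subset\subset\Omega$. Theorem. Let $u$ be a locally bounded weak solution.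 Then $u\in W^{\sigma,q}_{\rm loc}(\Omega)$ for all $q\ge p$ and all $s_p\le\sigma<\frac{s_pp}{p-1}$. Moreover, there are constants $C,\kappa>0$ depending only on $N,p,q,s_1,s_p,\sigma$ such that for every ball $B_R=B_R(x_0)\subset\subset\Omega$ with $R\in(0,1)$ and every $r\in(0,R)$, with $B_r=B_r(x_0)$, $$[u]^q_{W^{\sigma,q}(B_r)}\le\frac{C\left(\mathcal T+[u]_{W^{s_p,p}(B_R)}+1\right)^q}{(R-r)^{\kappa}} .$$ -/

import Mathlib

open MeasureTheory Set

noncomputable section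

/-- `V ⊂⊂ Ω`: the closure of `V` is compact and contained in `Ω`. -/
def CompactlyContained {N : ℕ} (V Ω : Set (EuclideanSpace ℝ (Fin N))) : Prop :=
  IsCompact (closure V) ∧ closure V ⊆ Ω

/-- The Gagliardo seminorm
`[u]_{W^{γ,q}(A)} = (∫_A ∫_A |u(x)-u(y)|^q / |x-y|^{N+γq} dx dy)^{1/q}`,
with values in `[0,∞]`. -/
def gagliardo {N : ℕ} (γ q : ℝ) (A : Set (EuclideanSpace ℝ (Fin N)))
    (u : EuclideanSpace ℝ (Fin N) → ℝ) : ENNReal :=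
  (∫⁻ x in A, ∫⁻ y in A,
    ENNReal.ofReal (|u x - u y| ^ q) / ENNReal.ofReal (‖x - y‖ ^ ((N : ℝ) + γ * q))) ^ (1 / q)

/-- `u ∈ W^{γ,q}(A)` (for `0 < γ < 1`, `1 ≤ q < ∞`). -/
def MemFracSobolev {N : ℕ} (γ q : ℝ) (A : Set (EuclideanSpace ℝ (Fin N)))
    (u : EuclideanSpace ℝ (Fin N) → ℝ) : Prop :=
  MemLp u (ENNReal.ofReal q) (volume.restrict A) ∧ gagliardo γ q A u < ⊤

/-- `u ∈ W^{γ,q}_loc(Ω)`: `u ∈ W^{γ,q}(V)` for every open `V ⊂⊂ Ω`. -/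
def MemFracSobolevLoc {N : ℕ} (γ q : ℝ) (Ω : Set (EuclideanSpace ℝ (Fin N)))
    (u : EuclideanSpace ℝ (Fin N) → ℝ) : Prop :=
  ∀ V : Set (EuclideanSpace ℝ (Fin N)), IsOpen V → CompactlyContained V Ω →
    MemFracSobolev γ q V u

/-- `u` is locally bounded in `Ω`: `u ∈ L^∞(V)` for every open `V ⊂⊂ Ω`. -/
def LocallyEssBounded {N : ℕ} (Ω : Set (EuclideanSpace ℝ (Fin N)))
    (u : EuclideanSpace ℝ (Fin N) → ℝ) : Prop :=
  ∀ V : Set (EuclideanSpace ℝ (Fin N)), IsOpen V → CompactlyContained V Ω →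
    MemLp u ⊤ (volume.restrict V)

/-- The tail space `L^{p-1}_{sp}(ℝ^N)`: all `w ∈ L^p_loc(ℝ^N)` with
`∫ |w(x)|^{p-1} / (1+|x|)^{N+sp} dx < ∞`. -/
def MemTailSpace {N : ℕ} (s p : ℝ) (w : EuclideanSpace ℝ (Fin N) → ℝ) : Prop :=
  (∀ K : Set (EuclideanSpace ℝ (Fin N)), IsCompact K →
    MemLp w (ENNReal.ofReal p) (volume.restrict K)) ∧
  ∫⁻ x, ENNReal.ofReal (|w x| ^ (p - 1)) /
    ENNReal.ofReal ((1 + ‖x‖) ^ ((N : ℝ) + s * p)) < ⊤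

/-- `Tail(u;x₀,R) = (R^{sp} ∫_{ℝ^N ∖ B_R(x₀)} |u(x)|^{p-1} / |x-x₀|^{N+sp} dx)^{1/(p-1)}`. -/
def tail {N : ℕ} (s p : ℝ) (u : EuclideanSpace ℝ (Fin N) → ℝ)
    (x₀ : EuclideanSpace ℝ (Fin N)) (R : ℝ) : ENNReal :=
  (ENNReal.ofReal (R ^ (s * p)) *
    ∫⁻ x in (Metric.ball x₀ R)ᶜ,
      ENNReal.ofReal (|u x| ^ (p - 1)) /
        ENNReal.ofReal (‖x - x₀‖ ^ ((N : ℝ) + s * p))) ^ (1 / (p - 1))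

/-- `𝒯 = ‖u‖_{L^∞(B_R(x₀))} + Tail(u;x₀,R)`. -/
def boundAndTail {N : ℕ} (s p : ℝ) (u : EuclideanSpace ℝ (Fin N) → ℝ)
    (x₀ : EuclideanSpace ℝ (Fin N)) (R : ℝ) : ENNReal :=
  eLpNorm u ⊤ (volume.restrict (Metric.ball x₀ R)) + tail s p u x₀ R

/-- The set-valued sign: `{1}` for `t > 0`, `{-1}` for `t < 0` and `[-1,1]` for `t = 0`. -/
def setSgn (t : ℝ) : Set ℝ :=
  {z | (0 < t → z = 1) ∧ (t < 0 → z = -1) ∧ z ∈ Icc (-1 : ℝ) 1}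

/-- `φ` is a test function for the problem in `Ω`: it belongs to
`W^{s₁,1}(ℝ^N) ∩ W^{s_p,p}(ℝ^N)` and has compact support in `Ω`. -/
def IsTestFunction {N : ℕ} (p s₁ sp : ℝ) (Ω : Set (EuclideanSpace ℝ (Fin N)))
    (φ : EuclideanSpace ℝ (Fin N) → ℝ) : Prop :=
  MemFracSobolev s₁ 1 univ φ ∧ MemFracSobolev sp p univ φ ∧
    HasCompactSupport φ ∧ tsupport φ ⊆ Ω

/-- `u` is a weak solution of `(-Δ_1)^{s₁} u + (-Δ_p)^{s_p} u = 0` in `Ω`.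
For the test functions above, both double integrals converge absolutely. -/
def IsWeakSolution {N : ℕ} (p s₁ sp : ℝ) (Ω : Set (EuclideanSpace ℝ (Fin N)))
    (u : EuclideanSpace ℝ (Fin N) → ℝ) : Prop :=
  MemFracSobolevLoc s₁ 1 Ω u ∧ MemFracSobolevLoc sp p Ω u ∧ MemTailSpace sp p u ∧
  ∃ Z : EuclideanSpace ℝ (Fin N) × EuclideanSpace ℝ (Fin N) → ℝ,
    MemLp Z ⊤ volume ∧
    (∀ᵐ z : EuclideanSpace ℝ (Fin N) × EuclideanSpace ℝ (Fin N),
      Z z ∈ setSgn (u z.1 - u z.2)) ∧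
    ∀ φ : EuclideanSpace ℝ (Fin N) → ℝ, IsTestFunction p s₁ sp Ω φ →
      0 = (∫ z : EuclideanSpace ℝ (Fin N) × EuclideanSpace ℝ (Fin N),
            Z z * (φ z.1 - φ z.2) / ‖z.1 - z.2‖ ^ ((N : ℝ) + s₁)) +
          ∫ z : EuclideanSpace ℝ (Fin N) × EuclideanSpace ℝ (Fin N),
            |u z.1 - u z.2| ^ (p - 2) * (u z.1 - u z.2) * (φ z.1 - φ z.2) /
              ‖z.1 - z.2‖ ^ ((N : ℝ) + sp * p)

end

/-! The proof is a difference-quotient bootstrap. Write δ_h u(x) = u(x+h) − u(x) and s = s_p p, and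
let M ≥ 1 dominate both the supremum of |u| on the ball and the tail. The equation and its translate
by h are tested with a cutoff times the odd power of δ_h u of exponent β = q + 1 − p, and the
results are subtracted. The set-valued sign is monotone, so the principal part of the 1-growth term
is nonnegative and can be dropped; only its cutoff error survives. The p-growth term leaves a
monotone energy, and `LocalSolution.energy_le` bounds this energy by a multiple of ∫|δ_h u|^β.

For p < 2 that energy controls |δ_h u(x) − δ_h u(y)| only with a degenerate weight.
`abs_sub_rpow_le_energy` removes the weight by interpolation with a free parameter l. Restricting to
y = x + k with |k| ≤ |h|, where the kernel is at least |h|^{−N−s}, and optimising l as a power of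
|h| turns the bound ∫|δ_h u|^q ≲ |h|^{σq} into a bound for the averages over k of the mixed
differences δ_k δ_h u (`LocalSolution.mixed_difference_le`). The new exponent is σ' = σ + (s −
σ(p−1))/(q+2−p).

Averaging over intermediate points passes from mixed differences to δ_h δ_h u
(`second_difference_le`). A doubling argument returns to δ_h u
(`incrementBound_of_second_difference`); it requires σ' < 1, which holds because s ≤ p − 1. The
iteration starts at σ = 0, where boundedness of u suffices. The defect s − σ(p−1) shrinks
geometrically, so every exponent below s/(p−1) is exceeded after finitely many steps, each costing a
fixed fraction of R − r. Increment bounds of order τ > σ finally give W^{σ,q} by integration against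
|h|^{−N−σq}.

Finiteness of the W^{s₁,1} and W^{s_p,p} seminorms serves only to make the test functions admissible
and the integrals absolutely convergent; no constant depends on these seminorms. -/

/-! ### Odd powers and the pointwise monotonicity inequalities -/

/-- The odd power `t ↦ |t|^{r-1} t`. -/
noncomputable def oddPow (r t : ℝ) : ℝ := |t| ^ (r - 1) * t

theorem oddPow_of_nonneg {r t : ℝ} (hr : 0 < r) (ht : 0 ≤ t) : oddPow r t = t ^ r := by
  rcases ht.eq_or_lt with rfl | h
  · simp [oddPow, Real.zero_rpow hr.ne']
  · rw [oddPow, abs_of_pos h, Real.rpow_sub_one h.ne']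
    field_simp

theorem oddPow_neg (r t : ℝ) : oddPow r (-t) = -oddPow r t := by
  simp [oddPow]

theorem abs_oddPow {r : ℝ} (hr : 0 < r) (t : ℝ) : |oddPow r t| = |t| ^ r := by
  rcases le_total 0 t with h | h
  · rw [oddPow_of_nonneg hr h, abs_of_nonneg h, abs_of_nonneg (Real.rpow_nonneg h r)]
  · have := oddPow_of_nonneg hr (neg_nonneg.2 h)
    rw [oddPow_neg] at this
    rw [← abs_neg, this, abs_of_nonpos h, abs_of_nonneg (Real.rpow_nonneg (neg_nonneg.2 h) r)]

/-- To bound differences of an odd function from below, it is enough to consider arguments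
of the same sign and of opposite signs. -/
theorem odd_diff_induction {P : ℝ → ℝ → Prop}
    (hneg : ∀ s t, P s t → P (-t) (-s))
    (hsame : ∀ s t, 0 ≤ s → s ≤ t → P s t)
    (hopp : ∀ s t, 0 ≤ s → 0 ≤ t → P (-s) t) {s t : ℝ} (hst : s ≤ t) : P s t := by
  rcases le_total 0 s with hs | hs
  · exact hsame s t hs hst
  · rcases le_total 0 t with ht | ht
    · simpa using hopp (-s) t (neg_nonneg.2 hs) ht
    · simpa using hneg (-t) (-s) (hsame (-t) (-s) (neg_nonneg.2 ht) (neg_le_neg hst))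

/-- For equal signs, weighted AM–GM applied to t^{1−r} s^r yields the factor r. For opposite signs,
subadditivity of the r-th power gives the bound even with factor 1. -/
theorem oddPow_sub_ge_of_le_one {r : ℝ} (hr : 0 < r) (hr1 : r ≤ 1) {s t : ℝ} (hst : s ≤ t) :
    r * (t - s) ≤ (|t| + |s|) ^ (1 - r) * (oddPow r t - oddPow r s) := by
  refine odd_diff_induction (P := fun s t => r * (t - s) ≤
    (|t| + |s|) ^ (1 - r) * (oddPow r t - oddPow r s)) ?_ ?_ ?_ hst
  · intro s t h
    simp only [oddPow_neg, abs_neg]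
    rw [add_comm |s|]
    linarith
  · intro s t hs hst
    have ht := hs.trans hst
    rw [oddPow_of_nonneg hr hs, oddPow_of_nonneg hr ht, abs_of_nonneg hs, abs_of_nonneg ht]
    have h1 : t ^ (1 - r) * (t ^ r - s ^ r) ≤ (t + s) ^ (1 - r) * (t ^ r - s ^ r) :=
      mul_le_mul_of_nonneg_right (Real.rpow_le_rpow ht (by linarith) (by linarith))
        (sub_nonneg.2 (Real.rpow_le_rpow hs hst hr.le))
    have h2 : t ^ (1 - r) * s ^ r ≤ (1 - r) * t + r * s :=
      Real.geom_mean_le_arith_mean2_weighted (by linarith) hr.le ht hs (by ring)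
    have h3 : t ^ (1 - r) * t ^ r = t := by
      rw [← Real.rpow_add_of_nonneg ht (by linarith) hr.le]; simp
    linarith
  · intro s t hs ht
    rw [oddPow_neg, oddPow_of_nonneg hr hs, oddPow_of_nonneg hr ht, abs_neg, abs_of_nonneg hs,
      abs_of_nonneg ht]
    have h1 := Real.rpow_add_le_add_rpow ht hs hr.le hr1
    have h0 : 0 ≤ t + s := by linarith
    have h2 : (t + s) ^ (1 - r) * (t + s) ^ r = t + s := by
      rw [← Real.rpow_add_of_nonneg h0 (by linarith) hr.le]; simp
    have h3 := mul_le_mul_of_nonneg_left h1 (Real.rpow_nonneg h0 (1 - r))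
    nlinarith

/-- Superadditivity of the r-th power settles equal signs with constant 1; the loss 2^{1−r} comes
from convexity when the signs are opposite. -/
theorem oddPow_sub_ge_of_one_le {r : ℝ} (hr : 1 ≤ r) {s t : ℝ} (hst : s ≤ t) :
    2 ^ (1 - r) * (t - s) ^ r ≤ oddPow r t - oddPow r s := by
  have hr0 : 0 < r := by linarith
  refine odd_diff_induction (P := fun s t => 2 ^ (1 - r) * (t - s) ^ r ≤
    oddPow r t - oddPow r s) ?_ ?_ ?_ hst
  · intro s t h
    simp only [oddPow_neg]
    rw [show -s - -t = t - s by ring]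
    linarith
  · intro s t hs hst
    rw [oddPow_of_nonneg hr0 hs, oddPow_of_nonneg hr0 (hs.trans hst)]
    have h1 := Real.add_rpow_le_rpow_add (sub_nonneg.2 hst) hs hr
    rw [sub_add_cancel] at h1
    have h2 : (2 : ℝ) ^ (1 - r) ≤ 1 := Real.rpow_le_one_of_one_le_of_nonpos (by norm_num) (by linarith)
    have h3 := mul_le_mul_of_nonneg_right h2 (Real.rpow_nonneg (sub_nonneg.2 hst) r)
    linarith
  · intro s t hs ht
    rw [oddPow_neg, oddPow_of_nonneg hr0 hs, oddPow_of_nonneg hr0 ht]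
    have h1 := (NNReal.rpow_add_le_mul_rpow_add_rpow ⟨t, ht⟩ ⟨s, hs⟩ hr)
    have h2 : (t + s) ^ r ≤ 2 ^ (r - 1) * (t ^ r + s ^ r) := by exact_mod_cast h1
    have h3 : (2 : ℝ) ^ (1 - r) * 2 ^ (r - 1) = 1 := by
      rw [← Real.rpow_add (by norm_num)]; simp
    have h4 := mul_le_mul_of_nonneg_left h2 (Real.rpow_nonneg (show (0 : ℝ) ≤ 2 by norm_num) (1 - r))
    rw [← mul_assoc, h3] at h4
    rw [sub_neg_eq_add]
    linarith

theorem oddPow_mono {r : ℝ} (hr : 0 < r) {s t : ℝ} (hst : s ≤ t) : oddPow r s ≤ oddPow r t := by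
  refine odd_diff_induction (P := fun s t => oddPow r s ≤ oddPow r t) ?_ ?_ ?_ hst
  · intro s t h
    simpa only [oddPow_neg, neg_le_neg_iff] using h
  · intro s t hs hst
    rw [oddPow_of_nonneg hr hs, oddPow_of_nonneg hr (hs.trans hst)]
    exact Real.rpow_le_rpow hs hst hr.le
  · intro s t hs ht
    rw [oddPow_neg, oddPow_of_nonneg hr hs, oddPow_of_nonneg hr ht]
    linarith [Real.rpow_nonneg hs r, Real.rpow_nonneg ht r]

/-- Bernoulli's inequality at s/t handles equal signs; for opposite signs each power is linearised
separately by x^r ≤ m^{r−1} x. -/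
theorem oddPow_sub_le {r m : ℝ} (hr : 1 ≤ r) {s t : ℝ} (hst : s ≤ t) (hs : |s| ≤ m)
    (ht : |t| ≤ m) : oddPow r t - oddPow r s ≤ r * m ^ (r - 1) * (t - s) := by
  have hr0 : 0 < r := by linarith
  have hm : 0 ≤ m := (abs_nonneg s).trans hs
  have key : ∀ x, 0 ≤ x → x ≤ m → x ^ r ≤ m ^ (r - 1) * x := by
    intro x hx hxm
    rcases hx.eq_or_lt with rfl | h
    · simp [Real.zero_rpow hr0.ne']
    · rw [show r = (r - 1) + 1 by ring, Real.rpow_add h, Real.rpow_one, add_sub_cancel_right]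
      exact mul_le_mul_of_nonneg_right (Real.rpow_le_rpow hx hxm (by linarith)) hx
  refine odd_diff_induction (P := fun s t => |s| ≤ m → |t| ≤ m →
    oddPow r t - oddPow r s ≤ r * m ^ (r - 1) * (t - s)) ?_ ?_ ?_ hst hs ht
  · intro s t h h1 h2
    rw [abs_neg] at h1 h2
    have := h h2 h1
    simp only [oddPow_neg]
    linarith
  · intro s t hs hst _ ht
    have ht0 := hs.trans hst
    rw [abs_of_nonneg ht0] at ht
    rw [oddPow_of_nonneg hr0 hs, oddPow_of_nonneg hr0 ht0]
    rcases ht0.eq_or_lt with rfl | htp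
    · have : s = 0 := le_antisymm hst hs
      simp [this]
    have h1 : 1 + r * (s / t - 1) ≤ (1 + (s / t - 1)) ^ r :=
      one_add_mul_self_le_rpow_one_add (by linarith [div_nonneg hs ht0]) hr
    rw [add_sub_cancel, Real.div_rpow hs ht0, le_div_iff₀ (Real.rpow_pos_of_pos htp r)] at h1
    have h2 : t ^ r = t ^ (r - 1) * t := by
      rw [Real.rpow_sub_one htp.ne']; field_simp
    have h3 : (1 + r * (s / t - 1)) * t ^ r = t ^ r - r * t ^ (r - 1) * (t - s) := by
      rw [h2]; field_simp; ring
    have h4 : t ^ (r - 1) ≤ m ^ (r - 1) := Real.rpow_le_rpow ht0 ht (by linarith)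
    have h5 : r * t ^ (r - 1) * (t - s) ≤ r * m ^ (r - 1) * (t - s) :=
      mul_le_mul_of_nonneg_right (mul_le_mul_of_nonneg_left h4 hr0.le) (sub_nonneg.2 hst)
    linarith
  · intro s t hs ht hsm htm
    rw [abs_neg, abs_of_nonneg hs] at hsm
    rw [abs_of_nonneg ht] at htm
    rw [oddPow_neg, oddPow_of_nonneg hr0 hs, oddPow_of_nonneg hr0 ht]
    have h1 := key s hs hsm
    have h2 := key t ht htm
    have h3 : 0 ≤ m ^ (r - 1) * (t + s) := mul_nonneg (Real.rpow_nonneg hm _) (by linarith)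
    nlinarith

theorem abs_oddPow_sub_le {r m : ℝ} (hr : 1 ≤ r) {s t : ℝ} (hs : |s| ≤ m) (ht : |t| ≤ m) :
    |oddPow r t - oddPow r s| ≤ r * m ^ (r - 1) * |t - s| := by
  rcases le_total s t with h | h
  · rw [abs_of_nonneg (sub_nonneg.2 h), abs_of_nonneg (sub_nonneg.2 (oddPow_mono (by linarith) h))]
    exact oddPow_sub_le hr h hs ht
  · rw [abs_sub_comm, abs_sub_comm t, abs_of_nonneg (sub_nonneg.2 h),
      abs_of_nonneg (sub_nonneg.2 (oddPow_mono (by linarith) h))]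
    exact oddPow_sub_le hr h ht hs

theorem oddPow_sub_mul_sub_nonneg {r k : ℝ} (hr : 0 < r) (hk : 0 < k) {a b s t : ℝ}
    (h : a - b = t - s) : 0 ≤ (oddPow r a - oddPow r b) * (oddPow k t - oddPow k s) := by
  rcases le_total b a with hab | hab
  · exact mul_nonneg (sub_nonneg.2 (oddPow_mono hr hab))
      (sub_nonneg.2 (oddPow_mono hk (by linarith)))
  · exact mul_nonneg_of_nonpos_of_nonpos (sub_nonpos.2 (oddPow_mono hr hab))
      (sub_nonpos.2 (oddPow_mono hk (by linarith)))

/-- Product of the two lower bounds for odd powers: exponent p − 1 ≤ 1 for the arguments a, b, which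
produces the weight, and exponent k ≥ 1 for s, t. -/
theorem oddPow_energy_ge {p k : ℝ} (hp : 1 < p) (hp2 : p ≤ 2) (hk : 1 ≤ k) {a b s t : ℝ}
    (h : a - b = t - s) :
    (p - 1) * 2 ^ (1 - k) * |a - b| ^ (k + 1) ≤
      (|a| + |b|) ^ (2 - p) *
        ((oddPow (p - 1) a - oddPow (p - 1) b) * (oddPow k t - oddPow k s)) := by
  wlog hab : b ≤ a generalizing a b s t
  · have := this (a := b) (b := a) (s := t) (t := s) (by linarith) (le_of_not_ge hab)
    rw [abs_sub_comm, add_comm |b|] at this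
    linarith
  have h1 := oddPow_sub_ge_of_le_one (r := p - 1) (by linarith) (by linarith) hab
  have h2 := oddPow_sub_ge_of_one_le hk (s := s) (t := t) (by linarith)
  rw [← h] at h2
  have hd : 0 ≤ a - b := sub_nonneg.2 hab
  rw [abs_of_nonneg hd, Real.rpow_add_one' hd (by linarith)]
  rw [show 1 - (p - 1) = 2 - p by ring] at h1
  have h3 := mul_le_mul h1 h2
    (mul_nonneg (Real.rpow_nonneg (by norm_num) _) (Real.rpow_nonneg hd _))
    (mul_nonneg (Real.rpow_nonneg (by positivity) _)
      (sub_nonneg.2 (oddPow_mono (by linarith) hab)))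
  linarith

/-- The interpolation step: a power of the difference is controlled by the monotone energy and by
the size of the arguments. -/
theorem abs_sub_rpow_le_energy {p q : ℝ} (hp : 1 < p) (hp2 : p < 2) (hq : p ≤ q) {a b s t l : ℝ}
    (h : a - b = t - s) (hl : 0 < l) :
    |a - b| ^ q ≤ l * ((p - 1) * 2 ^ (p - q))⁻¹ *
        ((oddPow (p - 1) a - oddPow (p - 1) b) *
          (oddPow (q + 1 - p) t - oddPow (q + 1 - p) s)) +
      l ^ (-(q / (2 - p))) * (|a| + |b|) ^ q := by
  have hE := oddPow_energy_ge hp hp2.le (k := q + 1 - p) (by linarith) h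
  have hX := oddPow_sub_mul_sub_nonneg (r := p - 1) (k := q + 1 - p) (by linarith) (by linarith) h
  set X := (oddPow (p - 1) a - oddPow (p - 1) b) *
          (oddPow (q + 1 - p) t - oddPow (q + 1 - p) s) with hXdef
  set w := |a| + |b| with hw
  set D := |a - b| with hD
  have hD0 : 0 ≤ D := abs_nonneg _
  have hDw : D ≤ w := abs_sub a b
  have hw0 : 0 ≤ w := hD0.trans hDw
  have hv : 0 < 2 - p := by linarith
  have hq0 : 0 < q := by linarith
  rw [show 1 - (q + 1 - p) = p - q by ring, show q + 1 - p + 1 = q + (2 - p) by ring] at hE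
  set c := (p - 1) * 2 ^ (p - q) with hc
  have hcpos : 0 < c := mul_pos (by linarith) (Real.rpow_pos_of_pos (by norm_num) _)
  have hA : 0 ≤ l * c⁻¹ * X := by positivity
  have hB : 0 ≤ l ^ (-(q / (2 - p))) * w ^ q := by positivity
  -- If the weight is at most l D^{2−p}, the surplus power D^{2−p} in the energy bound pays for it.
  -- Otherwise D is below l^{−1/(2−p)} w, which is the second term.
  rcases le_or_gt (w ^ (2 - p)) (l * D ^ (2 - p)) with hcase | hcase
  · rcases hw0.eq_or_lt with h0 | hwpos
    · have : D = 0 := le_antisymm (by linarith) hD0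
      rw [this, Real.zero_rpow hq0.ne']
      positivity
    · rw [Real.rpow_add_of_nonneg hD0 hq0.le hv.le] at hE
      have hwp : 0 < w ^ (2 - p) := Real.rpow_pos_of_pos hwpos _
      have h1 : c * D ^ q * w ^ (2 - p) ≤ l * X * w ^ (2 - p) := by
        have := mul_le_mul_of_nonneg_left hcase (show 0 ≤ c * D ^ q by positivity)
        nlinarith
      have h2 : c * D ^ q ≤ l * X := le_of_mul_le_mul_right h1 hwp
      have h3 : D ^ q ≤ l * c⁻¹ * X := by
        rw [show l * c⁻¹ * X = l * X / c by field_simp, le_div_iff₀ hcpos]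
        linarith
      linarith
  · have h1 : (l * D ^ (2 - p)) ^ (q / (2 - p)) ≤ (w ^ (2 - p)) ^ (q / (2 - p)) :=
      Real.rpow_le_rpow (by positivity) hcase.le (by positivity)
    rw [Real.mul_rpow hl.le (by positivity), ← Real.rpow_mul hD0, ← Real.rpow_mul hw0,
      mul_div_cancel₀ _ hv.ne'] at h1
    have h2 : D ^ q ≤ l ^ (-(q / (2 - p))) * w ^ q := by
      rw [Real.rpow_neg hl.le, inv_mul_eq_div, le_div_iff₀ (Real.rpow_pos_of_pos hl _)]
      linarith
    linarith

/-! ### Monotonicity of the set-valued sign and differences of products -/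

theorem setSgn_mono {a b z w : ℝ} (hz : z ∈ setSgn a) (hw : w ∈ setSgn b) (h : b < a) : w ≤ z := by
  rcases lt_or_ge 0 a with ha | ha
  · rw [hz.1 ha]; exact hw.2.2.2
  · rw [hw.2.1 (by linarith)]; exact hz.2.2.1

/-- The sign is a monotone graph. The selections z and w are unrelated only when a = b, and then t =
s makes the product vanish, so no knowledge of the selection at zeros is needed. -/
theorem setSgn_sub_mul_nonneg {k : ℝ} (hk : 0 < k) {a b z w s t : ℝ} (hz : z ∈ setSgn a)
    (hw : w ∈ setSgn b) (h : a - b = t - s) : 0 ≤ (z - w) * (oddPow k t - oddPow k s) := by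
  rcases lt_trichotomy b a with hab | hab | hab
  · exact mul_nonneg (sub_nonneg.2 (setSgn_mono hz hw hab))
      (sub_nonneg.2 (oddPow_mono hk (by linarith)))
  · have : t = s := by linarith
    simp [this]
  · exact mul_nonneg_of_nonpos_of_nonpos (sub_nonpos.2 (setSgn_mono hw hz hab))
      (sub_nonpos.2 (oddPow_mono hk (by linarith)))

/-- Differences of products `e * g` with `e ≥ 0`, up to an error carried by the support of `e`. -/
theorem abs_mul_sub_mul_sub_min_le {e f x y X Y : ℝ} (he : 0 ≤ e) (hf : 0 ≤ f)
    (hX : e ≠ 0 → |x| ≤ X) (hY : f ≠ 0 → |y| ≤ Y) (hX0 : 0 ≤ X) (hY0 : 0 ≤ Y) :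
    |e * x - f * y - min e f * (x - y)| ≤ |e - f| * (X + Y) := by
  rcases le_total e f with h | h
  · rw [min_eq_left h, show e * x - f * y - e * (x - y) = (e - f) * y by ring, abs_mul]
    rcases eq_or_ne f 0 with h0 | h0
    · have : e = 0 := by linarith
      simp [this, h0]
    · exact mul_le_mul_of_nonneg_left (by linarith [hY h0]) (abs_nonneg _)
  · rw [min_eq_right h, show e * x - f * y - f * (x - y) = (e - f) * x by ring, abs_mul]
    rcases eq_or_ne e 0 with h0 | h0
    · have : f = 0 := by linarith
      simp [this, h0]
    · exact mul_le_mul_of_nonneg_left (by linarith [hX h0]) (abs_nonneg _)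

/-! ### Singular kernels and their truncated mass -/

/-- Euclidean space of dimension `N`. -/
abbrev Euc (N : ℕ) := EuclideanSpace ℝ (Fin N)

/-- The weight `‖z‖^{N+s}` in `[0,∞]`. -/
noncomputable def singWeight {N : ℕ} (s : ℝ) (z : Euc N) : ENNReal :=
  ENNReal.ofReal (‖z‖ ^ ((N : ℝ) + s))

@[fun_prop]
theorem measurable_singWeight {N : ℕ} (s : ℝ) : Measurable (singWeight (N := N) s) := by
  unfold singWeight; fun_prop

theorem singWeight_neg {N : ℕ} (s : ℝ) (z : Euc N) : singWeight s (-z) = singWeight s z := by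
  simp [singWeight]

theorem singWeight_sub_comm {N : ℕ} (s : ℝ) (x y : Euc N) :
    singWeight s (x - y) = singWeight s (y - x) := by
  rw [← singWeight_neg, neg_sub]

theorem ofReal_div_singWeight {N : ℕ} (s t : ℝ) {z : Euc N} (hz : z ≠ 0) :
    ENNReal.ofReal t / singWeight s z = ENNReal.ofReal (t / ‖z‖ ^ ((N : ℝ) + s)) := by
  rw [singWeight, ENNReal.ofReal_div_of_pos (Real.rpow_pos_of_pos (norm_pos_iff.2 hz) _)]

/-- Only an inequality: at z = 0 the real quotient is 0 by convention, while the extended one may be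
infinite. -/
theorem ofReal_div_norm_le {N : ℕ} {s : ℝ} (t : ℝ) (z : Euc N) (hs : (N : ℝ) + s ≠ 0) :
    ENNReal.ofReal (t / ‖z‖ ^ ((N : ℝ) + s)) ≤ ENNReal.ofReal t / singWeight s z := by
  rcases eq_or_ne z 0 with rfl | hz
  · simp [Real.zero_rpow hs]
  · rw [ofReal_div_singWeight s t hz]

/-- The mass of the truncated singular kernel `min(1,‖z‖)^m / ‖z‖^{N+s}`. -/
noncomputable def kernelMass (N : ℕ) (s m : ℝ) : ENNReal :=
  ∫⁻ z : Euc N, ENNReal.ofReal (min 1 ‖z‖ ^ m) / singWeight s z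

/-- Near the origin the integrand is ‖z‖^{m−s−N}, integrable because m > s; at infinity it decays
like ‖z‖^{−N−s}, integrable because s > 0. -/
theorem kernelMass_lt_top {N : ℕ} (hN : 1 ≤ N) {s m : ℝ} (hs : 0 < s) (hsm : s < m) :
    kernelMass N s m < ⊤ := by
  have hfin : Module.finrank ℝ (Euc N) = N := by simp
  have hN' : Nontrivial (Euc N) :=
    Module.nontrivial_of_finrank_pos (R := ℝ) (by rw [hfin]; omega)
  have h1 : IntegrableOn (fun z : Euc N => ‖z‖ ^ (-((N : ℝ) + s - m))) (Metric.ball 0 1) := by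
    refine integrableOn_ball_of_norm_le_rpow (C := 1) (α := (N : ℝ) + s - m)
      (by rw [hfin]; exact hN) (by rw [hfin]; linarith) ?_
      (by fun_prop : Measurable _).aestronglyMeasurable
    refine Filter.Eventually.of_forall fun x => ?_
    rw [Real.norm_of_nonneg (Real.rpow_nonneg (norm_nonneg _) _), one_mul]
  have h2 : ∫⁻ z : Euc N, ENNReal.ofReal ((1 + ‖z‖) ^ (-((N : ℝ) + s))) < ⊤ :=
    finite_integral_one_add_norm (by rw [hfin]; linarith)
  have h3 : ∀ᵐ z : Euc N, ENNReal.ofReal (min 1 ‖z‖ ^ m) / singWeight s z ≤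
      (Metric.ball (0 : Euc N) 1).indicator
        (fun z => ENNReal.ofReal (‖z‖ ^ (-((N : ℝ) + s - m)))) z +
      ENNReal.ofReal (2 ^ ((N : ℝ) + s)) * ENNReal.ofReal ((1 + ‖z‖) ^ (-((N : ℝ) + s))) := by
    filter_upwards [compl_mem_ae_iff.2 (measure_singleton (0 : Euc N))] with z hz
    have hz0 : z ≠ 0 := hz
    have hn : 0 < ‖z‖ := norm_pos_iff.2 hz0
    rw [ofReal_div_singWeight s _ hz0]
    by_cases hb : z ∈ Metric.ball (0 : Euc N) 1
    · rw [indicator_of_mem hb]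
      refine le_add_right (ENNReal.ofReal_le_ofReal ?_)
      have : ‖z‖ < 1 := by simpa using hb
      rw [min_eq_right this.le, ← Real.rpow_sub hn]
      apply le_of_eq; congr 1; ring
    · rw [indicator_of_notMem hb, zero_add, ← ENNReal.ofReal_mul (by positivity)]
      have : 1 ≤ ‖z‖ := by simpa using hb
      refine ENNReal.ofReal_le_ofReal ?_
      rw [min_eq_left this, Real.one_rpow, Real.rpow_neg (by positivity), ← div_eq_mul_inv,
        ← Real.div_rpow (by norm_num) (by positivity), one_div, ← Real.inv_rpow hn.le]
      refine Real.rpow_le_rpow (by positivity) ?_ (by positivity)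
      rw [inv_eq_one_div, div_le_div_iff₀ hn (by positivity)]
      linarith
  refine (lintegral_mono_ae h3).trans_lt ?_
  rw [lintegral_add_left ((by fun_prop : Measurable fun z : Euc N =>
    ENNReal.ofReal (‖z‖ ^ (-((N : ℝ) + s - m)))).indicator Metric.isOpen_ball.measurableSet),
    lintegral_const_mul _ (by fun_prop), lintegral_indicator Metric.isOpen_ball.measurableSet]
  exact ENNReal.add_lt_top.2 ⟨h1.lintegral_lt_top, ENNReal.mul_lt_top ENNReal.ofReal_lt_top h2⟩

/-- Since d ≤ 1, min(1, ‖z‖/d) ≤ d^{−1} min(1, ‖z‖), which reduces to truncation at scale one. -/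
theorem lintegral_truncated_kernel_le {N : ℕ} {s m d : ℝ} (hm : 0 ≤ m) (hd : 0 < d) (hd1 : d ≤ 1)
    (x : Euc N) :
    ∫⁻ y : Euc N, ENNReal.ofReal (min 1 (‖x - y‖ / d) ^ m) / singWeight s (x - y) ≤
      ENNReal.ofReal (d ^ (-m)) * kernelMass N s m := by
  rw [lintegral_sub_left_eq_self
    (fun z : Euc N => ENNReal.ofReal (min 1 (‖z‖ / d) ^ m) / singWeight s z) x, kernelMass,
    ← lintegral_const_mul' _ _ ENNReal.ofReal_ne_top]
  refine lintegral_mono fun z => ?_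
  rw [← mul_div_assoc, ← ENNReal.ofReal_mul (by positivity)]
  refine ENNReal.div_le_div_right (ENNReal.ofReal_le_ofReal ?_) _
  rw [Real.rpow_neg hd.le, ← Real.inv_rpow hd.le, ← Real.mul_rpow (by positivity) (by positivity)]
  refine Real.rpow_le_rpow (by positivity) ?_ hm
  rw [mul_min_of_nonneg _ _ (by positivity), mul_one, inv_mul_eq_div]
  exact min_le_min_right _ (by rw [le_inv_comm₀ one_pos hd]; simpa using hd1)

/-- Tonelli together with the swap of variables. The row bound is needed only where G is nonzero,
which lets kernels depending on u be estimated on a ball alone. -/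
theorem lintegral_symm_kernel_le {α : Type*} [MeasurableSpace α] {μ : Measure α} [SFinite μ]
    {k : α × α → ENNReal} (hk : Measurable k) (hsymm : ∀ x y, k (x, y) = k (y, x))
    {G : α → ENNReal} (hG : Measurable G) {K : ENNReal}
    (hK : ∀ x, G x ≠ 0 → ∫⁻ y, k (x, y) ∂μ ≤ K) :
    ∫⁻ z, k z * (G z.1 + G z.2) ∂(μ.prod μ) ≤ 2 * K * ∫⁻ x, G x ∂μ := by
  have h1 : ∫⁻ z, k z * G z.1 ∂(μ.prod μ) ≤ K * ∫⁻ x, G x ∂μ := by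
    rw [lintegral_prod _ (by fun_prop), ← lintegral_const_mul _ hG]
    refine lintegral_mono fun x => ?_
    simp only
    rw [lintegral_mul_const _ (by fun_prop)]
    rcases eq_or_ne (G x) 0 with h | h
    · simp [h]
    · exact mul_le_mul_left (hK x h) _
  have h2 : ∫⁻ z, k z * G z.2 ∂(μ.prod μ) = ∫⁻ z, k z * G z.1 ∂(μ.prod μ) := by
    rw [← lintegral_prod_swap]
    refine lintegral_congr fun z => ?_
    simp only [Prod.swap]
    rw [hsymm]
  simp only [mul_add]
  rw [lintegral_add_left (by fun_prop), h2, mul_assoc, two_mul]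
  exact add_le_add h1 h1

/-! ### Radial cutoffs -/

/-- The piecewise linear cutoff that is `1` on the ball of radius `ρ - d` and `0` outside the ball
of radius `ρ`. -/
noncomputable def radialCutoff {N : ℕ} (x₀ : Euc N) (ρ d : ℝ) (x : Euc N) : ℝ :=
  max 0 (min 1 ((ρ - ‖x - x₀‖) / d))

section cutoff
variable {N : ℕ} (x₀ : Euc N) {ρ d : ℝ}

theorem continuous_radialCutoff : Continuous (radialCutoff x₀ ρ d) := by
  unfold radialCutoff; fun_prop

theorem radialCutoff_nonneg (x : Euc N) : 0 ≤ radialCutoff x₀ ρ d x := le_max_left _ _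

theorem radialCutoff_le_one (x : Euc N) : radialCutoff x₀ ρ d x ≤ 1 :=
  max_le zero_le_one (min_le_left _ _)

theorem radialCutoff_eq_one (hd : 0 < d) {x : Euc N} (hx : x ∈ Metric.closedBall x₀ (ρ - d)) :
    radialCutoff x₀ ρ d x = 1 := by
  rw [mem_closedBall_iff_norm] at hx
  rw [radialCutoff, min_eq_left, max_eq_right zero_le_one]
  rw [le_div_iff₀ hd]; linarith

theorem mem_of_radialCutoff_ne_zero (hd : 0 < d) {x : Euc N} (hx : radialCutoff x₀ ρ d x ≠ 0) :
    x ∈ Metric.closedBall x₀ ρ := by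
  by_contra h
  rw [mem_closedBall_iff_norm, not_le] at h
  refine hx (max_eq_left ((min_le_right _ _).trans ?_))
  exact div_nonpos_of_nonpos_of_nonneg (by linarith) hd.le

theorem abs_radialCutoff_sub_le (hd : 0 < d) (x y : Euc N) :
    |radialCutoff x₀ ρ d x - radialCutoff x₀ ρ d y| ≤ min 1 (‖x - y‖ / d) := by
  refine le_min ?_ ?_
  · rw [abs_le]
    constructor <;> linarith [radialCutoff_nonneg x₀ (ρ := ρ) (d := d) x,
      radialCutoff_nonneg x₀ (ρ := ρ) (d := d) y, radialCutoff_le_one x₀ (ρ := ρ) (d := d) x,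
      radialCutoff_le_one x₀ (ρ := ρ) (d := d) y]
  · unfold radialCutoff
    refine (abs_max_sub_max_le_max _ _ _ _).trans ?_
    rw [sub_self, abs_zero, max_eq_right (abs_nonneg _)]
    refine (abs_min_sub_min_le_max _ _ _ _).trans ?_
    rw [sub_self, abs_zero, max_eq_right (abs_nonneg _), ← sub_div, abs_div, abs_of_pos hd]
    refine div_le_div_of_nonneg_right ?_ hd.le
    have := abs_norm_sub_norm_le (y - x₀) (x - x₀)
    rw [sub_sub_sub_cancel_right, norm_sub_rev y x] at this
    rwa [sub_sub_sub_cancel_left]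

end cutoff

/-! ### Translations, the nonlocal coefficient, and product integrals -/

theorem setLIntegral_closedBall_comp_add_le {N : ℕ} (f : Euc N → ENNReal) (x₀ k : Euc N)
    {ρ ρ' : ℝ} (h : ρ + ‖k‖ ≤ ρ') :
    ∫⁻ x in Metric.closedBall x₀ ρ, f (x + k) ≤ ∫⁻ x in Metric.closedBall x₀ ρ', f x := by
  rw [← lintegral_indicator Metric.isClosed_closedBall.measurableSet,
    ← lintegral_indicator Metric.isClosed_closedBall.measurableSet,
    ← lintegral_add_right_eq_self ((Metric.closedBall x₀ ρ').indicator f) k]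
  refine lintegral_mono fun x => ?_
  by_cases hx : x ∈ Metric.closedBall x₀ ρ
  · rw [indicator_of_mem hx, indicator_of_mem]
    rw [mem_closedBall_iff_norm] at hx ⊢
    calc ‖x + k - x₀‖ = ‖(x - x₀) + k‖ := by congr 1; abel
      _ ≤ ‖x - x₀‖ + ‖k‖ := norm_add_le _ _
      _ ≤ ρ' := by linarith
  · rw [indicator_of_notMem hx]; exact zero_le

theorem abs_sub_rpow_le_add {r : ℝ} (hr : 0 ≤ r) (hr1 : r ≤ 1) (s t : ℝ) :
    |s - t| ^ r ≤ |s| ^ r + |t| ^ r :=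
  (Real.rpow_le_rpow (abs_nonneg _) (abs_sub s t) hr).trans
    (Real.rpow_add_le_add_rpow (abs_nonneg _) (abs_nonneg _) hr hr1)

/-- The nonlocal coefficient appearing in the cutoff errors is locally bounded. -/
theorem lintegral_increment_truncated_kernel_le {N : ℕ} {p s M R d : ℝ} {u : Euc N → ℝ}
    {x₀ x : Euc N} (hp : 1 < p) (hp2 : p < 2) (hs : 0 < s) (hs1 : s < 1)
    (hR : R ≤ 1) (hd : 0 < d) (hM : 0 ≤ M) (hb : ∀ x ∈ Metric.ball x₀ R, |u x| ≤ M)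
    (ht : ∫⁻ y in (Metric.ball x₀ R)ᶜ, ENNReal.ofReal (|u y| ^ (p - 1)) / singWeight s (y - x₀) ≤
      ENNReal.ofReal (M ^ (p - 1) / R ^ s))
    (hx : x ∈ Metric.closedBall x₀ (R - d)) :
    ∫⁻ y, ENNReal.ofReal (|u x - u y| ^ (p - 1) * min 1 (‖x - y‖ / d)) / singWeight s (x - y) ≤
      ENNReal.ofReal (M ^ (p - 1) * d ^ (-((N : ℝ) + 2))) * (2 * kernelMass N s 1 + 1) := by
  have hx' : ‖x - x₀‖ ≤ R - d := mem_closedBall_iff_norm.1 hx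
  have hdR : d ≤ R := by linarith [norm_nonneg (x - x₀)]
  have hd1 : d ≤ 1 := hdR.trans hR
  have hxb : |u x| ≤ M := hb x (by rw [mem_ball_iff_norm]; linarith)
  have hp0 : 0 ≤ p - 1 := by linarith
  have hNs : (N : ℝ) + s ≠ 0 := by positivity
  have hMp : 0 ≤ M ^ (p - 1) := Real.rpow_nonneg hM _
  set B := Metric.ball x₀ R with hB
  have hBm : MeasurableSet Bᶜ := Metric.isOpen_ball.measurableSet.compl
  have hpt : ∀ y, ENNReal.ofReal (|u x - u y| ^ (p - 1) * min 1 (‖x - y‖ / d)) /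
        singWeight s (x - y) ≤
      ENNReal.ofReal (2 * M ^ (p - 1)) *
        (ENNReal.ofReal (min 1 (‖x - y‖ / d) ^ (1 : ℝ)) / singWeight s (x - y)) +
      Bᶜ.indicator (fun y => ENNReal.ofReal (d ^ (-((N : ℝ) + s))) *
        (ENNReal.ofReal (|u y| ^ (p - 1)) / singWeight s (y - x₀))) y := by
    intro y
    have h1 : |u x - u y| ^ (p - 1) ≤ |u x| ^ (p - 1) + |u y| ^ (p - 1) :=
      abs_sub_rpow_le_add hp0 (by linarith) _ _
    have h2 : |u x| ^ (p - 1) ≤ M ^ (p - 1) := Real.rpow_le_rpow (abs_nonneg _) hxb hp0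
    have hm0 : 0 ≤ min 1 (‖x - y‖ / d) := by positivity
    have hm1 : min 1 (‖x - y‖ / d) ≤ 1 := min_le_left _ _
    rw [Real.rpow_one, ← mul_div_assoc, ← ENNReal.ofReal_mul (by positivity)]
    by_cases hy : y ∈ B
    · rw [indicator_of_notMem (not_not.2 hy), add_zero]
      have h3 : |u y| ^ (p - 1) ≤ M ^ (p - 1) := Real.rpow_le_rpow (abs_nonneg _) (hb y hy) hp0
      exact ENNReal.div_le_div_right (ENNReal.ofReal_le_ofReal
        (mul_le_mul_of_nonneg_right (by linarith) hm0)) _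
    · have hyR : R ≤ ‖y - x₀‖ := by
        rwa [hB, mem_ball_iff_norm, not_lt] at hy
      -- Here R ≤ 1 matters: ‖x−y‖ ≥ ‖y−x₀‖ − (R−d), and (1−d)‖y−x₀‖ ≥ (1−d)R ≥ R − d. The kernel
      -- centred at x is thus comparable to the tail kernel centred at x₀, up to a power of d.
      have hyx : d * ‖y - x₀‖ ≤ ‖x - y‖ := by
        have h5 : ‖y - x₀‖ ≤ ‖x - y‖ + ‖x - x₀‖ := by
          rw [norm_sub_rev x y]; exact norm_sub_le_norm_sub_add_norm_sub _ _ _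
        nlinarith
      have hy0 : 0 < ‖y - x₀‖ := by linarith
      have hyne : y - x₀ ≠ 0 := norm_pos_iff.1 hy0
      have hxyne : x - y ≠ 0 := norm_pos_iff.1 (lt_of_lt_of_le (by positivity) hyx)
      have hxy0 : 0 < ‖x - y‖ := norm_pos_iff.2 hxyne
      rw [indicator_of_mem hy, ofReal_div_singWeight _ _ hxyne, ofReal_div_singWeight _ _ hxyne,
        ofReal_div_singWeight _ _ hyne, ← ENNReal.ofReal_mul (by positivity),
        ← ENNReal.ofReal_add (by positivity) (by positivity)]
      refine ENNReal.ofReal_le_ofReal ?_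
      have h6 : d ^ (-((N : ℝ) + s)) * (|u y| ^ (p - 1) / ‖y - x₀‖ ^ ((N : ℝ) + s)) =
          |u y| ^ (p - 1) / (d * ‖y - x₀‖) ^ ((N : ℝ) + s) := by
        rw [Real.mul_rpow hd.le hy0.le, Real.rpow_neg hd.le]; field_simp
      have h7 : |u y| ^ (p - 1) / ‖x - y‖ ^ ((N : ℝ) + s) ≤
          |u y| ^ (p - 1) / (d * ‖y - x₀‖) ^ ((N : ℝ) + s) := by
        apply div_le_div_of_nonneg_left (by positivity) (by positivity)
        exact Real.rpow_le_rpow (by positivity) hyx (by positivity)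
      rw [h6]
      refine le_trans ?_ (add_le_add_right h7 _)
      rw [← add_div]
      refine div_le_div_of_nonneg_right ?_ (by positivity)
      have h8 : 0 ≤ |u y| ^ (p - 1) := by positivity
      calc _ ≤ (M ^ (p - 1) + |u y| ^ (p - 1)) * min 1 (‖x - y‖ / d) :=
            mul_le_mul_of_nonneg_right (by linarith) hm0
        _ ≤ _ := by nlinarith
  refine (lintegral_mono hpt).trans ?_
  rw [lintegral_add_left (by fun_prop), lintegral_const_mul' _ _ ENNReal.ofReal_ne_top,
    lintegral_indicator hBm, lintegral_const_mul' _ _ ENNReal.ofReal_ne_top]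
  -- All negative powers of d are absorbed into one. The worst is N + 2s < N + 2: N + s from
  -- recentring the kernel and s from the normalisation R^{−s} of the tail.
  have e1 : d ^ (-(1 : ℝ)) ≤ d ^ (-((N : ℝ) + 2)) :=
    Real.rpow_le_rpow_of_exponent_ge hd hd1 (by linarith [(Nat.cast_nonneg N : (0 : ℝ) ≤ N)])
  have e2 : d ^ (-((N : ℝ) + s)) * (M ^ (p - 1) / R ^ s) ≤
      M ^ (p - 1) * d ^ (-((N : ℝ) + 2)) := by
    have h1 : M ^ (p - 1) / R ^ s ≤ M ^ (p - 1) / d ^ s :=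
      div_le_div_of_nonneg_left hMp (by positivity) (Real.rpow_le_rpow hd.le hdR hs.le)
    have h2 : d ^ (-((N : ℝ) + s)) * (M ^ (p - 1) / d ^ s) =
        M ^ (p - 1) * d ^ (-((N : ℝ) + s) - s) := by
      rw [Real.rpow_sub hd]; ring
    have h3 : d ^ (-((N : ℝ) + s) - s) ≤ d ^ (-((N : ℝ) + 2)) :=
      Real.rpow_le_rpow_of_exponent_ge hd hd1 (by linarith)
    calc _ ≤ d ^ (-((N : ℝ) + s)) * (M ^ (p - 1) / d ^ s) :=
          mul_le_mul_of_nonneg_left h1 (by positivity)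
      _ ≤ _ := by rw [h2]; exact mul_le_mul_of_nonneg_left h3 hMp
  calc _ ≤ ENNReal.ofReal (2 * M ^ (p - 1)) *
          (ENNReal.ofReal (d ^ (-(1 : ℝ))) * kernelMass N s 1) +
        ENNReal.ofReal (d ^ (-((N : ℝ) + s))) * ENNReal.ofReal (M ^ (p - 1) / R ^ s) := by
        gcongr
        exact lintegral_truncated_kernel_le zero_le_one hd hd1 x
    _ ≤ ENNReal.ofReal (2 * (M ^ (p - 1) * d ^ (-((N : ℝ) + 2)))) * kernelMass N s 1 +
        ENNReal.ofReal (M ^ (p - 1) * d ^ (-((N : ℝ) + 2))) := by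
        rw [← mul_assoc, ← ENNReal.ofReal_mul (by positivity), ← ENNReal.ofReal_mul (by positivity)]
        have e3 : 2 * M ^ (p - 1) * d ^ (-(1 : ℝ)) ≤ 2 * (M ^ (p - 1) * d ^ (-((N : ℝ) + 2))) := by
          rw [mul_assoc]
          exact mul_le_mul_of_nonneg_left (mul_le_mul_of_nonneg_left e1 hMp) (by norm_num)
        exact add_le_add (mul_le_mul_left (ENNReal.ofReal_le_ofReal e3) _)
          (ENNReal.ofReal_le_ofReal e2)
    _ = _ := by
        rw [ENNReal.ofReal_mul (by norm_num), ENNReal.ofReal_ofNat]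
        ring

/-- The Gagliardo integral over a set, as an integral over the product space. -/
theorem lintegral_prod_lt_top_of_gagliardo {N : ℕ} {γ Q : ℝ} (hQ : 0 < Q) {A : Set (Euc N)}
    {u : Euc N → ℝ} (hu : Measurable u) (h : gagliardo γ Q A u < ⊤) :
    ∫⁻ z in A ×ˢ A, ENNReal.ofReal (|u z.1 - u z.2| ^ Q) / singWeight (γ * Q) (z.1 - z.2)
      ∂(volume.prod volume) < ⊤ := by
  rw [← Measure.prod_restrict, lintegral_prod _ (by fun_prop)]
  have : 0 < 1 / Q := by positivity
  exact (ENNReal.rpow_lt_top_iff_of_pos this).1 h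

theorem measurePreserving_diagonal_add {N : ℕ} (h : Euc N) :
    MeasurePreserving (fun z : Euc N × Euc N => (z.1 + h, z.2 + h))
      (volume.prod volume) (volume.prod volume) :=
  (measurePreserving_add_right volume h).prod (measurePreserving_add_right volume h)

theorem measurableEmbedding_diagonal_add {N : ℕ} (h : Euc N) :
    MeasurableEmbedding (fun z : Euc N × Euc N => (z.1 + h, z.2 + h)) :=
  ((MeasurableEquiv.addRight h).prodCongr (MeasurableEquiv.addRight h)).measurableEmbedding

theorem setLIntegral_prod_comp_add_le {N : ℕ} {S B : Set (Euc N)} {h : Euc N}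
    (hS : MeasurableSet S) (hB : MeasurableSet B) (hSB : ∀ x ∈ S, x + h ∈ B)
    (F : Euc N × Euc N → ENNReal) :
    ∫⁻ z in S ×ˢ S, F (z.1 + h, z.2 + h) ∂(volume.prod volume) ≤
      ∫⁻ z in B ×ˢ B, F z ∂(volume.prod volume) := by
  rw [← lintegral_indicator (hS.prod hS), ← lintegral_indicator (hB.prod hB),
    ← (measurePreserving_diagonal_add h).lintegral_comp_emb (measurableEmbedding_diagonal_add h)
      ((B ×ˢ B).indicator F)]
  refine lintegral_mono fun z => ?_
  by_cases hz : z ∈ S ×ˢ S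
  · rw [indicator_of_mem hz, indicator_of_mem]
    exact ⟨hSB _ hz.1, hSB _ hz.2⟩
  · rw [indicator_of_notMem hz]; exact zero_le

/-! ### Admissible exponents and local solutions -/

/-- The admissible range of exponents. -/
structure AdmissibleExponents (N : ℕ) (p s₁ sp : ℝ) : Prop where
  one_le_dim : 1 ≤ N
  one_lt : 1 < p
  lt_two : p < 2
  s₁_pos : 0 < s₁
  s₁_lt : s₁ < 1
  sp_pos : 0 < sp
  mul_lt : sp * p < 1

/-- A measurable function, bounded by `M` on `B_R(x₀)`, with tail controlled by `M`, that solves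
the equation in `B_R(x₀)`. -/
structure LocalSolution {N : ℕ} (p s₁ sp : ℝ) (x₀ : Euc N) (R M : ℝ) (u : Euc N → ℝ) : Prop where
  measurable : Measurable u
  radius_le_one : R ≤ 1
  one_le_bound : 1 ≤ M
  bound : ∀ x ∈ Metric.ball x₀ R, |u x| ≤ M
  tail_le : ∫⁻ y in (Metric.ball x₀ R)ᶜ,
      ENNReal.ofReal (|u y| ^ (p - 1)) / singWeight (sp * p) (y - x₀) ≤
    ENNReal.ofReal (M ^ (p - 1) / R ^ (sp * p))
  gagliardo_one : gagliardo s₁ 1 (Metric.ball x₀ R) u < ⊤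
  gagliardo_p : gagliardo sp p (Metric.ball x₀ R) u < ⊤
  exists_sign : ∃ Z : Euc N × Euc N → ℝ, AEStronglyMeasurable Z (volume.prod volume) ∧
    (∀ᵐ z ∂(volume.prod volume), Z z ∈ setSgn (u z.1 - u z.2)) ∧
    ∀ φ : Euc N → ℝ, IsTestFunction p s₁ sp (Metric.ball x₀ R) φ →
      0 = (∫ z, Z z * (φ z.1 - φ z.2) / ‖z.1 - z.2‖ ^ ((N : ℝ) + s₁) ∂(volume.prod volume)) +
        ∫ z, oddPow (p - 1) (u z.1 - u z.2) * (φ z.1 - φ z.2) /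
          ‖z.1 - z.2‖ ^ ((N : ℝ) + sp * p) ∂(volume.prod volume)

/-! ### The increment test function -/

@[fun_prop]
theorem measurable_oddPow (r : ℝ) : Measurable (oddPow r) := by
  unfold oddPow; fun_prop

@[fun_prop]
theorem measurable_radialCutoff {N : ℕ} (x₀ : Euc N) (ρ d : ℝ) :
    Measurable (radialCutoff x₀ ρ d) := (continuous_radialCutoff x₀).measurable

/-- The test function: a cutoff times an odd power of the increment of `u`. -/
noncomputable def incrementTest {N : ℕ} (x₀ : Euc N) (ρ d β : ℝ) (h : Euc N) (u : Euc N → ℝ)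
    (x : Euc N) : ℝ :=
  radialCutoff x₀ ρ d x * oddPow β (u (x + h) - u x)

/-- A power of the increment of `u`, restricted to a ball. -/
noncomputable def incrementPow {N : ℕ} (x₀ : Euc N) (ρ β : ℝ) (h : Euc N) (u : Euc N → ℝ) :
    Euc N → ℝ :=
  (Metric.closedBall x₀ ρ).indicator fun x => |u (x + h) - u x| ^ β

section test
variable {N : ℕ} {x₀ : Euc N} {ρ d β : ℝ} {h : Euc N} {u : Euc N → ℝ}

theorem measurable_incrementTest (hu : Measurable u) :
    Measurable (incrementTest x₀ ρ d β h u) := by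
  unfold incrementTest; fun_prop

theorem measurable_incrementPow (hu : Measurable u) :
    Measurable (incrementPow x₀ ρ β h u) :=
  (by fun_prop : Measurable fun x => |u (x + h) - u x| ^ β).indicator
    Metric.isClosed_closedBall.measurableSet

theorem incrementPow_nonneg (x : Euc N) : 0 ≤ incrementPow x₀ ρ β h u x :=
  indicator_nonneg (fun _ _ => by positivity) x

/-- Taking the minimum of the two cutoffs leaves a principal part with nonnegative weight, to which
monotonicity applies. The remainder involves δ_h u only inside the ball of radius ρ. -/
theorem abs_incrementTest_sub_sub_le (hβ : 0 < β) (hd : 0 < d) (x y : Euc N) :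
    |incrementTest x₀ ρ d β h u x - incrementTest x₀ ρ d β h u y -
        min (radialCutoff x₀ ρ d x) (radialCutoff x₀ ρ d y) *
          (oddPow β (u (x + h) - u x) - oddPow β (u (y + h) - u y))| ≤
      min 1 (‖x - y‖ / d) * (incrementPow x₀ ρ β h u x + incrementPow x₀ ρ β h u y) := by
  have key : ∀ x, radialCutoff x₀ ρ d x ≠ 0 →
      |oddPow β (u (x + h) - u x)| ≤ incrementPow x₀ ρ β h u x := by
    intro x hx
    rw [incrementPow, indicator_of_mem (mem_of_radialCutoff_ne_zero x₀ hd hx), abs_oddPow hβ]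
  refine (abs_mul_sub_mul_sub_min_le (radialCutoff_nonneg x₀ x) (radialCutoff_nonneg x₀ y)
    (key x) (key y) (incrementPow_nonneg x) (incrementPow_nonneg y)).trans ?_
  exact mul_le_mul_of_nonneg_right (abs_radialCutoff_sub_le x₀ hd x y)
    (add_nonneg (incrementPow_nonneg x) (incrementPow_nonneg y))

/-- As β ≥ 1, the odd power is Lipschitz on [−2M, 2M], where the increments live. This crude bound
serves for finiteness only, not for the quantitative estimate. -/
theorem abs_incrementTest_sub_le {M : ℝ} (hβ : 1 ≤ β) (hd : 0 < d)
    (hb : ∀ x ∈ Metric.closedBall x₀ ρ, |u x| ≤ M)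
    (hb' : ∀ x ∈ Metric.closedBall x₀ ρ, |u (x + h)| ≤ M) (x y : Euc N) :
    |incrementTest x₀ ρ d β h u x - incrementTest x₀ ρ d β h u y| ≤
      (Metric.closedBall x₀ ρ ×ˢ Metric.closedBall x₀ ρ).indicator
        (fun z => β * (2 * M) ^ (β - 1) * (|u (z.1 + h) - u (z.2 + h)| + |u z.1 - u z.2|)) (x, y) +
      min 1 (‖x - y‖ / d) * (incrementPow x₀ ρ β h u x + incrementPow x₀ ρ β h u y) := by
  have h1 := abs_incrementTest_sub_sub_le (x₀ := x₀) (ρ := ρ) (h := h) (u := u)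
    (by linarith : 0 < β) hd x y
  have h2 : |min (radialCutoff x₀ ρ d x) (radialCutoff x₀ ρ d y) *
      (oddPow β (u (x + h) - u x) - oddPow β (u (y + h) - u y))| ≤
      (Metric.closedBall x₀ ρ ×ˢ Metric.closedBall x₀ ρ).indicator
        (fun z => β * (2 * M) ^ (β - 1) * (|u (z.1 + h) - u (z.2 + h)| + |u z.1 - u z.2|))
        (x, y) := by
    have hx0 := radialCutoff_nonneg x₀ (ρ := ρ) (d := d) x
    have hy0 := radialCutoff_nonneg x₀ (ρ := ρ) (d := d) y
    by_cases hxy : (x, y) ∈ Metric.closedBall x₀ ρ ×ˢ Metric.closedBall x₀ ρ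
    · rw [indicator_of_mem hxy]
      have bx := abs_sub (u (x + h)) (u x)
      have by' := abs_sub (u (y + h)) (u y)
      have cx := hb x hxy.1
      have cy := hb y hxy.2
      have dx := hb' x hxy.1
      have dy := hb' y hxy.2
      have hM : 0 ≤ M := (abs_nonneg _).trans cx
      have h3 := abs_oddPow_sub_le (m := 2 * M) hβ (s := u (y + h) - u y) (t := u (x + h) - u x)
        (by linarith) (by linarith)
      have h4 : |u (x + h) - u x - (u (y + h) - u y)| ≤
          |u (x + h) - u (y + h)| + |u x - u y| := by
        rw [show u (x + h) - u x - (u (y + h) - u y) =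
          (u (x + h) - u (y + h)) - (u x - u y) by ring]
        exact abs_sub _ _
      have h5 : |min (radialCutoff x₀ ρ d x) (radialCutoff x₀ ρ d y)| ≤ 1 := by
        rw [abs_of_nonneg (le_min hx0 hy0)]
        exact (min_le_left _ _).trans (radialCutoff_le_one x₀ x)
      rw [abs_mul]
      calc _ ≤ 1 * |oddPow β (u (x + h) - u x) - oddPow β (u (y + h) - u y)| :=
            mul_le_mul_of_nonneg_right h5 (abs_nonneg _)
        _ ≤ _ := by
          rw [one_mul]
          exact h3.trans (mul_le_mul_of_nonneg_left h4 (by positivity))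
    · rw [indicator_of_notMem hxy]
      have : min (radialCutoff x₀ ρ d x) (radialCutoff x₀ ρ d y) = 0 := by
        by_contra hne
        apply hxy
        constructor
        · refine mem_of_radialCutoff_ne_zero x₀ hd fun h0 => hne ?_
          simp only at h0
          rw [h0, min_eq_left hy0]
        · refine mem_of_radialCutoff_ne_zero x₀ hd fun h0 => hne ?_
          simp only at h0
          rw [h0, min_eq_right hx0]
      simp [this]
  have h3 := abs_sub_abs_le_abs_sub (incrementTest x₀ ρ d β h u x - incrementTest x₀ ρ d β h u y)
    (min (radialCutoff x₀ ρ d x) (radialCutoff x₀ ρ d y) *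
      (oddPow β (u (x + h) - u x) - oddPow β (u (y + h) - u y)))
  linarith

theorem incrementPow_le {M : ℝ} (hβ : 0 ≤ β)
    (hb : ∀ x ∈ Metric.closedBall x₀ ρ, |u x| ≤ M)
    (hb' : ∀ x ∈ Metric.closedBall x₀ ρ, |u (x + h)| ≤ M) (x : Euc N) :
    incrementPow x₀ ρ β h u x ≤ (Metric.closedBall x₀ ρ).indicator (fun _ => (2 * M) ^ β) x := by
  refine indicator_le_indicator' fun hx => ?_
  refine Real.rpow_le_rpow (abs_nonneg _) ?_ hβ
  linarith [abs_sub (u (x + h)) (u x), hb x hx, hb' x hx]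

end test

theorem add_rpow_le_two_rpow_mul {Q a b : ℝ} (hQ : 0 ≤ Q) (ha : 0 ≤ a) (hb : 0 ≤ b) :
    (a + b) ^ Q ≤ 2 ^ Q * (a ^ Q + b ^ Q) := by
  have h1 : (a + b) ^ Q ≤ (2 * max a b) ^ Q :=
    Real.rpow_le_rpow (by positivity) (by linarith [le_max_left a b, le_max_right a b]) hQ
  rw [Real.mul_rpow (by norm_num) (le_max_of_le_left ha)] at h1
  refine h1.trans (mul_le_mul_of_nonneg_left ?_ (by positivity))
  rcases max_cases a b with h | h <;> rw [h.1] <;>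
    linarith [Real.rpow_nonneg ha Q, Real.rpow_nonneg hb Q]

/-! ### Finite fractional energy of the test function -/

section finiteness
variable {N : ℕ} {p s₁ sp : ℝ} {x₀ : Euc N} {ρ d R M β : ℝ} {h : Euc N} {u : Euc N → ℝ}

theorem add_mem_ball_of_mem_closedBall {x : Euc N} (hd : 0 < d) (hρ : ρ + 2 * d ≤ R) (hh : ‖h‖ ≤ d)
    (hx : x ∈ Metric.closedBall x₀ ρ) : x + h ∈ Metric.ball x₀ R := by
  rw [mem_closedBall_iff_norm] at hx
  rw [mem_ball_iff_norm]
  calc ‖x + h - x₀‖ = ‖(x - x₀) + h‖ := by congr 1; abel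
    _ ≤ ‖x - x₀‖ + ‖h‖ := norm_add_le _ _
    _ < R := by linarith

theorem mem_ball_of_mem_closedBall {x : Euc N} (hd : 0 < d) (hρ : ρ + 2 * d ≤ R)
    (hx : x ∈ Metric.closedBall x₀ ρ) : x ∈ Metric.ball x₀ R :=
  Metric.closedBall_subset_ball (by linarith) hx

/-- The increments of `u` and of its translate have finite joint Gagliardo energy. -/
theorem lintegral_joint_energy_lt_top {γ Q : ℝ} (hQ : 0 < Q) (hu : Measurable u) (hd : 0 < d)
    (hρ : ρ + 2 * d ≤ R) (hh : ‖h‖ ≤ d) (hg : gagliardo γ Q (Metric.ball x₀ R) u < ⊤) :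
    ∫⁻ z in Metric.closedBall x₀ ρ ×ˢ Metric.closedBall x₀ ρ,
      ENNReal.ofReal ((|u (z.1 + h) - u (z.2 + h)| + |u z.1 - u z.2|) ^ Q) /
        singWeight (γ * Q) (z.1 - z.2) ∂(volume.prod volume) < ⊤ := by
  have hfin := lintegral_prod_lt_top_of_gagliardo hQ hu hg
  have hS : MeasurableSet (Metric.closedBall x₀ ρ) := Metric.isClosed_closedBall.measurableSet
  have hB : MeasurableSet (Metric.ball x₀ R) := Metric.isOpen_ball.measurableSet
  set F : Euc N × Euc N → ENNReal := fun z =>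
    ENNReal.ofReal (|u z.1 - u z.2| ^ Q) / singWeight (γ * Q) (z.1 - z.2) with hF
  have hFm : Measurable F := by fun_prop
  have h1 := setLIntegral_prod_comp_add_le hS hB
    (fun x hx => add_mem_ball_of_mem_closedBall hd hρ hh hx) F
  have h2 : ∫⁻ z in Metric.closedBall x₀ ρ ×ˢ Metric.closedBall x₀ ρ, F z ∂(volume.prod volume) ≤
      ∫⁻ z in Metric.ball x₀ R ×ˢ Metric.ball x₀ R, F z ∂(volume.prod volume) :=
    lintegral_mono_set (prod_mono (fun x hx => mem_ball_of_mem_closedBall hd hρ hx)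
      (fun x hx => mem_ball_of_mem_closedBall hd hρ hx))
  have hpt : ∀ z : Euc N × Euc N,
      ENNReal.ofReal ((|u (z.1 + h) - u (z.2 + h)| + |u z.1 - u z.2|) ^ Q) /
        singWeight (γ * Q) (z.1 - z.2) ≤
      ENNReal.ofReal (2 ^ Q) * (F (z.1 + h, z.2 + h) + F z) := by
    intro z
    simp only [hF, add_sub_add_right_eq_sub]
    rw [← ENNReal.add_div, ← ENNReal.ofReal_add (by positivity) (by positivity), ← mul_div_assoc,
      ← ENNReal.ofReal_mul (by positivity)]
    exact ENNReal.div_le_div_right (ENNReal.ofReal_le_ofReal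
      (add_rpow_le_two_rpow_mul hQ.le (abs_nonneg _) (abs_nonneg _))) _
  refine (lintegral_mono hpt).trans_lt ?_
  rw [lintegral_const_mul' _ _ ENNReal.ofReal_ne_top, lintegral_add_left (by fun_prop)]
  exact ENNReal.mul_lt_top ENNReal.ofReal_lt_top
    (ENNReal.add_lt_top.2 ⟨h1.trans_lt hfin, h2.trans_lt hfin⟩)

theorem volume_closedBall_lt_top : volume (Metric.closedBall x₀ ρ) < ⊤ :=
  (isCompact_closedBall x₀ ρ).measure_lt_top

/-- The Lipschitz part is dominated by the joint Gagliardo energy of u and its translate. The cutoff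
part carries the kernel truncated with power Q, of finite mass because γQ < Q. It is applied with
(γ, Q) equal to (s₁, 1) and (s_p, p). -/
theorem lintegral_incrementTest_lt_top {γ Q : ℝ} (hN : 1 ≤ N) (hQ : 1 ≤ Q) (hγ : 0 < γ)
    (hγ1 : γ < 1) (hβ : 1 ≤ β) (hu : Measurable u) (hM : 0 ≤ M)
    (hb : ∀ x ∈ Metric.ball x₀ R, |u x| ≤ M) (hd : 0 < d) (hd1 : d ≤ 1)
    (hρ : ρ + 2 * d ≤ R) (hh : ‖h‖ ≤ d) (hg : gagliardo γ Q (Metric.ball x₀ R) u < ⊤) :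
    ∫⁻ z, ENNReal.ofReal (|incrementTest x₀ ρ d β h u z.1 - incrementTest x₀ ρ d β h u z.2| ^ Q) /
      singWeight (γ * Q) (z.1 - z.2) ∂(volume.prod volume) < ⊤ := by
  have hQ0 : 0 < Q := by linarith
  have hS : MeasurableSet (Metric.closedBall x₀ ρ) := Metric.isClosed_closedBall.measurableSet
  have hfin := lintegral_joint_energy_lt_top hQ0 hu hd hρ hh hg
  set S := Metric.closedBall x₀ ρ with hSdef
  have hb1 : ∀ x ∈ S, |u x| ≤ M := fun x hx => hb x (mem_ball_of_mem_closedBall hd hρ hx)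
  have hb2 : ∀ x ∈ S, |u (x + h)| ≤ M := fun x hx =>
    hb _ (add_mem_ball_of_mem_closedBall hd hρ hh hx)
  set L := β * (2 * M) ^ (β - 1) with hL
  have hL0 : 0 ≤ L := by positivity
  set G₀ := (2 * M) ^ β with hG₀
  have hG₀0 : 0 ≤ G₀ := by positivity
  set J : Euc N × Euc N → ENNReal := fun z =>
    ENNReal.ofReal ((|u (z.1 + h) - u (z.2 + h)| + |u z.1 - u z.2|) ^ Q) /
        singWeight (γ * Q) (z.1 - z.2) with hJ
  have hJm : Measurable J := by fun_prop
  set k : Euc N × Euc N → ENNReal := fun z =>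
    ENNReal.ofReal (min 1 (‖z.1 - z.2‖ / d) ^ Q) / singWeight (γ * Q) (z.1 - z.2) with hk
  have hkm : Measurable k := by fun_prop
  set I : Euc N → ENNReal := S.indicator fun _ => 1 with hI
  have hIm : Measurable I := measurable_const.indicator hS
  have hpt : ∀ z : Euc N × Euc N,
      ENNReal.ofReal (|incrementTest x₀ ρ d β h u z.1 - incrementTest x₀ ρ d β h u z.2| ^ Q) /
        singWeight (γ * Q) (z.1 - z.2) ≤
      (S ×ˢ S).indicator (fun z => ENNReal.ofReal (2 ^ Q * L ^ Q) * J z) z +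
        ENNReal.ofReal (2 ^ Q * (2 * G₀) ^ Q) * (k z * (I z.1 + I z.2)) := by
    rintro ⟨x, y⟩
    have h1 := abs_incrementTest_sub_le hβ hd hb1 hb2 x y
    set m := min 1 (‖x - y‖ / d) with hm
    have hm0 : 0 ≤ m := by positivity
    set A := (S ×ˢ S).indicator (fun z : Euc N × Euc N =>
      L * (|u (z.1 + h) - u (z.2 + h)| + |u z.1 - u z.2|)) (x, y) with hA
    have hA0 : 0 ≤ A := indicator_nonneg (fun _ _ => by positivity) _
    set T := incrementPow x₀ ρ β h u x + incrementPow x₀ ρ β h u y with hT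
    have hT0 : 0 ≤ T := add_nonneg (incrementPow_nonneg x) (incrementPow_nonneg y)
    have h2 : |incrementTest x₀ ρ d β h u x - incrementTest x₀ ρ d β h u y| ^ Q ≤
        2 ^ Q * (A ^ Q + (m * T) ^ Q) :=
      (Real.rpow_le_rpow (abs_nonneg _) h1 hQ0.le).trans
        (add_rpow_le_two_rpow_mul hQ0.le hA0 (by positivity))
    have h3 : ENNReal.ofReal (2 ^ Q * A ^ Q) / singWeight (γ * Q) (x - y) ≤
        (S ×ˢ S).indicator (fun z => ENNReal.ofReal (2 ^ Q * L ^ Q) * J z) (x, y) := by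
      by_cases hz : (x, y) ∈ S ×ˢ S
      · rw [hA, indicator_of_mem hz, indicator_of_mem hz, hJ, Real.mul_rpow hL0 (by positivity),
          ← mul_assoc, ENNReal.ofReal_mul (by positivity), mul_div_assoc]
      · rw [hA, indicator_of_notMem hz, indicator_of_notMem hz, Real.zero_rpow hQ0.ne']
        simp
    have h4 : ENNReal.ofReal (2 ^ Q * (m * T) ^ Q) / singWeight (γ * Q) (x - y) ≤
        ENNReal.ofReal (2 ^ Q * (2 * G₀) ^ Q) * (k (x, y) * (I x + I y)) := by
      have h5 : ENNReal.ofReal (T ^ Q) ≤ ENNReal.ofReal ((2 * G₀) ^ Q) * (I x + I y) := by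
        have tx := incrementPow_le (h := h) (u := u) (by linarith : 0 ≤ β) hb1 hb2 x
        have ty := incrementPow_le (h := h) (u := u) (by linarith : 0 ≤ β) hb1 hb2 y
        have cx : (S.indicator (fun _ => G₀) x : ℝ) ≤ G₀ := indicator_le_self' (by simp [hG₀0]) x
        have cy : (S.indicator (fun _ => G₀) y : ℝ) ≤ G₀ := indicator_le_self' (by simp [hG₀0]) y
        have hTle : T ^ Q ≤ (2 * G₀) ^ Q := Real.rpow_le_rpow hT0 (by linarith) hQ0.le
        by_cases hx : x ∈ S
        · rw [hI, indicator_of_mem hx]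
          calc _ ≤ ENNReal.ofReal ((2 * G₀) ^ Q) * 1 := by
                rw [mul_one]; exact ENNReal.ofReal_le_ofReal hTle
            _ ≤ _ := by gcongr; exact le_self_add
        · by_cases hy : y ∈ S
          · rw [hI, indicator_of_mem hy]
            calc _ ≤ ENNReal.ofReal ((2 * G₀) ^ Q) * 1 := by
                  rw [mul_one]; exact ENNReal.ofReal_le_ofReal hTle
              _ ≤ _ := by gcongr; exact le_add_self
          · have : T = 0 := by
              rw [hT, incrementPow, indicator_of_notMem hx, indicator_of_notMem hy, add_zero]
            rw [this, Real.zero_rpow hQ0.ne']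
            simp
      rw [Real.mul_rpow hm0 hT0, show 2 ^ Q * (m ^ Q * T ^ Q) = 2 ^ Q * m ^ Q * T ^ Q by ring,
        ENNReal.ofReal_mul (by positivity), ENNReal.ofReal_mul (by positivity),
        ENNReal.ofReal_mul (by positivity), hk]
      simp only [div_eq_mul_inv]
      calc _ ≤ ENNReal.ofReal (2 ^ Q) * ENNReal.ofReal (m ^ Q) *
            (ENNReal.ofReal ((2 * G₀) ^ Q) * (I x + I y)) * (singWeight (γ * Q) (x - y))⁻¹ := by
            gcongr
        _ = _ := by rw [hm]; simp only [div_eq_mul_inv]; ring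
    calc _ ≤ ENNReal.ofReal (2 ^ Q * A ^ Q + 2 ^ Q * (m * T) ^ Q) /
          singWeight (γ * Q) (x - y) :=
          ENNReal.div_le_div_right (ENNReal.ofReal_le_ofReal (by rw [← mul_add]; exact h2)) _
      _ ≤ _ := by
          rw [ENNReal.ofReal_add (by positivity) (by positivity), ENNReal.add_div]
          exact add_le_add h3 h4
  refine (lintegral_mono hpt).trans_lt ?_
  rw [lintegral_add_left ((hJm.const_mul _).indicator (hS.prod hS)),
    lintegral_indicator (hS.prod hS), lintegral_const_mul' _ _ ENNReal.ofReal_ne_top,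
    lintegral_const_mul' _ _ ENNReal.ofReal_ne_top]
  refine ENNReal.add_lt_top.2 ⟨ENNReal.mul_lt_top ENNReal.ofReal_lt_top hfin,
    ENNReal.mul_lt_top ENNReal.ofReal_lt_top ?_⟩
  refine (lintegral_symm_kernel_le hkm (fun x y => ?_) hIm
    (K := ENNReal.ofReal (d ^ (-Q)) * kernelMass N (γ * Q) Q) (fun x _ =>
      lintegral_truncated_kernel_le hQ0.le hd hd1 x)).trans_lt ?_
  · simp only [hk]
    rw [norm_sub_rev, singWeight_sub_comm]
  · have hkf := kernelMass_lt_top hN (s := γ * Q) (m := Q) (by positivity) (by nlinarith)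
    rw [hI, lintegral_indicator hS, lintegral_const, one_mul, Measure.restrict_apply_univ]
    exact ENNReal.mul_lt_top (ENNReal.mul_lt_top (by simp)
      (ENNReal.mul_lt_top ENNReal.ofReal_lt_top hkf)) volume_closedBall_lt_top

end finiteness

/-! ### Admissibility criteria and cutoff error kernels -/

section
variable {N : ℕ} {p s₁ sp : ℝ} {x₀ : Euc N} {ρ d R M β : ℝ} {h : Euc N} {u : Euc N → ℝ}

theorem lintegral_diagonal_add (F : Euc N × Euc N → ENNReal) (h : Euc N) :
    ∫⁻ z, F (z.1 + h, z.2 + h) ∂(volume.prod volume) = ∫⁻ z, F z ∂(volume.prod volume) :=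
  (measurePreserving_diagonal_add h).lintegral_comp_emb (measurableEmbedding_diagonal_add h) F

theorem memFracSobolev_univ_of_bounded {γ Q C : ℝ} {x₁ : Euc N} {φ : Euc N → ℝ}
    (hφ : Measurable φ)
    (hb : ∀ x, |φ x| ≤ (Metric.closedBall x₁ ρ).indicator (fun _ => C) x)
    (hg : ∫⁻ z, ENNReal.ofReal (|φ z.1 - φ z.2| ^ Q) / singWeight (γ * Q) (z.1 - z.2)
      ∂(volume.prod volume) < ⊤) (hQ : 0 < Q) : MemFracSobolev γ Q univ φ := by
  constructor
  · rw [Measure.restrict_univ]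
    exact (memLp_indicator_const (ENNReal.ofReal Q) Metric.isClosed_closedBall.measurableSet C
      (Or.inr (volume_closedBall_lt_top (x₀ := x₁) (ρ := ρ)).ne)).mono' hφ.aestronglyMeasurable
      (Filter.Eventually.of_forall hb)
  · rw [gagliardo, Measure.restrict_univ]
    rw [lintegral_prod _ (by fun_prop)] at hg
    exact ENNReal.rpow_lt_top_of_nonneg (by positivity) hg.ne

theorem isTestFunction_of_bounded (hp : 1 < p) {C : ℝ} {x₁ : Euc N} {φ : Euc N → ℝ}
    (hφ : Measurable φ)
    (hb : ∀ x, |φ x| ≤ (Metric.closedBall x₁ ρ).indicator (fun _ => C) x)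
    (hsub : Metric.closedBall x₁ ρ ⊆ Metric.ball x₀ R)
    (h1 : ∫⁻ z, ENNReal.ofReal (|φ z.1 - φ z.2| ^ (1 : ℝ)) / singWeight (s₁ * 1) (z.1 - z.2)
      ∂(volume.prod volume) < ⊤)
    (h2 : ∫⁻ z, ENNReal.ofReal (|φ z.1 - φ z.2| ^ p) / singWeight (sp * p) (z.1 - z.2)
      ∂(volume.prod volume) < ⊤) :
    IsTestFunction p s₁ sp (Metric.ball x₀ R) φ := by
  have hsupp : tsupport φ ⊆ Metric.closedBall x₁ ρ := by
    refine closure_minimal (fun x hx => ?_) Metric.isClosed_closedBall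
    by_contra hxS
    have := hb x
    rw [indicator_of_notMem hxS] at this
    exact hx (abs_nonpos_iff.1 this)
  exact ⟨memFracSobolev_univ_of_bounded hφ hb h1 one_pos,
    memFracSobolev_univ_of_bounded hφ hb h2 (by linarith),
    (isCompact_closedBall x₁ ρ).of_isClosed_subset (isClosed_tsupport φ) hsupp,
    hsupp.trans hsub⟩

/-- The kernel multiplying the cutoff errors of the `p`-growth term. -/
noncomputable def incrementKernel (p s d : ℝ) (h : Euc N) (u : Euc N → ℝ) (z : Euc N × Euc N) :
    ENNReal :=
  ENNReal.ofReal ((|u (z.1 + h) - u (z.2 + h)| ^ (p - 1) + |u z.1 - u z.2| ^ (p - 1)) *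
    min 1 (‖z.1 - z.2‖ / d)) / singWeight s (z.1 - z.2)

theorem measurable_incrementKernel {s : ℝ} (hu : Measurable u) :
    Measurable (incrementKernel p s d h u) := by
  unfold incrementKernel; fun_prop

theorem incrementKernel_symm {s : ℝ} (x y : Euc N) :
    incrementKernel p s d h u (x, y) = incrementKernel p s d h u (y, x) := by
  simp only [incrementKernel]
  rw [singWeight_sub_comm, norm_sub_rev, abs_sub_comm, abs_sub_comm (u x)]

/-- Both x and x + h lie at distance at most R − d from x₀, which is why a margin of 2d is required.
The nonlocal bound is used at each of them, after translating y by h for the second. -/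
theorem LocalSolution.lintegral_incrementKernel_le (E : AdmissibleExponents N p s₁ sp)
    (H : LocalSolution p s₁ sp x₀ R M u) (hd : 0 < d) (hρ : ρ + 2 * d ≤ R) (hh : ‖h‖ ≤ d)
    {x : Euc N} (hx : x ∈ Metric.closedBall x₀ ρ) :
    ∫⁻ y, incrementKernel p (sp * p) d h u (x, y) ≤
      2 * (ENNReal.ofReal (M ^ (p - 1) * d ^ (-((N : ℝ) + 2))) *
        (2 * kernelMass N (sp * p) 1 + 1)) := by
  have hu := H.measurable
  have hs : 0 < sp * p := mul_pos E.sp_pos (by linarith [E.one_lt])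
  have hM : 0 ≤ M := by linarith [H.one_le_bound]
  have hx' := mem_closedBall_iff_norm.1 hx
  have key := fun y hy => lintegral_increment_truncated_kernel_le (x := y) E.one_lt E.lt_two hs
    E.mul_lt H.radius_le_one hd hM H.bound H.tail_le hy
  have k1 := key x (by rw [mem_closedBall_iff_norm]; linarith)
  have k2 := key (x + h) (by
    rw [mem_closedBall_iff_norm, show x + h - x₀ = (x - x₀) + h by abel]
    linarith [norm_add_le (x - x₀) h])
  rw [← lintegral_add_right_eq_self _ h] at k2
  simp only [add_sub_add_right_eq_sub] at k2
  have : ∀ y, incrementKernel p (sp * p) d h u (x, y) =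
      ENNReal.ofReal (|u (x + h) - u (y + h)| ^ (p - 1) * min 1 (‖x - y‖ / d)) /
        singWeight (sp * p) (x - y) +
      ENNReal.ofReal (|u x - u y| ^ (p - 1) * min 1 (‖x - y‖ / d)) /
        singWeight (sp * p) (x - y) := by
    intro y
    simp only [incrementKernel]
    rw [add_mul, ENNReal.ofReal_add (by positivity) (by positivity), ENNReal.add_div]
  simp only [this]
  rw [lintegral_add_left (by fun_prop), two_mul]
  exact add_le_add k2 k1

theorem lintegral_incrementPow (β ρ : ℝ) :
    ∫⁻ x, ENNReal.ofReal (incrementPow x₀ ρ β h u x) =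
      ∫⁻ x in Metric.closedBall x₀ ρ, ENNReal.ofReal (|u (x + h) - u x| ^ β) := by
  rw [← lintegral_indicator Metric.isClosed_closedBall.measurableSet]
  refine lintegral_congr fun x => ?_
  by_cases hx : x ∈ Metric.closedBall x₀ ρ
  · rw [incrementPow, indicator_of_mem hx, indicator_of_mem hx]
  · rw [incrementPow, indicator_of_notMem hx, indicator_of_notMem hx, ENNReal.ofReal_zero]

theorem LocalSolution.lintegral_incrementPow_lt_top (H : LocalSolution p s₁ sp x₀ R M u)
    (hβ : 0 ≤ β) (hd : 0 < d) (hρ : ρ + 2 * d ≤ R) (hh : ‖h‖ ≤ d) :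
    ∫⁻ x, ENNReal.ofReal (incrementPow x₀ ρ β h u x) < ⊤ := by
  have h1 : ∀ x, ENNReal.ofReal (incrementPow x₀ ρ β h u x) ≤
      (Metric.closedBall x₀ ρ).indicator (fun _ => ENNReal.ofReal ((2 * M) ^ β)) x := by
    intro x
    have := incrementPow_le (h := h) (u := u) hβ
      (fun x hx => H.bound x (mem_ball_of_mem_closedBall hd hρ hx))
      (fun x hx => H.bound _ (add_mem_ball_of_mem_closedBall hd hρ hh hx)) x
    refine (ENNReal.ofReal_le_ofReal this).trans ?_
    by_cases hx : x ∈ Metric.closedBall x₀ ρ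
    · rw [indicator_of_mem hx, indicator_of_mem hx]
    · rw [indicator_of_notMem hx, indicator_of_notMem hx, ENNReal.ofReal_zero]
  refine (lintegral_mono h1).trans_lt ?_
  rw [lintegral_indicator Metric.isClosed_closedBall.measurableSet, lintegral_const,
    Measure.restrict_apply_univ]
  exact ENNReal.mul_lt_top ENNReal.ofReal_lt_top volume_closedBall_lt_top

theorem LocalSolution.lintegral_incrementKernel_mul_le (E : AdmissibleExponents N p s₁ sp)
    (H : LocalSolution p s₁ sp x₀ R M u) (hd : 0 < d) (hρ : ρ + 2 * d ≤ R) (hh : ‖h‖ ≤ d) :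
    ∫⁻ z, incrementKernel p (sp * p) d h u z * (ENNReal.ofReal (incrementPow x₀ ρ β h u z.1) +
        ENNReal.ofReal (incrementPow x₀ ρ β h u z.2)) ∂(volume.prod volume) ≤
      2 * (2 * (ENNReal.ofReal (M ^ (p - 1) * d ^ (-((N : ℝ) + 2))) *
        (2 * kernelMass N (sp * p) 1 + 1))) *
        ∫⁻ x, ENNReal.ofReal (incrementPow x₀ ρ β h u x) := by
  refine lintegral_symm_kernel_le (measurable_incrementKernel H.measurable) incrementKernel_symm
    (measurable_incrementPow H.measurable).ennreal_ofReal fun x hx => ?_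
  refine H.lintegral_incrementKernel_le E hd hρ hh ?_
  by_contra hxS
  simp [incrementPow, indicator_of_notMem hxS] at hx

/-- The cutoff kernel of the `1`-growth term. -/
theorem LocalSolution.lintegral_truncated_mul_le (E : AdmissibleExponents N p s₁ sp)
    (H : LocalSolution p s₁ sp x₀ R M u) (hd : 0 < d) (hd1 : d ≤ 1) :
    ∫⁻ z, ENNReal.ofReal (min 1 (‖z.1 - z.2‖ / d)) / singWeight s₁ (z.1 - z.2) *
        (ENNReal.ofReal (incrementPow x₀ ρ β h u z.1) +
        ENNReal.ofReal (incrementPow x₀ ρ β h u z.2)) ∂(volume.prod volume) ≤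
      2 * (ENNReal.ofReal (M ^ (p - 1) * d ^ (-((N : ℝ) + 2))) * kernelMass N s₁ 1) *
        ∫⁻ x, ENNReal.ofReal (incrementPow x₀ ρ β h u x) := by
  refine lintegral_symm_kernel_le (by fun_prop) (fun x y => ?_)
    (measurable_incrementPow H.measurable).ennreal_ofReal fun x _ => ?_
  · simp only
    rw [norm_sub_rev, singWeight_sub_comm]
  · have := lintegral_truncated_kernel_le (s := s₁) zero_le_one hd hd1 x
    simp only [Real.rpow_one] at this
    refine this.trans (mul_le_mul_left (ENNReal.ofReal_le_ofReal ?_) _)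
    have e1 : d ^ (-(1 : ℝ)) ≤ d ^ (-((N : ℝ) + 2)) :=
      Real.rpow_le_rpow_of_exponent_ge hd hd1 (by linarith [(Nat.cast_nonneg N : (0 : ℝ) ≤ N)])
    -- The 1-growth error does not scale with u; M ≥ 1 allows it to be written with the same factor
    -- M^{p−1} as the p-growth error.
    have e2 : 1 ≤ M ^ (p - 1) := Real.one_le_rpow H.one_le_bound (by linarith [E.one_lt])
    have e3 : 0 < d ^ (-((N : ℝ) + 2)) := by positivity
    nlinarith

/-- Absolute convergence of the p-growth term, both for u and for its translate, so that the two
weak formulations may be subtracted under the integral sign. On the ball a^{p−1} + b^{p−1} ≤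
2(a+b)^{p−1} reduces the main part to the joint energy; elsewhere only the cutoff error remains. -/
theorem LocalSolution.lintegral_growth_term_lt_top (E : AdmissibleExponents N p s₁ sp)
    (H : LocalSolution p s₁ sp x₀ R M u) (hβ : 1 ≤ β) (hd : 0 < d) (hρ : ρ + 2 * d ≤ R)
    (hh : ‖h‖ ≤ d) :
    ∫⁻ z, ENNReal.ofReal
      ((|u (z.1 + h) - u (z.2 + h)| ^ (p - 1) + |u z.1 - u z.2| ^ (p - 1)) *
        |incrementTest x₀ ρ d β h u z.1 - incrementTest x₀ ρ d β h u z.2|) /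
      singWeight (sp * p) (z.1 - z.2) ∂(volume.prod volume) < ⊤ := by
  have hu := H.measurable
  have hp0 : 0 < p := by linarith [E.one_lt]
  have hM : 0 ≤ M := by linarith [H.one_le_bound]
  have hS : MeasurableSet (Metric.closedBall x₀ ρ) := Metric.isClosed_closedBall.measurableSet
  have hfin := lintegral_joint_energy_lt_top hp0 hu hd hρ hh H.gagliardo_p
  set S := Metric.closedBall x₀ ρ with hSdef
  set L := β * (2 * M) ^ (β - 1) with hL
  have hL0 : 0 ≤ L := by positivity
  set J : Euc N × Euc N → ENNReal := fun z =>
    ENNReal.ofReal ((|u (z.1 + h) - u (z.2 + h)| + |u z.1 - u z.2|) ^ p) /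
        singWeight (sp * p) (z.1 - z.2) with hJ
  have hJm : Measurable J := by fun_prop
  have hpt : ∀ z : Euc N × Euc N,
      ENNReal.ofReal
      ((|u (z.1 + h) - u (z.2 + h)| ^ (p - 1) + |u z.1 - u z.2| ^ (p - 1)) *
        |incrementTest x₀ ρ d β h u z.1 - incrementTest x₀ ρ d β h u z.2|) /
      singWeight (sp * p) (z.1 - z.2) ≤
      (S ×ˢ S).indicator (fun z => ENNReal.ofReal (2 * L) * J z) z +
        incrementKernel p (sp * p) d h u z * (ENNReal.ofReal (incrementPow x₀ ρ β h u z.1) +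
        ENNReal.ofReal (incrementPow x₀ ρ β h u z.2)) := by
    rintro ⟨x, y⟩
    have h1 := abs_incrementTest_sub_le hβ hd
      (fun x hx => H.bound x (mem_ball_of_mem_closedBall hd hρ hx))
      (fun x hx => H.bound _ (add_mem_ball_of_mem_closedBall hd hρ hh hx)) x y
    set a := |u (x + h) - u (y + h)| with ha
    set b := |u x - u y| with hb
    have ha0 : 0 ≤ a := abs_nonneg _
    have hb0 : 0 ≤ b := abs_nonneg _
    have hGx := incrementPow_nonneg (x₀ := x₀) (ρ := ρ) (β := β) (h := h) (u := u) x
    have hGy := incrementPow_nonneg (x₀ := x₀) (ρ := ρ) (β := β) (h := h) (u := u) y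
    set w := a ^ (p - 1) + b ^ (p - 1) with hw
    have hw0 : 0 ≤ w := by positivity
    set A := (S ×ˢ S).indicator (fun z : Euc N × Euc N =>
      L * (|u (z.1 + h) - u (z.2 + h)| + |u z.1 - u z.2|)) (x, y) with hA
    have hA0 : 0 ≤ A := indicator_nonneg (fun _ _ => by positivity) _
    have h2 := mul_le_mul_of_nonneg_left h1 hw0
    rw [mul_add] at h2
    have h3 : ENNReal.ofReal (w * A) / singWeight (sp * p) (x - y) ≤
        (S ×ˢ S).indicator (fun z => ENNReal.ofReal (2 * L) * J z) (x, y) := by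
      by_cases hz : (x, y) ∈ S ×ˢ S
      · rw [hA, indicator_of_mem hz, indicator_of_mem hz, hJ, ← mul_div_assoc,
          ← ENNReal.ofReal_mul (by positivity)]
        refine ENNReal.div_le_div_right (ENNReal.ofReal_le_ofReal ?_) _
        have hab : (a + b) ^ p = (a + b) ^ (p - 1) * (a + b) := by
          rw [← Real.rpow_add_one' (by positivity) (by linarith), sub_add_cancel]
        have hwab : w ≤ 2 * (a + b) ^ (p - 1) := by
          have e1 : a ^ (p - 1) ≤ (a + b) ^ (p - 1) :=
            Real.rpow_le_rpow ha0 (by linarith) (by linarith [E.one_lt])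
          have e2 : b ^ (p - 1) ≤ (a + b) ^ (p - 1) :=
            Real.rpow_le_rpow hb0 (by linarith) (by linarith [E.one_lt])
          linarith
        rw [hab]
        calc w * (L * (a + b)) ≤ 2 * (a + b) ^ (p - 1) * (L * (a + b)) :=
              mul_le_mul_of_nonneg_right hwab (by positivity)
          _ = _ := by ring
      · rw [hA, indicator_of_notMem hz, indicator_of_notMem hz]
        simp
    calc _ ≤ ENNReal.ofReal (w * A + w * (min 1 (‖x - y‖ / d) *
          (incrementPow x₀ ρ β h u x + incrementPow x₀ ρ β h u y))) /
          singWeight (sp * p) (x - y) :=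
          ENNReal.div_le_div_right (ENNReal.ofReal_le_ofReal h2) _
      _ ≤ _ := by
          rw [ENNReal.ofReal_add (by positivity) (by positivity), ENNReal.add_div]
          refine add_le_add h3 (le_of_eq ?_)
          rw [← ENNReal.ofReal_add hGx hGy, incrementKernel, ← mul_assoc,
            ENNReal.ofReal_mul (by positivity)]
          simp only [div_eq_mul_inv]
          ring
  refine (lintegral_mono hpt).trans_lt ?_
  rw [lintegral_add_left ((hJm.const_mul _).indicator (hS.prod hS)),
    lintegral_indicator (hS.prod hS), lintegral_const_mul' _ _ ENNReal.ofReal_ne_top]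
  refine ENNReal.add_lt_top.2 ⟨ENNReal.mul_lt_top ENNReal.ofReal_lt_top hfin, ?_⟩
  refine (H.lintegral_incrementKernel_mul_le E hd hρ hh).trans_lt ?_
  have hkf := kernelMass_lt_top E.one_le_dim (s := sp * p) (m := 1)
    (mul_pos E.sp_pos hp0) E.mul_lt
  exact ENNReal.mul_lt_top (ENNReal.mul_lt_top (by simp) (ENNReal.mul_lt_top (by simp)
    (ENNReal.mul_lt_top ENNReal.ofReal_lt_top (ENNReal.add_lt_top.2
      ⟨ENNReal.mul_lt_top (by simp) hkf, by simp⟩))))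
    (H.lintegral_incrementPow_lt_top (by linarith) hd hρ hh)

end

/-! ### The energy inequality for increments -/

section
variable {N : ℕ} {p s₁ sp : ℝ} {x₀ : Euc N} {ρ d R M β : ℝ} {h : Euc N} {u : Euc N → ℝ}

theorem integrable_of_le_div_weight {s : ℝ} {F X : Euc N × Euc N → ℝ}
    (hs : (N : ℝ) + s ≠ 0) (hF : AEStronglyMeasurable F (volume.prod volume))
    (hle : ∀ᵐ z ∂(volume.prod volume), |F z| ≤ X z / ‖z.1 - z.2‖ ^ ((N : ℝ) + s))
    (hX : ∫⁻ z, ENNReal.ofReal (X z) / singWeight s (z.1 - z.2) ∂(volume.prod volume) < ⊤) :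
    Integrable F (volume.prod volume) := by
  refine ⟨hF, lt_of_le_of_lt (lintegral_mono_ae ?_) hX⟩
  filter_upwards [hle] with z hz
  rw [← ofReal_norm, Real.norm_eq_abs]
  exact (ENNReal.ofReal_le_ofReal hz).trans (ofReal_div_norm_le _ _ hs)

theorem abs_le_one_of_mem_setSgn {z t : ℝ} (h : z ∈ setSgn t) : |z| ≤ 1 := abs_le.2 h.2.2

theorem abs_incrementTest_le (hd : 0 < d) (hβ : 0 < β)
    (hb : ∀ x ∈ Metric.closedBall x₀ ρ, |u x| ≤ M)
    (hb' : ∀ x ∈ Metric.closedBall x₀ ρ, |u (x + h)| ≤ M) (x : Euc N) :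
    |incrementTest x₀ ρ d β h u x| ≤
      (Metric.closedBall x₀ ρ).indicator (fun _ => (2 * M) ^ β) x := by
  refine le_trans ?_ (incrementPow_le hβ.le hb hb' x)
  rw [incrementTest, abs_mul, abs_oddPow hβ, abs_of_nonneg (radialCutoff_nonneg x₀ x)]
  by_cases hx : x ∈ Metric.closedBall x₀ ρ
  · rw [incrementPow, indicator_of_mem hx]
    exact mul_le_of_le_one_left (by positivity) (radialCutoff_le_one x₀ x)
  · have : radialCutoff x₀ ρ d x = 0 := by
      by_contra h0; exact hx (mem_of_radialCutoff_ne_zero x₀ hd h0)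
    rw [this, zero_mul]
    exact incrementPow_nonneg x

/-- The shift k is 0 for the equation itself and −h for the translated equation; the support then
stays within ρ + d of x₀. -/
theorem LocalSolution.isTestFunction (E : AdmissibleExponents N p s₁ sp)
    (H : LocalSolution p s₁ sp x₀ R M u) (hβ : 1 ≤ β) (hd : 0 < d) (hd1 : d ≤ 1)
    (hρ : ρ + 2 * d ≤ R) (hh : ‖h‖ ≤ d) {k : Euc N} (hk : ‖k‖ ≤ d) :
    IsTestFunction p s₁ sp (Metric.ball x₀ R)
      (fun x => incrementTest x₀ ρ d β h u (x + k)) := by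
  have hM : 0 ≤ M := by linarith [H.one_le_bound]
  have hb : ∀ x ∈ Metric.closedBall x₀ ρ, |u x| ≤ M :=
    fun x hx => H.bound x (mem_ball_of_mem_closedBall hd hρ hx)
  have hb' : ∀ x ∈ Metric.closedBall x₀ ρ, |u (x + h)| ≤ M :=
    fun x hx => H.bound _ (add_mem_ball_of_mem_closedBall hd hρ hh hx)
  have hsp1 : sp < 1 := by nlinarith [E.mul_lt, E.one_lt, E.sp_pos]
  have hm := measurable_incrementTest (x₀ := x₀) (ρ := ρ) (d := d) (β := β) (h := h) H.measurable
  have trans : ∀ {γ Q : ℝ},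
      ∫⁻ z, ENNReal.ofReal (|incrementTest x₀ ρ d β h u z.1 - incrementTest x₀ ρ d β h u z.2| ^ Q) /
        singWeight (γ * Q) (z.1 - z.2) ∂(volume.prod volume) < ⊤ →
      ∫⁻ z, ENNReal.ofReal (|incrementTest x₀ ρ d β h u (z.1 + k) -
          incrementTest x₀ ρ d β h u (z.2 + k)| ^ Q) /
        singWeight (γ * Q) (z.1 - z.2) ∂(volume.prod volume) < ⊤ := by
    intro γ Q hlt
    rw [← lintegral_diagonal_add _ k] at hlt
    simpa only [add_sub_add_right_eq_sub] using hlt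
  refine isTestFunction_of_bounded (x₁ := x₀ - k) (ρ := ρ) (C := (2 * M) ^ β) E.one_lt
    (by fun_prop) (fun x => ?_) (fun x hx => ?_)
    (trans (lintegral_incrementTest_lt_top E.one_le_dim le_rfl E.s₁_pos E.s₁_lt hβ H.measurable
      hM H.bound hd hd1 hρ hh H.gagliardo_one))
    (trans (lintegral_incrementTest_lt_top E.one_le_dim E.one_lt.le E.sp_pos hsp1 hβ H.measurable
      hM H.bound hd hd1 hρ hh H.gagliardo_p))
  · refine (abs_incrementTest_le hd (by linarith) hb hb' (x + k)).trans (le_of_eq ?_)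
    have : x + k ∈ Metric.closedBall x₀ ρ ↔ x ∈ Metric.closedBall (x₀ - k) ρ := by
      rw [mem_closedBall_iff_norm, mem_closedBall_iff_norm, show x + k - x₀ = x - (x₀ - k) by abel]
    by_cases hx : x ∈ Metric.closedBall (x₀ - k) ρ
    · rw [indicator_of_mem hx, indicator_of_mem (this.2 hx)]
    · rw [indicator_of_notMem hx, indicator_of_notMem (fun h' => hx (this.1 h'))]
  · rw [mem_closedBall_iff_norm] at hx
    rw [mem_ball_iff_norm, show x - x₀ = (x - (x₀ - k)) + (-k) by abel]
    have := norm_add_le (x - (x₀ - k)) (-k)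
    rw [norm_neg] at this
    linarith

/-- The constant of the energy estimate. -/
noncomputable def energyConst (N : ℕ) (p s₁ sp : ℝ) : ENNReal :=
  4 * kernelMass N s₁ 1 + 4 * (2 * kernelMass N (sp * p) 1 + 1)

theorem energyConst_lt_top (E : AdmissibleExponents N p s₁ sp) : energyConst N p s₁ sp < ⊤ := by
  have h1 := kernelMass_lt_top E.one_le_dim (s := sp * p) (m := 1)
    (mul_pos E.sp_pos (by linarith [E.one_lt])) E.mul_lt
  have h2 := kernelMass_lt_top E.one_le_dim (s := s₁) (m := 1) E.s₁_pos E.s₁_lt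
  exact ENNReal.add_lt_top.2 ⟨ENNReal.mul_lt_top (by simp) h2, ENNReal.mul_lt_top (by simp)
    (ENNReal.add_lt_top.2 ⟨ENNReal.mul_lt_top (by simp) h1, by simp⟩)⟩

/-- The energy inequality for increments of a solution. -/
theorem LocalSolution.energy_le (E : AdmissibleExponents N p s₁ sp)
    (H : LocalSolution p s₁ sp x₀ R M u) (hβ : 1 ≤ β) (hd : 0 < d) (hd1 : d ≤ 1)
    (hρ : ρ + 2 * d ≤ R) (hh : ‖h‖ ≤ d) :
    ∫⁻ z in Metric.closedBall x₀ (ρ - d) ×ˢ Metric.closedBall x₀ (ρ - d), ENNReal.ofReal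
      ((oddPow (p - 1) (u (z.1 + h) - u (z.2 + h)) - oddPow (p - 1) (u z.1 - u z.2)) *
        (oddPow β (u (z.1 + h) - u z.1) - oddPow β (u (z.2 + h) - u z.2)) /
          ‖z.1 - z.2‖ ^ ((N : ℝ) + sp * p)) ∂(volume.prod volume) ≤
      ENNReal.ofReal (M ^ (p - 1) * d ^ (-((N : ℝ) + 2))) * energyConst N p s₁ sp *
        ∫⁻ x in Metric.closedBall x₀ ρ, ENNReal.ofReal (|u (x + h) - u x| ^ β) := by
  obtain ⟨Z, hZm, hZ, hweak⟩ := H.exists_sign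
  have hu := H.measurable
  have hp1 : 0 < p - 1 := by linarith [E.one_lt]
  have hp2 : p - 1 ≤ 1 := by linarith [E.lt_two]
  have hM : 0 ≤ M := by linarith [H.one_le_bound]
  have hs0 : 0 < sp * p := mul_pos E.sp_pos (by linarith)
  have hNs : (N : ℝ) + sp * p ≠ 0 := by positivity
  have hs₁ := E.s₁_pos
  have hN₁ : (N : ℝ) + s₁ ≠ 0 := by positivity
  have hβ0 : 0 < β := by linarith
  set φ := incrementTest x₀ ρ d β h u with hφ
  have hφm : Measurable φ := measurable_incrementTest hu
  set G := incrementPow x₀ ρ β h u with hG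
  have hGm : Measurable G := measurable_incrementPow hu
  have hG0 : ∀ x, 0 ≤ G x := incrementPow_nonneg
  -- translation of the sign function
  set Zh : Euc N × Euc N → ℝ := fun z => Z (z.1 + h, z.2 + h) with hZh
  have hqmp := (measurePreserving_diagonal_add h).quasiMeasurePreserving
  have hZhm : AEStronglyMeasurable Zh (volume.prod volume) :=
    hZm.comp_quasiMeasurePreserving hqmp
  have hZh' : ∀ᵐ z ∂(volume.prod volume), Zh z ∈ setSgn (u (z.1 + h) - u (z.2 + h)) :=
    hqmp.ae hZ
  -- the four integrands
  set P₁ : Euc N × Euc N → ℝ := fun z =>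
    Zh z * (φ z.1 - φ z.2) / ‖z.1 - z.2‖ ^ ((N : ℝ) + s₁) with hP₁
  set P₂ : Euc N × Euc N → ℝ := fun z =>
    Z z * (φ z.1 - φ z.2) / ‖z.1 - z.2‖ ^ ((N : ℝ) + s₁) with hP₂
  set Q₁ : Euc N × Euc N → ℝ := fun z =>
    oddPow (p - 1) (u (z.1 + h) - u (z.2 + h)) * (φ z.1 - φ z.2) /
      ‖z.1 - z.2‖ ^ ((N : ℝ) + sp * p) with hQ₁
  set Q₂ : Euc N × Euc N → ℝ := fun z =>
    oddPow (p - 1) (u z.1 - u z.2) * (φ z.1 - φ z.2) /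
      ‖z.1 - z.2‖ ^ ((N : ℝ) + sp * p) with hQ₂
  have eq₂ : 0 = (∫ z, P₂ z ∂(volume.prod volume)) + ∫ z, Q₂ z ∂(volume.prod volume) := by
    have := hweak _ (H.isTestFunction E hβ hd hd1 hρ hh (k := 0) (by simpa using hd.le))
    simpa only [add_zero] using this
  -- Testing with φ(· − h) and translating both variables by h gives the equation for u(· + h)
  -- tested with φ.
  have eq₁ : 0 = (∫ z, P₁ z ∂(volume.prod volume)) + ∫ z, Q₁ z ∂(volume.prod volume) := by
    have := hweak _ (H.isTestFunction E hβ hd hd1 hρ hh (k := -h) (by simpa using hh))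
    have tr : ∀ F : Euc N × Euc N → ℝ, ∫ z, F z ∂(volume.prod volume) =
        ∫ z, F (z.1 + h, z.2 + h) ∂(volume.prod volume) := fun F =>
      ((measurePreserving_diagonal_add h).integral_comp (measurableEmbedding_diagonal_add h) F).symm
    replace this := this.trans (congrArg₂ (· + ·) (tr _) (tr _))
    simpa only [add_sub_add_right_eq_sub, add_neg_cancel_right] using this
  have hφ1 := lintegral_incrementTest_lt_top E.one_le_dim le_rfl E.s₁_pos E.s₁_lt hβ hu
      hM H.bound hd hd1 hρ hh H.gagliardo_one
  simp only [Real.rpow_one, mul_one] at hφ1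
  have iP : ∀ {Y : Euc N × Euc N → ℝ}, AEStronglyMeasurable Y (volume.prod volume) →
      (∀ᵐ z ∂(volume.prod volume), |Y z| ≤ 1) →
      Integrable (fun z => Y z * (φ z.1 - φ z.2) / ‖z.1 - z.2‖ ^ ((N : ℝ) + s₁))
        (volume.prod volume) := by
    intro Y hY hY1
    refine integrable_of_le_div_weight hN₁ ?_ ?_ hφ1
    · simp only [div_eq_mul_inv]
      exact (hY.mul (by fun_prop : Measurable _).aestronglyMeasurable).mul
        (by fun_prop : Measurable _).aestronglyMeasurable
    · filter_upwards [hY1] with z hz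
      rw [abs_div, abs_mul, abs_of_nonneg (Real.rpow_nonneg (norm_nonneg (z.1 - z.2)) _)]
      exact div_le_div_of_nonneg_right (mul_le_of_le_one_left (abs_nonneg _) hz) (by positivity)
  have iP₁ : Integrable P₁ (volume.prod volume) :=
    iP hZhm (hZh'.mono fun z hz => abs_le_one_of_mem_setSgn hz)
  have iP₂ : Integrable P₂ (volume.prod volume) :=
    iP hZm (hZ.mono fun z hz => abs_le_one_of_mem_setSgn hz)
  have hgrow := H.lintegral_growth_term_lt_top E hβ hd hρ hh
  have iQ₁ : Integrable Q₁ (volume.prod volume) := by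
    refine integrable_of_le_div_weight hNs (by fun_prop : Measurable _).aestronglyMeasurable
      (Filter.Eventually.of_forall fun z => ?_) hgrow
    rw [abs_div, abs_mul, abs_of_nonneg (Real.rpow_nonneg (norm_nonneg (z.1 - z.2)) _),
      abs_oddPow hp1]
    refine div_le_div_of_nonneg_right (mul_le_mul_of_nonneg_right ?_ (abs_nonneg _)) (by positivity)
    exact le_add_of_nonneg_right (by positivity)
  have iQ₂ : Integrable Q₂ (volume.prod volume) := by
    refine integrable_of_le_div_weight hNs (by fun_prop : Measurable _).aestronglyMeasurable
      (Filter.Eventually.of_forall fun z => ?_) hgrow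
    rw [abs_div, abs_mul, abs_of_nonneg (Real.rpow_nonneg (norm_nonneg (z.1 - z.2)) _),
      abs_oddPow hp1]
    refine div_le_div_of_nonneg_right (mul_le_mul_of_nonneg_right ?_ (abs_nonneg _)) (by positivity)
    exact le_add_of_nonneg_left (by positivity)
  -- the cutoff errors
  set e₁ : Euc N × Euc N → ℝ := fun z =>
    2 * min 1 (‖z.1 - z.2‖ / d) * (G z.1 + G z.2) / ‖z.1 - z.2‖ ^ ((N : ℝ) + s₁) with he₁
  set e₂ : Euc N × Euc N → ℝ := fun z =>
    (|u (z.1 + h) - u (z.2 + h)| ^ (p - 1) + |u z.1 - u z.2| ^ (p - 1)) *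
      min 1 (‖z.1 - z.2‖ / d) * (G z.1 + G z.2) / ‖z.1 - z.2‖ ^ ((N : ℝ) + sp * p) with he₂
  have he₁0 : ∀ z, 0 ≤ e₁ z := fun z => by
    have := hG0 z.1; have := hG0 z.2; positivity
  have he₂0 : ∀ z, 0 ≤ e₂ z := fun z => by
    have := hG0 z.1; have := hG0 z.2; positivity
  have he₁m : Measurable e₁ := by fun_prop
  have he₂m : Measurable e₂ := by fun_prop
  set I := ∫⁻ x, ENNReal.ofReal (G x) with hI
  set A := ENNReal.ofReal (M ^ (p - 1) * d ^ (-((N : ℝ) + 2))) with hA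
  have hIfin : I < ⊤ := H.lintegral_incrementPow_lt_top hβ0.le hd hρ hh
  have b₁ : ∫⁻ z, ENNReal.ofReal (e₁ z) ∂(volume.prod volume) ≤
      A * (4 * kernelMass N s₁ 1) * I := by
    calc _ ≤ ∫⁻ z, 2 * (ENNReal.ofReal (min 1 (‖z.1 - z.2‖ / d)) / singWeight s₁ (z.1 - z.2) *
          (ENNReal.ofReal (G z.1) + ENNReal.ofReal (G z.2))) ∂(volume.prod volume) := by
          refine lintegral_mono fun z => (ofReal_div_norm_le _ _ hN₁).trans (le_of_eq ?_)
          rw [ENNReal.ofReal_mul (by positivity), ENNReal.ofReal_mul (by norm_num),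
            ENNReal.ofReal_add (hG0 _) (hG0 _), ENNReal.ofReal_ofNat]
          simp only [div_eq_mul_inv]
          ring
      _ ≤ 2 * (2 * (A * kernelMass N s₁ 1) * I) := by
          rw [lintegral_const_mul' _ _ (by simp)]
          gcongr
          exact H.lintegral_truncated_mul_le E hd hd1
      _ = _ := by ring
  have b₂ : ∫⁻ z, ENNReal.ofReal (e₂ z) ∂(volume.prod volume) ≤
      A * (4 * (2 * kernelMass N (sp * p) 1 + 1)) * I := by
    calc _ ≤ ∫⁻ z, incrementKernel p (sp * p) d h u z *
          (ENNReal.ofReal (G z.1) + ENNReal.ofReal (G z.2)) ∂(volume.prod volume) := by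
          refine lintegral_mono fun z => (ofReal_div_norm_le _ _ hNs).trans (le_of_eq ?_)
          rw [ENNReal.ofReal_mul (by positivity), ENNReal.ofReal_add (hG0 _) (hG0 _),
            incrementKernel]
          simp only [div_eq_mul_inv]
          ring
      _ ≤ _ := H.lintegral_incrementKernel_mul_le E hd hρ hh
      _ = _ := by ring
  have b₁₂ : ∫⁻ z, ENNReal.ofReal (e₁ z + e₂ z) ∂(volume.prod volume) ≤
      A * energyConst N p s₁ sp * I := by
    calc _ = (∫⁻ z, ENNReal.ofReal (e₁ z) ∂(volume.prod volume)) +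
          ∫⁻ z, ENNReal.ofReal (e₂ z) ∂(volume.prod volume) := by
          rw [← lintegral_add_left (by fun_prop)]
          exact lintegral_congr fun z => ENNReal.ofReal_add (he₁0 z) (he₂0 z)
      _ ≤ _ := add_le_add b₁ b₂
      _ = _ := by rw [energyConst]; ring
  have hCfin := energyConst_lt_top E
  have ie : Integrable (fun z => e₁ z + e₂ z) (volume.prod volume) := by
    refine ⟨(he₁m.add he₂m).aestronglyMeasurable, lt_of_le_of_lt (le_of_eq ?_) (b₁₂.trans_lt
      (ENNReal.mul_lt_top (ENNReal.mul_lt_top ENNReal.ofReal_lt_top hCfin) hIfin))⟩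
    refine lintegral_congr fun z => ?_
    rw [← ofReal_norm, Real.norm_of_nonneg (add_nonneg (he₁0 z) (he₂0 z))]
  -- pointwise comparison
  set m : Euc N × Euc N → ℝ := fun z =>
    min (radialCutoff x₀ ρ d z.1) (radialCutoff x₀ ρ d z.2) *
      ((oddPow (p - 1) (u (z.1 + h) - u (z.2 + h)) - oddPow (p - 1) (u z.1 - u z.2)) *
        (oddPow β (u (z.1 + h) - u z.1) - oddPow β (u (z.2 + h) - u z.2))) /
          ‖z.1 - z.2‖ ^ ((N : ℝ) + sp * p) with hm
  have hm0 : ∀ z, 0 ≤ m z := fun z => by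
    refine div_nonneg (mul_nonneg (le_min (radialCutoff_nonneg _ _) (radialCutoff_nonneg _ _))
      (oddPow_sub_mul_sub_nonneg hp1 hβ0 (by ring))) (by positivity)
  have hmle : ∀ᵐ z ∂(volume.prod volume),
      m z ≤ (P₁ z - P₂ z) + (Q₁ z - Q₂ z) + (e₁ z + e₂ z) := by
    filter_upwards [hZ, hZh'] with z hz hzh
    have hr := abs_incrementTest_sub_sub_le (x₀ := x₀) (ρ := ρ) (h := h) (u := u) hβ0 hd z.1 z.2
    rw [← hφ, ← hG] at hr
    set μ := min (radialCutoff x₀ ρ d z.1) (radialCutoff x₀ ρ d z.2) with hμ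
    have hμ0 : 0 ≤ μ := le_min (radialCutoff_nonneg _ _) (radialCutoff_nonneg _ _)
    set D := oddPow β (u (z.1 + h) - u z.1) - oddPow β (u (z.2 + h) - u z.2) with hD
    set T := min 1 (‖z.1 - z.2‖ / d) * (G z.1 + G z.2) with hT
    have hT0 : 0 ≤ T := (abs_nonneg _).trans hr
    set j := oddPow (p - 1) (u (z.1 + h) - u (z.2 + h)) - oddPow (p - 1) (u z.1 - u z.2) with hj
    set F := φ z.1 - φ z.2 with hF
    have hjle : |j| ≤ |u (z.1 + h) - u (z.2 + h)| ^ (p - 1) + |u z.1 - u z.2| ^ (p - 1) := by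
      rw [← abs_oddPow hp1, ← abs_oddPow hp1]
      exact abs_sub _ _
    have hzle : |Zh z - Z z| ≤ 2 := by
      have := abs_sub (Zh z) (Z z)
      linarith [abs_le_one_of_mem_setSgn hz, abs_le_one_of_mem_setSgn hzh]
    have hzmono : 0 ≤ (Zh z - Z z) * D := setSgn_sub_mul_nonneg hβ0 hzh hz (by ring)
    have q1 : μ * (j * D) ≤ j * F +
        (|u (z.1 + h) - u (z.2 + h)| ^ (p - 1) + |u z.1 - u z.2| ^ (p - 1)) * T := by
      have h1 : |j * (F - μ * D)| ≤
          (|u (z.1 + h) - u (z.2 + h)| ^ (p - 1) + |u z.1 - u z.2| ^ (p - 1)) * T := by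
        rw [abs_mul]
        exact mul_le_mul hjle hr (abs_nonneg _) (by positivity)
      have h2 := (abs_le.1 h1).1
      linarith [show j * (F - μ * D) = j * F - μ * (j * D) by ring]
    -- The principal part μ (Zh − Z) D is nonnegative and is discarded; the factor 2 bounds |Zh −
    -- Z|. The fractional 1-Laplacian therefore enters only through its cutoff error.
    have q2 : 0 ≤ (Zh z - Z z) * F + 2 * T := by
      have h1 : |(Zh z - Z z) * (F - μ * D)| ≤ 2 * T := by
        rw [abs_mul]
        exact mul_le_mul hzle hr (abs_nonneg _) (by norm_num)
      have h2 := (abs_le.1 h1).1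
      have h3 := mul_nonneg hμ0 hzmono
      linarith [show (Zh z - Z z) * (F - μ * D) = (Zh z - Z z) * F - μ * ((Zh z - Z z) * D) by ring]
    have q3 := div_le_div_of_nonneg_right q1
      (Real.rpow_nonneg (norm_nonneg (z.1 - z.2)) ((N : ℝ) + sp * p))
    have q4 := div_nonneg q2 (Real.rpow_nonneg (norm_nonneg (z.1 - z.2)) ((N : ℝ) + s₁))
    have r1 : (P₁ z - P₂ z) + e₁ z =
        ((Zh z - Z z) * F + 2 * T) / ‖z.1 - z.2‖ ^ ((N : ℝ) + s₁) := by
      simp only [hP₁, hP₂, he₁]; rw [hT]; ring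
    have r2 : (Q₁ z - Q₂ z) + e₂ z = (j * F +
        (|u (z.1 + h) - u (z.2 + h)| ^ (p - 1) + |u z.1 - u z.2| ^ (p - 1)) * T) /
          ‖z.1 - z.2‖ ^ ((N : ℝ) + sp * p) := by
      simp only [hQ₁, hQ₂, he₂]; rw [hT]; ring
    have r3 : m z = μ * (j * D) / ‖z.1 - z.2‖ ^ ((N : ℝ) + sp * p) := rfl
    linarith
  have iP : Integrable (fun z => P₁ z - P₂ z) (volume.prod volume) := iP₁.sub iP₂
  have iQ : Integrable (fun z => Q₁ z - Q₂ z) (volume.prod volume) := iQ₁.sub iQ₂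
  have iPQ : Integrable (fun z => (P₁ z - P₂ z) + (Q₁ z - Q₂ z)) (volume.prod volume) := iP.add iQ
  have itot : Integrable (fun z => (P₁ z - P₂ z) + (Q₁ z - Q₂ z) + (e₁ z + e₂ z))
      (volume.prod volume) := iPQ.add ie
  -- Neither difference need have zero integral, but their sum does, by the two weak formulations.
  have htot : ∫ z, ((P₁ z - P₂ z) + (Q₁ z - Q₂ z) + (e₁ z + e₂ z)) ∂(volume.prod volume) =
      ∫ z, (e₁ z + e₂ z) ∂(volume.prod volume) := by
    rw [integral_add iPQ ie, integral_add iP iQ,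
      integral_sub iP₁ iP₂, integral_sub iQ₁ iQ₂]
    linarith
  have hS' : MeasurableSet (Metric.closedBall x₀ (ρ - d)) :=
    Metric.isClosed_closedBall.measurableSet
  calc _ ≤ ∫⁻ z, ENNReal.ofReal (m z) ∂(volume.prod volume) := by
        rw [← lintegral_indicator (hS'.prod hS')]
        refine lintegral_mono fun z => ?_
        by_cases hz : z ∈ Metric.closedBall x₀ (ρ - d) ×ˢ Metric.closedBall x₀ (ρ - d)
        · rw [indicator_of_mem hz]
          simp only [hm]
          rw [radialCutoff_eq_one x₀ hd hz.1, radialCutoff_eq_one x₀ hd hz.2, min_self, one_mul]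
        · rw [indicator_of_notMem hz]; exact zero_le
    _ ≤ ∫⁻ z, ENNReal.ofReal ((P₁ z - P₂ z) + (Q₁ z - Q₂ z) + (e₁ z + e₂ z))
          ∂(volume.prod volume) :=
        lintegral_mono_ae (hmle.mono fun z hz => ENNReal.ofReal_le_ofReal hz)
    -- The cancellation takes place in the Bochner integral. The dominating function lies above m ≥
    -- 0 almost everywhere, so its lower integral equals its Bochner integral.
    _ = ENNReal.ofReal (∫ z, (e₁ z + e₂ z) ∂(volume.prod volume)) := by
        rw [← htot, ofReal_integral_eq_lintegral_ofReal itot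
          (hmle.mono fun z hz => (hm0 z).trans hz)]
    _ = ∫⁻ z, ENNReal.ofReal (e₁ z + e₂ z) ∂(volume.prod volume) :=
        ofReal_integral_eq_lintegral_ofReal ie
          (Filter.Eventually.of_forall fun z => add_nonneg (he₁0 z) (he₂0 z))
    _ ≤ _ := by rw [← lintegral_incrementPow]; exact b₁₂

end

/-! ### Increment bounds and averaged mixed differences -/

/-- The volume of the unit ball. -/
noncomputable def unitBallVolume (N : ℕ) : ℝ := (volume (Metric.ball (0 : Euc N) 1)).toReal

theorem unitBallVolume_pos (N : ℕ) : 0 < unitBallVolume N :=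
  ENNReal.toReal_pos (Metric.measure_ball_pos volume _ one_pos).ne' measure_ball_lt_top.ne

theorem volume_closedBall_eq {N : ℕ} (x : Euc N) {r : ℝ} (hr : 0 ≤ r) :
    volume (Metric.closedBall x r) = ENNReal.ofReal (r ^ (N : ℝ) * unitBallVolume N) := by
  rw [Measure.addHaar_closedBall _ _ hr, ENNReal.ofReal_mul (by positivity), unitBallVolume,
    ENNReal.ofReal_toReal measure_ball_lt_top.ne, finrank_euclideanSpace_fin, Real.rpow_natCast]

theorem volume_closedBall_le {N : ℕ} (x : Euc N) {r : ℝ} (hr : r ≤ 1) :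
    volume (Metric.closedBall x r) ≤ ENNReal.ofReal (unitBallVolume N) := by
  refine (measure_mono (Metric.closedBall_subset_closedBall hr)).trans ?_
  rw [volume_closedBall_eq x zero_le_one, Real.one_rpow, one_mul]

/-- The increments of `u` are bounded in `L^q` by a power of the step. -/
def IncrementBound {N : ℕ} (q : ℝ) (x₀ : Euc N) (ρ d : ℝ) (u : Euc N → ℝ) (σ A : ℝ) : Prop :=
  ∀ h : Euc N, h ≠ 0 → ‖h‖ ≤ d →
    ∫⁻ x in Metric.closedBall x₀ ρ, ENNReal.ofReal (|u (x + h) - u x| ^ q) ≤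
      ENNReal.ofReal (A * ‖h‖ ^ (σ * q))

section
variable {N : ℕ} {p s₁ sp q σ A : ℝ} {x₀ : Euc N} {ρ d R M β : ℝ} {h : Euc N} {u : Euc N → ℝ}

theorem rpow_le_add_of_le {t Y : ℝ} (ht : 0 ≤ t) (hY : 0 < Y) (hβ : 0 < β) (hβq : β ≤ q) :
    t ^ β ≤ Y ^ β + Y ^ (β - q) * t ^ q := by
  rcases le_or_gt t Y with h | h
  · have h1 := Real.rpow_le_rpow ht h hβ.le
    have : 0 ≤ Y ^ (β - q) * t ^ q := by positivity
    linarith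
  · have ht0 : 0 < t := hY.trans h
    have h1 : t ^ (β - q) ≤ Y ^ (β - q) :=
      Real.rpow_le_rpow_of_nonpos hY h.le (by linarith)
    have h2 : t ^ β = t ^ (β - q) * t ^ q := by rw [← Real.rpow_add ht0]; ring_nf
    have h3 : 0 ≤ Y ^ β := by positivity
    have h4 : 0 ≤ t ^ q := by positivity
    nlinarith

/-- Takes the place of Hölder's inequality on a set of bounded volume: the integrand is split at the
natural size M‖h‖^σ of the increment. The constant A ≥ 1 then appears to the first power. -/
theorem IncrementBound.lower_power (hI : IncrementBound q x₀ ρ d u σ (A * M ^ q))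
    (hA : 1 ≤ A) (hM : 1 ≤ M) (hβ : 0 < β) (hβq : β ≤ q) (hρ1 : ρ ≤ 1) (h0 : h ≠ 0)
    (hh : ‖h‖ ≤ d) :
    ∫⁻ x in Metric.closedBall x₀ ρ, ENNReal.ofReal (|u (x + h) - u x| ^ β) ≤
      ENNReal.ofReal ((unitBallVolume N + 1) * A * M ^ β * ‖h‖ ^ (σ * β)) := by
  have hn : 0 < ‖h‖ := norm_pos_iff.2 h0
  have hM0 : 0 < M := by linarith
  have hV := unitBallVolume_pos N
  set Y := M * ‖h‖ ^ σ with hY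
  have hY0 : 0 < Y := by positivity
  have hYr : ∀ r : ℝ, Y ^ r = M ^ r * ‖h‖ ^ (σ * r) := fun r => by
    rw [hY, Real.mul_rpow hM0.le (by positivity), ← Real.rpow_mul hn.le]
  calc _ ≤ ∫⁻ x in Metric.closedBall x₀ ρ, (ENNReal.ofReal (Y ^ β) +
        ENNReal.ofReal (Y ^ (β - q)) * ENNReal.ofReal (|u (x + h) - u x| ^ q)) := by
        refine lintegral_mono fun x => ?_
        rw [← ENNReal.ofReal_mul (by positivity),
          ← ENNReal.ofReal_add (by positivity) (by positivity)]
        exact ENNReal.ofReal_le_ofReal (rpow_le_add_of_le (abs_nonneg _) hY0 hβ hβq)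
    _ ≤ ENNReal.ofReal (Y ^ β) * ENNReal.ofReal (unitBallVolume N) +
        ENNReal.ofReal (Y ^ (β - q)) * ENNReal.ofReal (A * M ^ q * ‖h‖ ^ (σ * q)) := by
        rw [lintegral_add_left measurable_const, lintegral_const, Measure.restrict_apply_univ,
          lintegral_const_mul' _ _ ENNReal.ofReal_ne_top]
        gcongr
        · exact volume_closedBall_le x₀ hρ1
        · exact hI h h0 hh
    _ = ENNReal.ofReal (Y ^ β * unitBallVolume N + Y ^ (β - q) * (A * Y ^ q)) := by
        rw [← ENNReal.ofReal_mul (by positivity), ← ENNReal.ofReal_mul (by positivity),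
          ← ENNReal.ofReal_add (by positivity) (by positivity), hYr q, mul_assoc A]
    _ ≤ _ := by
        refine ENNReal.ofReal_le_ofReal ?_
        have h1 : Y ^ (β - q) * (A * Y ^ q) = A * Y ^ β := by
          rw [mul_left_comm, ← Real.rpow_add hY0, sub_add_cancel]
        rw [h1, mul_assoc ((unitBallVolume N + 1) * A), ← hYr β]
        have : 0 < Y ^ β := by positivity
        have h2 : unitBallVolume N ≤ unitBallVolume N * A := le_mul_of_one_le_right hV.le hA
        nlinarith

theorem setLIntegral_comp_add_left_le {S B : Set (Euc N)} {x : Euc N}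
    (hS : MeasurableSet S) (hB : MeasurableSet B) (hSB : ∀ k ∈ S, x + k ∈ B)
    (f : Euc N → ENNReal) : ∫⁻ k in S, f (x + k) ≤ ∫⁻ y in B, f y := by
  rw [← lintegral_indicator hS, ← lintegral_indicator hB,
    ← lintegral_add_left_eq_self (B.indicator f) x]
  refine lintegral_mono fun k => ?_
  by_cases hk : k ∈ S
  · rw [indicator_of_mem hk, indicator_of_mem (hSB k hk)]
  · rw [indicator_of_notMem hk]; exact zero_le

theorem add_mem_closedBall_of_le {x k : Euc N} {ρ' : ℝ} (hx : x ∈ Metric.closedBall x₀ ρ)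
    (hk : ρ + ‖k‖ ≤ ρ') : x + k ∈ Metric.closedBall x₀ ρ' := by
  rw [mem_closedBall_iff_norm] at hx ⊢
  rw [show x + k - x₀ = (x - x₀) + k by abel]
  linarith [norm_add_le (x - x₀) k]

/-- The substitution y = x + k identifies the average over short steps k with a strip near the
diagonal of the product of balls. -/
theorem lintegral_fiber_le {F : Euc N × Euc N → ENNReal} (hF : Measurable F) (hd : 0 ≤ d)
    {t : ℝ} (ht : t ≤ d) :
    ∫⁻ x in Metric.closedBall x₀ (ρ - d), ∫⁻ k in Metric.closedBall 0 t, F (x, x + k) ≤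
      ∫⁻ z in Metric.closedBall x₀ ρ ×ˢ Metric.closedBall x₀ ρ, F z ∂(volume.prod volume) := by
  have hm : ∀ (y : Euc N) (r : ℝ), MeasurableSet (Metric.closedBall y r) :=
    fun _ _ => Metric.isClosed_closedBall.measurableSet
  rw [← Measure.prod_restrict, lintegral_prod _ hF.aemeasurable]
  refine le_trans ?_ (lintegral_mono_set (Metric.closedBall_subset_closedBall
    (by linarith : ρ - d ≤ ρ)))
  refine setLIntegral_mono' (hm _ _) fun x hx => ?_
  refine setLIntegral_comp_add_left_le (hm _ _) (hm _ _) (fun k hk => ?_) fun y => F (x, y)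
  rw [mem_closedBall_zero_iff] at hk
  exact add_mem_closedBall_of_le hx (by linarith)

theorem IncrementBound.lintegral_average_le (hI : IncrementBound q x₀ ρ d u σ A) (hu : Measurable u)
    (hq : 0 < q) (hσ : 0 ≤ σ) (hA : 0 ≤ A) {t ρ' : ℝ} (ht0 : 0 ≤ t) (ht : t ≤ d) {k₀ : Euc N}
    (hk₀ : ρ' + ‖k₀‖ ≤ ρ) :
    ∫⁻ x in Metric.closedBall x₀ ρ', ∫⁻ k in Metric.closedBall (0 : Euc N) t,
        ENNReal.ofReal (|u (x + k₀ + k) - u (x + k₀)| ^ q) ≤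
      ENNReal.ofReal (unitBallVolume N * t ^ (N : ℝ) * (A * t ^ (σ * q))) := by
  rw [lintegral_lintegral_swap (by fun_prop)]
  have hV := unitBallVolume_pos N
  calc _ ≤ ∫⁻ k in Metric.closedBall (0 : Euc N) t, ENNReal.ofReal (A * t ^ (σ * q)) := by
        refine setLIntegral_mono' Metric.isClosed_closedBall.measurableSet fun k hk => ?_
        rw [mem_closedBall_zero_iff] at hk
        rcases eq_or_ne k 0 with rfl | h0
        · simp [Real.zero_rpow hq.ne']
        refine (setLIntegral_closedBall_comp_add_le
          (fun x => ENNReal.ofReal (|u (x + k) - u x| ^ q)) x₀ k₀ hk₀).trans ?_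
        refine (hI k h0 (hk.trans ht)).trans (ENNReal.ofReal_le_ofReal ?_)
        exact mul_le_mul_of_nonneg_left (Real.rpow_le_rpow (norm_nonneg _) hk (by positivity)) hA
    _ = _ := by
        rw [lintegral_const, Measure.restrict_apply_univ, volume_closedBall_eq _ ht0,
          ← ENNReal.ofReal_mul (by positivity)]
        ring_nf

/-- The gain of differentiability in one step. -/
noncomputable def improvedExponent (p sp q σ : ℝ) : ℝ :=
  σ + (sp * p - σ * (p - 1)) / (q + 2 - p)

/-- The constant of the estimate for averaged mixed second differences. -/
noncomputable def mixedConst (N : ℕ) (p s₁ sp q : ℝ) : ℝ :=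
  ((p - 1) * 2 ^ (p - q))⁻¹ * (energyConst N p s₁ sp).toReal * (unitBallVolume N + 1) +
    2 ^ (q + 1) * unitBallVolume N

/-- Averaged mixed second differences gain a power of the step. -/
theorem LocalSolution.mixed_difference_le (E : AdmissibleExponents N p s₁ sp)
    (H : LocalSolution p s₁ sp x₀ R M u) (hq : p ≤ q) (hσ : 0 ≤ σ) (hd : 0 < d)
    (hρ : ρ + 2 * d ≤ R) (hA : 1 ≤ A) (hI : IncrementBound q x₀ ρ d u σ (A * M ^ q))
    (h0 : h ≠ 0) (hh : ‖h‖ ≤ d) (hd1 : d ≤ 1) :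
    ∫⁻ x in Metric.closedBall x₀ (ρ - 2 * d), ∫⁻ k in Metric.closedBall (0 : Euc N) ‖h‖,
      ENNReal.ofReal (|(u (x + k + h) - u (x + k)) - (u (x + h) - u x)| ^ q) ≤
    ENNReal.ofReal (mixedConst N p s₁ sp q * d ^ (-((N : ℝ) + 2)) * A * M ^ q *
      ‖h‖ ^ ((N : ℝ) + improvedExponent p sp q σ * q)) := by
  have hu := H.measurable
  have hp1 := E.one_lt
  have hp2 := E.lt_two
  have hM1 := H.one_le_bound
  have hM0 : 0 < M := by linarith
  have hn : 0 < ‖h‖ := norm_pos_iff.2 h0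
  have hV := unitBallVolume_pos N
  have hq0 : 0 < q := by linarith
  have hs0 : 0 < sp * p := mul_pos E.sp_pos (by linarith)
  set s := sp * p with hs
  -- Chosen so that (p − 1) + β = q, which makes the powers of M recombine to M^q; q ≥ p gives β ≥
  -- 1.
  set β := q + 1 - p with hβ
  set g := s - σ * (p - 1) with hg
  -- With l = ‖h‖^{−μ} the two interpolation terms carry ‖h‖ to the powers N + s + σβ − μ and N + σq
  -- + μq/(2−p). This μ equates them, and both become N + σ'q with σ' the improved exponent.
  set μ := (2 - p) * g / (q + 2 - p) with hμ
  set l := ‖h‖ ^ (-μ) with hl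
  have hl0 : 0 < l := by positivity
  set c := (p - 1) * 2 ^ (p - q) with hc
  have hc0 : 0 < c := mul_pos (by linarith) (by positivity)
  have hρ1 : ρ ≤ 1 := by linarith [H.radius_le_one]
  have hm : ∀ (y : Euc N) (r : ℝ), MeasurableSet (Metric.closedBall y r) :=
    fun _ _ => Metric.isClosed_closedBall.measurableSet
  have hen := H.energy_le E (β := β) (h := h) (by linarith : 1 ≤ β) hd hd1 hρ hh
  have hlow := hI.lower_power (β := β) hA hM1 (by linarith) (by linarith) hρ1 h0 hh
  set e : Euc N × Euc N → ENNReal := fun z => ENNReal.ofReal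
      ((oddPow (p - 1) (u (z.1 + h) - u (z.2 + h)) - oddPow (p - 1) (u z.1 - u z.2)) *
        (oddPow β (u (z.1 + h) - u z.1) - oddPow β (u (z.2 + h) - u z.2)) /
          ‖z.1 - z.2‖ ^ ((N : ℝ) + s)) with he
  have hem : Measurable e := by fun_prop
  have hfib := lintegral_fiber_le (x₀ := x₀) (ρ := ρ - d) hem hd.le hh
  rw [show ρ - d - d = ρ - 2 * d by ring] at hfib
  have hAM : 0 ≤ A * M ^ q := by positivity
  have hav1 := hI.lintegral_average_le (ρ' := ρ - 2 * d) hu hq0 hσ hAM hn.le hh (k₀ := h)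
    (by linarith)
  have hav0 := hI.lintegral_average_le (ρ' := ρ - 2 * d) hu hq0 hσ hAM hn.le hh (k₀ := 0)
    (by simp; linarith)
  simp only [add_zero] at hav0
  set L := ENNReal.ofReal (l * c⁻¹ * ‖h‖ ^ ((N : ℝ) + s)) with hL
  set L' := ENNReal.ofReal (l ^ (-(q / (2 - p))) * 2 ^ q) with hL'
  have hpt : ∀ x, ∀ k ∈ Metric.closedBall (0 : Euc N) ‖h‖,
      ENNReal.ofReal (|(u (x + k + h) - u (x + k)) - (u (x + h) - u x)| ^ q) ≤
      L * e (x, x + k) + L' * (ENNReal.ofReal (|u (x + h + k) - u (x + h)| ^ q) +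
        ENNReal.ofReal (|u (x + k) - u x| ^ q)) := by
    intro x k hk
    rw [mem_closedBall_zero_iff] at hk
    rcases eq_or_ne k 0 with rfl | hk0
    · simp [Real.zero_rpow hq0.ne']
    have hkn : 0 < ‖k‖ := norm_pos_iff.2 hk0
    have h1 := abs_sub_rpow_le_energy hp1 hp2 hq (a := u (x + h) - u (x + k + h))
      (b := u x - u (x + k)) (s := u (x + k + h) - u (x + k)) (t := u (x + h) - u x) (by ring) hl0
    have hX0 := oddPow_sub_mul_sub_nonneg (r := p - 1) (k := q + 1 - p) (by linarith) (by linarith)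
      (a := u (x + h) - u (x + k + h))
      (b := u x - u (x + k)) (s := u (x + k + h) - u (x + k)) (t := u (x + h) - u x) (by ring)
    rw [← hβ, ← hc] at h1
    rw [← hβ] at hX0
    set X := (oddPow (p - 1) (u (x + h) - u (x + k + h)) - oddPow (p - 1) (u x - u (x + k))) *
      (oddPow β (u (x + h) - u x) - oddPow β (u (x + k + h) - u (x + k))) with hX
    have h2 : e (x, x + k) = ENNReal.ofReal (X / ‖k‖ ^ ((N : ℝ) + s)) := by
      simp only [he, hX, sub_add_cancel_left, norm_neg]
    -- For ‖k‖ ≤ ‖h‖ the singular kernel is at least ‖h‖^{−N−s}; nonnegativity of X lets it be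
    -- inserted at this cost.
    have h3 : X ≤ ‖h‖ ^ ((N : ℝ) + s) * (X / ‖k‖ ^ ((N : ℝ) + s)) := by
      rw [mul_div_assoc', le_div_iff₀ (by positivity), mul_comm]
      exact mul_le_mul_of_nonneg_right (Real.rpow_le_rpow hkn.le hk (by positivity)) hX0
    have h4 := add_rpow_le_two_rpow_mul hq0.le (abs_nonneg (u (x + h) - u (x + k + h)))
      (abs_nonneg (u x - u (x + k)))
    rw [h2, hL, hL', ← ENNReal.ofReal_add (by positivity) (by positivity),
      ← ENNReal.ofReal_mul (by positivity), ← ENNReal.ofReal_mul (by positivity),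
      ← ENNReal.ofReal_add (by positivity) (by positivity)]
    refine ENNReal.ofReal_le_ofReal ?_
    rw [show |(u (x + k + h) - u (x + k)) - (u (x + h) - u x)| =
      |(u (x + h) - u (x + k + h)) - (u x - u (x + k))| by rw [← abs_neg]; congr 1; ring,
      show x + h + k = x + k + h by abel, abs_sub_comm (u (x + k + h)) (u (x + h)),
      abs_sub_comm (u (x + k)) (u x)]
    refine h1.trans (add_le_add ?_ ?_)
    · rw [mul_assoc (l * c⁻¹)]
      exact mul_le_mul_of_nonneg_left h3 (by positivity)
    · rw [mul_assoc (l ^ (-(q / (2 - p))))]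
      exact mul_le_mul_of_nonneg_left h4 (by positivity)
  have hCe : energyConst N p s₁ sp = ENNReal.ofReal (energyConst N p s₁ sp).toReal :=
    (ENNReal.ofReal_toReal (energyConst_lt_top E).ne).symm
  set Ce := (energyConst N p s₁ sp).toReal with hCedef
  have hCe0 : 0 ≤ Ce := ENNReal.toReal_nonneg
  set K := d ^ (-((N : ℝ) + 2)) with hK
  have hK0 : 0 < K := by positivity
  have hK1 : 1 ≤ K := Real.one_le_rpow_of_pos_of_le_one_of_nonpos hd hd1
    (by linarith [(Nat.cast_nonneg N : (0 : ℝ) ≤ N)])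
  calc _ ≤ ∫⁻ x in Metric.closedBall x₀ (ρ - 2 * d), ∫⁻ k in Metric.closedBall (0 : Euc N) ‖h‖,
        (L * e (x, x + k) + L' * (ENNReal.ofReal (|u (x + h + k) - u (x + h)| ^ q) +
        ENNReal.ofReal (|u (x + k) - u x| ^ q))) :=
        lintegral_mono fun x => setLIntegral_mono' (hm _ _) (hpt x)
    _ = L * (∫⁻ x in Metric.closedBall x₀ (ρ - 2 * d), ∫⁻ k in Metric.closedBall (0 : Euc N) ‖h‖,
          e (x, x + k)) +
        L' * ((∫⁻ x in Metric.closedBall x₀ (ρ - 2 * d), ∫⁻ k in Metric.closedBall (0 : Euc N) ‖h‖,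
          ENNReal.ofReal (|u (x + h + k) - u (x + h)| ^ q)) +
          ∫⁻ x in Metric.closedBall x₀ (ρ - 2 * d), ∫⁻ k in Metric.closedBall (0 : Euc N) ‖h‖,
          ENNReal.ofReal (|u (x + k) - u x| ^ q)) := by
        have e1 : ∀ x, ∫⁻ k in Metric.closedBall (0 : Euc N) ‖h‖,
            (L * e (x, x + k) + L' * (ENNReal.ofReal (|u (x + h + k) - u (x + h)| ^ q) +
            ENNReal.ofReal (|u (x + k) - u x| ^ q))) =
            L * (∫⁻ k in Metric.closedBall (0 : Euc N) ‖h‖, e (x, x + k)) +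
            L' * ((∫⁻ k in Metric.closedBall (0 : Euc N) ‖h‖,
              ENNReal.ofReal (|u (x + h + k) - u (x + h)| ^ q)) +
              ∫⁻ k in Metric.closedBall (0 : Euc N) ‖h‖,
              ENNReal.ofReal (|u (x + k) - u x| ^ q)) := by
          intro x
          rw [lintegral_add_left (by fun_prop), lintegral_const_mul' _ _ ENNReal.ofReal_ne_top,
            lintegral_const_mul' _ _ ENNReal.ofReal_ne_top, lintegral_add_left (by fun_prop)]
        simp only [e1]
        have m1 : Measurable fun x => ∫⁻ k in Metric.closedBall (0 : Euc N) ‖h‖, e (x, x + k) :=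
          Measurable.lintegral_prod_right' (f := fun z : Euc N × Euc N => e (z.1, z.1 + z.2))
            (by fun_prop)
        have m2 : Measurable fun x => ∫⁻ k in Metric.closedBall (0 : Euc N) ‖h‖,
            ENNReal.ofReal (|u (x + h + k) - u (x + h)| ^ q) :=
          Measurable.lintegral_prod_right' (f := fun z : Euc N × Euc N =>
            ENNReal.ofReal (|u (z.1 + h + z.2) - u (z.1 + h)| ^ q)) (by fun_prop)
        rw [lintegral_add_left (m1.const_mul _), lintegral_const_mul' _ _ ENNReal.ofReal_ne_top,
          lintegral_const_mul' _ _ ENNReal.ofReal_ne_top, lintegral_add_left m2]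
    _ ≤ L * (ENNReal.ofReal (M ^ (p - 1) * K) * ENNReal.ofReal Ce *
          ENNReal.ofReal ((unitBallVolume N + 1) * A * M ^ β * ‖h‖ ^ (σ * β))) +
        L' * (ENNReal.ofReal (unitBallVolume N * ‖h‖ ^ (N : ℝ) * (A * M ^ q * ‖h‖ ^ (σ * q))) +
          ENNReal.ofReal (unitBallVolume N * ‖h‖ ^ (N : ℝ) * (A * M ^ q * ‖h‖ ^ (σ * q)))) := by
        refine add_le_add (mul_le_mul_right ?_ _) (mul_le_mul_right (add_le_add hav1 hav0) _)
        refine (hfib.trans hen).trans ?_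
        rw [← hCe]
        exact mul_le_mul_right hlow _
    _ = ENNReal.ofReal (l * c⁻¹ * ‖h‖ ^ ((N : ℝ) + s) * (M ^ (p - 1) * K * Ce *
          ((unitBallVolume N + 1) * A * M ^ β * ‖h‖ ^ (σ * β))) +
        l ^ (-(q / (2 - p))) * 2 ^ q *
          (unitBallVolume N * ‖h‖ ^ (N : ℝ) * (A * M ^ q * ‖h‖ ^ (σ * q)) +
          unitBallVolume N * ‖h‖ ^ (N : ℝ) * (A * M ^ q * ‖h‖ ^ (σ * q)))) := by
        rw [← ENNReal.ofReal_mul (by positivity), ← ENNReal.ofReal_mul (by positivity),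
          ← ENNReal.ofReal_add (by positivity) (by positivity), hL, hL',
          ← ENNReal.ofReal_mul (by positivity), ← ENNReal.ofReal_mul (by positivity),
          ← ENNReal.ofReal_add (by positivity) (by positivity)]
    _ ≤ _ := by
        refine ENNReal.ofReal_le_ofReal ?_
        have hqp : q + 2 - p ≠ 0 := by linarith
        have h2p : 2 - p ≠ 0 := by linarith
        have x1 : l * ‖h‖ ^ ((N : ℝ) + s) * ‖h‖ ^ (σ * β) =
            ‖h‖ ^ ((N : ℝ) + improvedExponent p sp q σ * q) := by
          rw [hl, ← Real.rpow_add hn, ← Real.rpow_add hn]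
          congr 1
          rw [hμ, improvedExponent, ← hs, ← hg, hβ]
          field_simp
          rw [hg]; ring
        have x2 : l ^ (-(q / (2 - p))) * ‖h‖ ^ (N : ℝ) * ‖h‖ ^ (σ * q) =
            ‖h‖ ^ ((N : ℝ) + improvedExponent p sp q σ * q) := by
          rw [hl, ← Real.rpow_mul hn.le, ← Real.rpow_add hn, ← Real.rpow_add hn]
          congr 1
          rw [hμ, improvedExponent, ← hs, ← hg]
          field_simp
          ring
        have x3 : M ^ (p - 1) * M ^ β = M ^ q := by
          rw [← Real.rpow_add hM0]; congr 1; rw [hβ]; ring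
        have x4 : (2 : ℝ) ^ (q + 1) = 2 ^ q * 2 := by
          rw [Real.rpow_add (by norm_num), Real.rpow_one]
        set Hn := ‖h‖ ^ ((N : ℝ) + improvedExponent p sp q σ * q) with hHn
        have hHn0 : 0 < Hn := by positivity
        have y1 : l * c⁻¹ * ‖h‖ ^ ((N : ℝ) + s) * (M ^ (p - 1) * K * Ce *
            ((unitBallVolume N + 1) * A * M ^ β * ‖h‖ ^ (σ * β))) =
            c⁻¹ * Ce * (unitBallVolume N + 1) * K * A * M ^ q * Hn := by
          rw [← x1, ← x3]; ring
        have y2 : l ^ (-(q / (2 - p))) * 2 ^ q *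
            (unitBallVolume N * ‖h‖ ^ (N : ℝ) * (A * M ^ q * ‖h‖ ^ (σ * q)) +
            unitBallVolume N * ‖h‖ ^ (N : ℝ) * (A * M ^ q * ‖h‖ ^ (σ * q))) =
            2 ^ (q + 1) * unitBallVolume N * A * M ^ q * Hn := by
          rw [← x2, x4]; ring
        rw [y1, y2, mixedConst, ← hc, ← hCedef]
        have y3 : 0 ≤ 2 ^ (q + 1) * unitBallVolume N * A * M ^ q * Hn := by positivity
        have y4 := mul_le_mul_of_nonneg_left hK1 y3
        linarith [show (c⁻¹ * Ce * (unitBallVolume N + 1) + 2 ^ (q + 1) * unitBallVolume N) *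
          K * A * M ^ q * Hn = c⁻¹ * Ce * (unitBallVolume N + 1) * K * A * M ^ q * Hn +
          2 ^ (q + 1) * unitBallVolume N * A * M ^ q * Hn * K by ring]

end

/-! ### From mixed differences to second and first differences -/

section
variable {N : ℕ} {p s₁ sp q σ A : ℝ} {x₀ : Euc N} {ρ d R M β : ℝ} {h : Euc N} {u : Euc N → ℝ}

/-- Iterated differences are controlled by averages of mixed differences. -/
theorem second_difference_le {B : ℝ} (hu : Measurable u) (hq : 0 ≤ q) (h0 : h ≠ 0) (hh : ‖h‖ ≤ d)
    (hB : ∫⁻ x in Metric.closedBall x₀ ρ, ∫⁻ k in Metric.closedBall (0 : Euc N) ‖h‖,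
      ENNReal.ofReal (|(u (x + k + h) - u (x + k)) - (u (x + h) - u x)| ^ q) ≤
      ENNReal.ofReal (B * ‖h‖ ^ (N : ℝ))) (hB0 : 0 ≤ B) :
    ∫⁻ x in Metric.closedBall x₀ (ρ - d),
      ENNReal.ofReal (|(u (x + h + h) - u (x + h)) - (u (x + h) - u x)| ^ q) ≤
    ENNReal.ofReal (2 ^ (q + 1) * 2 ^ (N : ℝ) / unitBallVolume N * B) := by
  have hn : 0 < ‖h‖ := norm_pos_iff.2 h0
  have hV := unitBallVolume_pos N
  have hm : ∀ (y : Euc N) (r : ℝ), MeasurableSet (Metric.closedBall y r) :=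
    fun _ _ => Metric.isClosed_closedBall.measurableSet
  -- The ball with diameter [0, h]: for k in D both k and h − k are admissible steps of length at
  -- most ‖h‖. Its volume is the source of the factor 2^N divided by the unit ball volume.
  set D := Metric.closedBall ((1 / 2 : ℝ) • h) (‖h‖ / 2) with hD
  have hDk : ∀ k ∈ D, ‖k‖ ≤ ‖h‖ ∧ ‖h - k‖ ≤ ‖h‖ := by
    intro k hk
    rw [hD, mem_closedBall_iff_norm] at hk
    have h1 : ‖(1 / 2 : ℝ) • h‖ = ‖h‖ / 2 := by
      rw [norm_smul]; norm_num; ring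
    constructor
    · have := norm_add_le (k - (1 / 2 : ℝ) • h) ((1 / 2 : ℝ) • h)
      rw [sub_add_cancel] at this
      linarith
    · have := norm_sub_le ((1 / 2 : ℝ) • h) (k - (1 / 2 : ℝ) • h)
      rw [show (1 / 2 : ℝ) • h - (k - (1 / 2 : ℝ) • h) = h - k by module] at this
      linarith
  set f : Euc N → Euc N → ENNReal := fun x k =>
    ENNReal.ofReal (|(u (x + k + h) - u (x + k)) - (u (x + h) - u x)| ^ q) with hf
  have hfm : Measurable (Function.uncurry f) := by
    simp only [hf, Function.uncurry_def]; fun_prop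
  have hfm' : ∀ x, Measurable (f x) := fun x => by simp only [hf]; fun_prop
  set S := ∫⁻ x in Metric.closedBall x₀ (ρ - d),
      ENNReal.ofReal (|(u (x + h + h) - u (x + h)) - (u (x + h) - u x)| ^ q) with hS
  -- The difference of δ_h u between x and x + h passes through the intermediate point x + k, which
  -- leaves two mixed differences, with steps k and h − k.
  have hpt : ∀ x k,
      ENNReal.ofReal (|(u (x + h + h) - u (x + h)) - (u (x + h) - u x)| ^ q) ≤
      ENNReal.ofReal (2 ^ q) * (f x k + f (x + k) (h - k)) := by
    intro x k
    simp only [hf]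
    rw [show x + k + (h - k) = x + h by abel, ← ENNReal.ofReal_add (by positivity) (by positivity),
      ← ENNReal.ofReal_mul (by positivity)]
    refine ENNReal.ofReal_le_ofReal (le_trans (Real.rpow_le_rpow (abs_nonneg _) ?_ hq)
      (add_rpow_le_two_rpow_mul hq (abs_nonneg _) (abs_nonneg _)))
    refine le_trans (le_of_eq ?_) (abs_add_le _ _)
    congr 1; ring
  have hsum : ENNReal.ofReal ((‖h‖ / 2) ^ (N : ℝ) * unitBallVolume N) * S ≤
      ENNReal.ofReal (2 ^ q) * (ENNReal.ofReal (B * ‖h‖ ^ (N : ℝ)) +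
        ENNReal.ofReal (B * ‖h‖ ^ (N : ℝ))) := by
    calc _ = ∫⁻ x in Metric.closedBall x₀ (ρ - d), ∫⁻ _ in D,
          ENNReal.ofReal (|(u (x + h + h) - u (x + h)) - (u (x + h) - u x)| ^ q) := by
          simp only [lintegral_const, Measure.restrict_apply_univ]
          rw [hD, volume_closedBall_eq _ (by positivity),
            lintegral_mul_const' _ _ ENNReal.ofReal_ne_top, mul_comm]
      _ ≤ ∫⁻ x in Metric.closedBall x₀ (ρ - d), ∫⁻ k in D,
          ENNReal.ofReal (2 ^ q) * (f x k + f (x + k) (h - k)) :=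
          lintegral_mono fun x => lintegral_mono fun k => hpt x k
      _ = ENNReal.ofReal (2 ^ q) * ((∫⁻ x in Metric.closedBall x₀ (ρ - d), ∫⁻ k in D, f x k) +
          ∫⁻ x in Metric.closedBall x₀ (ρ - d), ∫⁻ k in D, f (x + k) (h - k)) := by
          have e1 : ∀ x, ∫⁻ k in D, ENNReal.ofReal (2 ^ q) * (f x k + f (x + k) (h - k)) =
              ENNReal.ofReal (2 ^ q) * ((∫⁻ k in D, f x k) + ∫⁻ k in D, f (x + k) (h - k)) := by
            intro x
            rw [lintegral_const_mul' _ _ ENNReal.ofReal_ne_top, lintegral_add_left (hfm' x)]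
          have hfi : Measurable fun x => ∫⁻ k in D, f x k :=
            Measurable.lintegral_prod_right' (f := Function.uncurry f) hfm
          simp only [e1]
          rw [lintegral_const_mul' _ _ ENNReal.ofReal_ne_top,
            lintegral_add_left hfi]
      _ ≤ _ := by
          refine mul_le_mul_right (add_le_add ?_ ?_) _
          · refine le_trans ?_ hB
            refine le_trans (lintegral_mono_set (Metric.closedBall_subset_closedBall
              (by linarith : ρ - d ≤ ρ))) (lintegral_mono fun x => lintegral_mono_set fun k hk => ?_)
            rw [mem_closedBall_zero_iff]
            exact (hDk k hk).1
          · have hsw : Measurable (fun z : Euc N × Euc N => f (z.1 + z.2) (h - z.2)) := by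
              simp only [hf]; fun_prop
            rw [lintegral_lintegral_swap (f := fun x k => f (x + k) (h - k)) hsw.aemeasurable]
            refine le_trans ?_ hB
            rw [lintegral_lintegral_swap hfm.aemeasurable]
            calc _ ≤ ∫⁻ k in D, ∫⁻ x in Metric.closedBall x₀ ρ, f x (h - k) := by
                  refine setLIntegral_mono' (hm _ _) fun k hk => ?_
                  exact setLIntegral_closedBall_comp_add_le (fun x => f x (h - k)) x₀ k
                    (by linarith [(hDk k hk).1])
              _ ≤ _ := by
                  rw [← lintegral_indicator (hm _ _), ← lintegral_indicator (hm _ _),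
                    ← lintegral_sub_left_eq_self
                      ((Metric.closedBall (0 : Euc N) ‖h‖).indicator
                        fun k => ∫⁻ x in Metric.closedBall x₀ ρ, f x k) h]
                  refine lintegral_mono fun k => ?_
                  by_cases hk : k ∈ D
                  · rw [indicator_of_mem hk, indicator_of_mem]
                    rw [mem_closedBall_zero_iff]
                    exact (hDk k hk).2
                  · rw [indicator_of_notMem hk]; exact zero_le
  have hvol : 0 < (‖h‖ / 2) ^ (N : ℝ) * unitBallVolume N := by positivity
  rw [mul_comm, ← ENNReal.le_div_iff_mul_le (Or.inl (ENNReal.ofReal_pos.2 hvol).ne')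
    (Or.inl ENNReal.ofReal_ne_top), ← ENNReal.ofReal_add (by positivity) (by positivity),
    ← ENNReal.ofReal_mul (by positivity), ← ENNReal.ofReal_div_of_pos hvol] at hsum
  refine hsum.trans (ENNReal.ofReal_le_ofReal (le_of_eq ?_))
  rw [Real.div_rpow hn.le (by norm_num), Real.rpow_add (by norm_num) q 1, Real.rpow_one]
  field_simp
  ring

theorem two_mul_ofReal (t : ℝ) : 2 * ENNReal.ofReal t = ENNReal.ofReal (2 * t) := by
  rw [ENNReal.ofReal_mul (by norm_num), ENNReal.ofReal_ofNat]

/-- A bound for second differences implies one for first differences, below exponent one. -/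
theorem incrementBound_of_second_difference {B M' : ℝ} (hu : Measurable u) (hq : 1 ≤ q)
    (hσ : σ < 1) (hd : 0 < d) (hd1 : d ≤ 1) (hρ1 : ρ ≤ 1) (hB : 0 ≤ B) (hM : 0 ≤ M')
    (hb : ∀ x ∈ Metric.closedBall x₀ ρ, |u x| ≤ M')
    (hb' : ∀ x ∈ Metric.closedBall x₀ ρ, ∀ h : Euc N, ‖h‖ ≤ d → |u (x + h)| ≤ M')
    (h2 : ∀ h : Euc N, h ≠ 0 → ‖h‖ ≤ d → ∫⁻ x in Metric.closedBall x₀ ρ,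
      ENNReal.ofReal (|(u (x + h + h) - u (x + h)) - (u (x + h) - u x)| ^ q) ≤
        ENNReal.ofReal (B * ‖h‖ ^ (σ * q))) :
    IncrementBound q x₀ ρ d u σ
      (2 ^ q * (B / (2 - 2 ^ σ) ^ q + (4 * M') ^ q * unitBallVolume N / d ^ q)) := by
  have hq0 : 0 < q := by linarith
  have hV := unitBallVolume_pos N
  have h2σ : (2 : ℝ) ^ σ < 2 := by
    calc (2 : ℝ) ^ σ < 2 ^ (1 : ℝ) := Real.rpow_lt_rpow_of_exponent_lt (by norm_num) hσ
      _ = 2 := Real.rpow_one 2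
  have hgap : 0 < 2 - (2 : ℝ) ^ σ := by linarith
  set V := unitBallVolume N with hVdef
  -- X is the fixed point of doubling: 2^σ X + B^{1/q} = 2X. Y covers the steps longer than d/2,
  -- where u is merely bounded and ‖h‖^σ ≥ d/2.
  set X := B ^ (1 / q) / (2 - 2 ^ σ) with hX
  set Y := 4 * M' * V ^ (1 / q) / d with hY
  have hX0 : 0 ≤ X := by positivity
  have hY0 : 0 ≤ Y := by positivity
  set n : Euc N → ENNReal := fun h =>
    (∫⁻ x in Metric.closedBall x₀ ρ, ENNReal.ofReal (|u (x + h) - u x|) ^ q) ^ (1 / q) with hn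
  -- Induction on the number of doublings after which the step exceeds d. For j = 0 the two
  -- conditions on ‖h‖ contradict each other, so the genuine start is the case ‖h‖ > d/2 below.
  have claim : ∀ j : ℕ, ∀ h : Euc N, ‖h‖ ≤ d → d < 2 ^ j * ‖h‖ →
      n h ≤ ENNReal.ofReal ((X + Y) * ‖h‖ ^ σ) := by
    intro j
    induction j with
    | zero => intro h hh hlt; simp at hlt; linarith
    | succ j ih =>
      intro h hh hlt
      have hpos : 0 < ‖h‖ := by
        by_contra hc
        have : ‖h‖ = 0 := le_antisymm (not_lt.1 hc) (norm_nonneg h)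
        rw [this, mul_zero] at hlt
        linarith
      rcases le_or_gt (‖h‖) (d / 2) with hhalf | hhalf
      · have hnorm2 : ‖h + h‖ = 2 * ‖h‖ := by
          rw [← two_smul ℝ h, norm_smul]; norm_num
        have ih' := ih (h + h) (by rw [hnorm2]; linarith) (by
          rw [hnorm2, ← mul_assoc, ← pow_succ]; exact hlt)
        have hsec := h2 h (norm_pos_iff.1 hpos) hh
        have hsec' : (∫⁻ x in Metric.closedBall x₀ ρ, ENNReal.ofReal
            (|(u (x + h + h) - u (x + h)) - (u (x + h) - u x)|) ^ q) ^ (1 / q) ≤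
            ENNReal.ofReal (B ^ (1 / q) * ‖h‖ ^ σ) := by
          simp only [ENNReal.ofReal_rpow_of_nonneg (abs_nonneg _) hq0.le]
          refine (ENNReal.rpow_le_rpow hsec (by positivity)).trans (le_of_eq ?_)
          rw [ENNReal.ofReal_rpow_of_nonneg (by positivity) (by positivity),
            Real.mul_rpow hB (by positivity), ← Real.rpow_mul hpos.le, mul_assoc,
            mul_one_div_cancel hq0.ne', mul_one]
        -- Minkowski's inequality for 2 δ_h u = δ_{2h} u − δ_h δ_h u.
        have htri : 2 * n h ≤ n (h + h) + (∫⁻ x in Metric.closedBall x₀ ρ, ENNReal.ofReal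
            (|(u (x + h + h) - u (x + h)) - (u (x + h) - u x)|) ^ q) ^ (1 / q) := by
          refine le_trans ?_ (ENNReal.lintegral_Lp_add_le (by fun_prop) (by fun_prop) hq)
          have : 2 * n h = (∫⁻ x in Metric.closedBall x₀ ρ,
              (2 * ENNReal.ofReal (|u (x + h) - u x|)) ^ q) ^ (1 / q) := by
            simp only [ENNReal.mul_rpow_of_nonneg _ _ hq0.le]
            rw [lintegral_const_mul' _ _ (by simp), ENNReal.mul_rpow_of_nonneg _ _ (by positivity),
              ← ENNReal.rpow_mul, mul_one_div_cancel hq0.ne', ENNReal.rpow_one]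
          rw [this]
          refine ENNReal.rpow_le_rpow (lintegral_mono fun x => ENNReal.rpow_le_rpow ?_ hq0.le)
            (by positivity)
          simp only [Pi.add_apply]
          rw [← ENNReal.ofReal_add (abs_nonneg _) (abs_nonneg _), two_mul_ofReal]
          refine ENNReal.ofReal_le_ofReal ?_
          rw [← add_assoc, show (2 : ℝ) * |u (x + h) - u x| = |2 * (u (x + h) - u x)| by
            rw [abs_mul]; norm_num]
          refine le_trans (le_of_eq ?_) (abs_sub _ _)
          congr 1; ring
        have hfin : 2 * n h ≤ 2 * ENNReal.ofReal ((X + Y) * ‖h‖ ^ σ) := by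
          refine htri.trans ((add_le_add ih' hsec').trans ?_)
          rw [hnorm2, ← ENNReal.ofReal_add (by positivity) (by positivity), two_mul_ofReal]
          refine ENNReal.ofReal_le_ofReal ?_
          rw [Real.mul_rpow (by norm_num) hpos.le]
          have e1 : B ^ (1 / q) = X * (2 - 2 ^ σ) := by rw [hX]; field_simp
          rw [e1]
          have e2 : 0 ≤ Y * (2 - 2 ^ σ) * ‖h‖ ^ σ := by positivity
          nlinarith
        exact (ENNReal.mul_le_mul_iff_right (by simp) (by simp)).1 hfin
      · have hle : ∀ x ∈ Metric.closedBall x₀ ρ,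
            ENNReal.ofReal (|u (x + h) - u x|) ^ q ≤ ENNReal.ofReal (2 * M') ^ q := fun x hx => by
          refine ENNReal.rpow_le_rpow (ENNReal.ofReal_le_ofReal ?_) hq0.le
          linarith [abs_sub (u (x + h)) (u x), hb x hx, hb' x hx h hh]
        have h3 : n h ≤ ENNReal.ofReal (2 * M' * V ^ (1 / q)) := by
          refine (ENNReal.rpow_le_rpow (setLIntegral_mono'
            Metric.isClosed_closedBall.measurableSet hle) (by positivity)).trans ?_
          rw [lintegral_const, Measure.restrict_apply_univ,
            ENNReal.mul_rpow_of_nonneg _ _ (by positivity), ← ENNReal.rpow_mul,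
            mul_one_div_cancel hq0.ne', ENNReal.rpow_one,
            ENNReal.ofReal_mul (p := 2 * M') (by positivity),
            ← ENNReal.ofReal_rpow_of_nonneg hV.le (by positivity)]
          exact mul_le_mul_right (ENNReal.rpow_le_rpow (volume_closedBall_le x₀ hρ1)
            (by positivity)) _
        refine h3.trans (ENNReal.ofReal_le_ofReal ?_)
        have h4 : d / 2 ≤ ‖h‖ ^ σ := by
          have : ‖h‖ ^ (1 : ℝ) ≤ ‖h‖ ^ σ :=
            Real.rpow_le_rpow_of_exponent_ge hpos (hh.trans hd1) hσ.le
          rw [Real.rpow_one] at this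
          linarith
        calc 2 * M' * V ^ (1 / q) = Y * (d / 2) := by rw [hY]; field_simp; ring
          _ ≤ Y * ‖h‖ ^ σ := mul_le_mul_of_nonneg_left h4 hY0
          _ ≤ _ := by nlinarith [mul_nonneg hX0 (Real.rpow_nonneg hpos.le σ)]
  intro h h0 hh
  have hpos : 0 < ‖h‖ := norm_pos_iff.2 h0
  obtain ⟨j, hj⟩ := pow_unbounded_of_one_lt (d / ‖h‖) (one_lt_two : (1 : ℝ) < 2)
  rw [div_lt_iff₀ hpos] at hj
  have h3 := ENNReal.rpow_le_rpow (claim j h hh hj) hq0.le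
  simp only [hn] at h3
  rw [← ENNReal.rpow_mul, one_div_mul_cancel hq0.ne', ENNReal.rpow_one] at h3
  simp only [ENNReal.ofReal_rpow_of_nonneg (abs_nonneg _) hq0.le] at h3
  refine h3.trans ?_
  rw [ENNReal.ofReal_rpow_of_nonneg (by positivity) hq0.le]
  refine ENNReal.ofReal_le_ofReal ?_
  rw [Real.mul_rpow (by positivity) (by positivity), ← Real.rpow_mul hpos.le]
  refine mul_le_mul_of_nonneg_right ((add_rpow_le_two_rpow_mul hq0.le hX0 hY0).trans
    (le_of_eq ?_)) (by positivity)
  rw [hX, hY, Real.div_rpow (by positivity) hgap.le, Real.div_rpow (by positivity) hd.le,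
    Real.mul_rpow (by positivity) (by positivity), ← Real.rpow_mul hB, ← Real.rpow_mul hV.le,
    one_div_mul_cancel hq0.ne', Real.rpow_one, Real.rpow_one]

end

/-! ### Iteration of the differentiability gain -/

section
variable {N : ℕ} {p s₁ sp q σ : ℝ}

theorem IncrementBound.mono {x₀ : Euc N} {ρ d A A' : ℝ} {u : Euc N → ℝ}
    (h : IncrementBound q x₀ ρ d u σ A) (hA : A ≤ A') : IncrementBound q x₀ ρ d u σ A' :=
  fun k hk hkd => (h k hk hkd).trans (ENNReal.ofReal_le_ofReal
    (mul_le_mul_of_nonneg_right hA (Real.rpow_nonneg (norm_nonneg k) _)))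

theorem mixedConst_nonneg (hp : 1 < p) : 0 ≤ mixedConst N p s₁ sp q := by
  have h1 : 0 < p - 1 := by linarith
  have h2 := unitBallVolume_pos N
  have h3 : 0 ≤ (energyConst N p s₁ sp).toReal := ENNReal.toReal_nonneg
  unfold mixedConst
  positivity

/-- The defect s_p p − σ(p−1) is multiplied by 1 − (p−1)/(q+2−p), which is positive because p − 1 <
1 < q + 2 − p. -/
theorem improvedExponent_mul_lt (hp : 1 < p) (hp2 : p < 2) (hq : p ≤ q) (hσ : σ * (p - 1) < sp * p) :
    improvedExponent p sp q σ * (p - 1) < sp * p := by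
  have h1 : 0 < q + 2 - p := by linarith
  have h2 : 0 < sp * p - σ * (p - 1) := by linarith
  rw [improvedExponent, add_mul, div_mul_eq_mul_div]
  have : (sp * p - σ * (p - 1)) * (p - 1) / (q + 2 - p) < sp * p - σ * (p - 1) := by
    rw [div_lt_iff₀ h1]
    exact mul_lt_mul_of_pos_left (by linarith) h2
  linarith

theorem le_improvedExponent (hp : p ≤ q) (hσ : σ * (p - 1) < sp * p) :
    σ ≤ improvedExponent p sp q σ :=
  le_add_of_nonneg_right (div_nonneg (by linarith) (by linarith))

/-- One step of the improvement of differentiability. -/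
theorem exists_incrementBound_improved (E : AdmissibleExponents N p s₁ sp) (hsp : sp * p ≤ p - 1)
    (hq : p ≤ q) (hσ0 : 0 ≤ σ) (hσ : σ * (p - 1) < sp * p) :
    ∃ C : ℝ, 1 ≤ C ∧ ∀ (x₀ : Euc N) (R M : ℝ) (u : Euc N → ℝ) (ρ d A : ℝ),
      LocalSolution p s₁ sp x₀ R M u → 0 < d → d ≤ 1 → ρ + 2 * d ≤ R → 1 ≤ A →
      IncrementBound q x₀ ρ d u σ (A * M ^ q) →
      IncrementBound q x₀ (ρ - 3 * d) d u (improvedExponent p sp q σ)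
        (C * d ^ (-((N : ℝ) + 2 + q)) * A * M ^ q) := by
  have hp := E.one_lt
  have hq0 : 0 < q := by linarith
  set σ' := improvedExponent p sp q σ with hσ'
  have hσ'0 : 0 ≤ σ' := hσ0.trans (le_improvedExponent hq hσ)
  -- This is where s_p ≤ (p−1)/p is decisive: σ' < s_p p/(p−1) ≤ 1, and the passage from second to
  -- first differences fails from exponent one on.
  have hσ'1 : σ' < 1 := by
    have := improvedExponent_mul_lt hp E.lt_two hq hσ
    rw [← hσ'] at this
    by_contra hc
    nlinarith
  have h2σ : (2 : ℝ) ^ σ' < 2 := by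
    calc (2 : ℝ) ^ σ' < 2 ^ (1 : ℝ) := Real.rpow_lt_rpow_of_exponent_lt (by norm_num) hσ'1
      _ = 2 := Real.rpow_one 2
  have hgap : 0 < (2 - (2 : ℝ) ^ σ') ^ q := Real.rpow_pos_of_pos (by linarith) q
  have hV := unitBallVolume_pos N
  have hmix := mixedConst_nonneg (N := N) (s₁ := s₁) (sp := sp) (q := q) hp
  set V := unitBallVolume N with hVdef
  set D := mixedConst N p s₁ sp q with hD
  set gap := (2 - (2 : ℝ) ^ σ') ^ q with hgapdef
  set c₂ := 2 ^ (q + 1) * 2 ^ (N : ℝ) / V with hc₂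
  have hc₂0 : 0 < c₂ := by positivity
  refine ⟨2 ^ q * (c₂ * D / gap + 4 ^ q * V) + 1, by
    have : 0 ≤ 2 ^ q * (c₂ * D / gap + 4 ^ q * V) := by positivity
    linarith, ?_⟩
  intro x₀ R M u ρ d A H hd hd1 hρ hA hI
  have hM1 := H.one_le_bound
  have hM0 : 0 < M := by linarith
  have hR := H.radius_le_one
  set K := d ^ (-((N : ℝ) + 2)) with hK
  have hK0 : 0 < K := by positivity
  have hsecond : ∀ h : Euc N, h ≠ 0 → ‖h‖ ≤ d → ∫⁻ x in Metric.closedBall x₀ (ρ - 3 * d),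
      ENNReal.ofReal (|(u (x + h + h) - u (x + h)) - (u (x + h) - u x)| ^ q) ≤
        ENNReal.ofReal (c₂ * (D * K * A * M ^ q) * ‖h‖ ^ (σ' * q)) := by
    intro h h0 hh
    have hn : 0 < ‖h‖ := norm_pos_iff.2 h0
    have h1 := H.mixed_difference_le E hq hσ0 hd hρ hA hI h0 hh hd1
    rw [← hσ', ← hD, ← hK, add_comm (N : ℝ), Real.rpow_add hn, ← mul_assoc] at h1
    have h2 := second_difference_le H.measurable hq0.le h0 hh h1 (by positivity)
    rw [show ρ - 2 * d - d = ρ - 3 * d by ring] at h2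
    refine h2.trans (le_of_eq ?_)
    rw [← hVdef, ← hc₂, mul_assoc c₂]
  have hfinal := incrementBound_of_second_difference (M' := M) H.measurable (by linarith : 1 ≤ q)
    hσ'1 hd hd1 (by linarith : ρ - 3 * d ≤ 1) (by positivity) hM0.le
    (fun x hx => H.bound x (mem_ball_of_mem_closedBall hd (by linarith) hx))
    (fun x hx h hh => H.bound _ (add_mem_ball_of_mem_closedBall hd (by linarith) hh hx)) hsecond
  refine hfinal.mono ?_
  rw [← hgapdef, ← hVdef]
  -- One power of d for both contributions: d^{−(N+2)} from the energy inequality and d^{−q} from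
  -- the long steps in the doubling argument.
  set K' := d ^ (-((N : ℝ) + 2 + q)) with hK'
  have hK'0 : 0 < K' := by positivity
  have hNn : (0 : ℝ) ≤ N := Nat.cast_nonneg N
  have k1 : K ≤ K' := Real.rpow_le_rpow_of_exponent_ge hd hd1 (by linarith)
  have k2 : d ^ (-q) ≤ K' := Real.rpow_le_rpow_of_exponent_ge hd hd1 (by linarith)
  have e1 : c₂ * (D * K * A * M ^ q) / gap ≤ c₂ * D / gap * (K' * A * M ^ q) := by
    rw [show c₂ * (D * K * A * M ^ q) / gap = c₂ * D / gap * (K * A * M ^ q) by ring]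
    gcongr
  have e2 : (4 * M) ^ q * V / d ^ q ≤ 4 ^ q * V * (K' * A * M ^ q) := by
    rw [Real.mul_rpow (by norm_num) hM0.le, show 4 ^ q * M ^ q * V / d ^ q =
      4 ^ q * V * (d ^ (-q) * M ^ q) by rw [Real.rpow_neg hd.le]; ring]
    have : d ^ (-q) * M ^ q ≤ K' * A * M ^ q := by
      refine mul_le_mul_of_nonneg_right (k2.trans (le_mul_of_one_le_right hK'0.le hA)) ?_
      positivity
    gcongr
  have e3 : 0 ≤ K' * A * M ^ q := by positivity
  have e4 : (0 : ℝ) < 2 ^ q := by positivity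
  have e5 := mul_le_mul_of_nonneg_left (add_le_add e1 e2) e4.le
  refine e5.trans ?_
  rw [show (2 ^ q * (c₂ * D / gap + 4 ^ q * V) + 1) * K' * A * M ^ q =
    2 ^ q * (c₂ * D / gap * (K' * A * M ^ q) + 4 ^ q * V * (K' * A * M ^ q)) +
      K' * A * M ^ q by ring]
  linarith

/-- The exponents reached after finitely many improvement steps. -/
noncomputable def iteratedExponent (p sp q : ℝ) (n : ℕ) : ℝ :=
  (improvedExponent p sp q)^[n] 0

theorem iteratedExponent_succ (p sp q : ℝ) (n : ℕ) :
    iteratedExponent p sp q (n + 1) = improvedExponent p sp q (iteratedExponent p sp q n) := by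
  rw [iteratedExponent, Function.iterate_succ_apply', iteratedExponent]

/-- The recursion is affine with fixed point s_p p/(p−1) and contraction factor 1 − (p−1)/(q+2−p).
-/
theorem iteratedExponent_mul (hp : 1 < p) (hq : p ≤ q) (n : ℕ) :
    iteratedExponent p sp q n * (p - 1) =
      sp * p * (1 - (1 - (p - 1) / (q + 2 - p)) ^ n) := by
  induction n with
  | zero => simp [iteratedExponent]
  | succ n ih =>
    rw [iteratedExponent_succ, improvedExponent, add_mul, div_mul_eq_mul_div, ih, pow_succ]
    have : q + 2 - p ≠ 0 := by linarith
    field_simp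
    ring

theorem exists_lt_iteratedExponent (hp : 1 < p) (hp2 : p < 2) (hq : p ≤ q) (hs : 0 < sp * p)
    (hσ : σ < sp * p / (p - 1)) : ∃ n, σ < iteratedExponent p sp q n := by
  have hp1 : 0 < p - 1 := by linarith
  have hd : 0 < q + 2 - p := by linarith
  have h0 : 0 ≤ 1 - (p - 1) / (q + 2 - p) := by
    rw [sub_nonneg, div_le_one hd]; linarith
  have h1 : 1 - (p - 1) / (q + 2 - p) < 1 := by
    have : 0 < (p - 1) / (q + 2 - p) := by positivity
    linarith
  rw [lt_div_iff₀ hp1] at hσ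
  obtain ⟨n, hn⟩ := exists_pow_lt_of_lt_one
    (show 0 < (sp * p - σ * (p - 1)) / (sp * p) from div_pos (by linarith) hs) h1
  refine ⟨n, lt_of_mul_lt_mul_right ?_ hp1.le⟩
  rw [iteratedExponent_mul hp hq]
  rw [lt_div_iff₀ hs] at hn
  linarith

/-- The base case is σ = 0, where |δ_h u| ≤ 2M suffices. Each step consumes a radius 3d, namely 2d
for mixed and d for second differences. The final 2d keeps the translated balls inside B_R. -/
theorem exists_incrementBound_iterated (E : AdmissibleExponents N p s₁ sp) (hsp : sp * p ≤ p - 1)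
    (hq : p ≤ q) (n : ℕ) :
    0 ≤ iteratedExponent p sp q n ∧ iteratedExponent p sp q n * (p - 1) < sp * p ∧
    ∃ C κ : ℝ, 1 ≤ C ∧ 0 ≤ κ ∧ ∀ (x₀ : Euc N) (R M : ℝ) (u : Euc N → ℝ) (ρ d : ℝ),
      LocalSolution p s₁ sp x₀ R M u → 0 < d → d ≤ 1 → ρ + 3 * n * d + 2 * d ≤ R →
      IncrementBound q x₀ ρ d u (iteratedExponent p sp q n) (C * d ^ (-κ) * M ^ q) := by
  have hp := E.one_lt
  have hq0 : 0 < q := by linarith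
  have hs0 : 0 < sp * p := mul_pos E.sp_pos (by linarith)
  have hV := unitBallVolume_pos N
  induction n with
  | zero =>
    refine ⟨by simp [iteratedExponent], by simpa [iteratedExponent] using hs0,
      2 ^ q * unitBallVolume N + 1, 0, by
        have : 0 < 2 ^ q * unitBallVolume N := by positivity
        linarith, le_rfl, ?_⟩
    intro x₀ R M u ρ d H hd hd1 hρ h h0 hh
    have hM0 : 0 < M := by linarith [H.one_le_bound]
    simp only [CharP.cast_eq_zero, mul_zero, zero_mul, add_zero] at hρ
    have hle : ∀ x ∈ Metric.closedBall x₀ ρ, ENNReal.ofReal (|u (x + h) - u x| ^ q) ≤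
        ENNReal.ofReal ((2 * M) ^ q) := fun x hx => by
      refine ENNReal.ofReal_le_ofReal (Real.rpow_le_rpow (abs_nonneg _) ?_ hq0.le)
      linarith [abs_sub (u (x + h)) (u x), H.bound x (mem_ball_of_mem_closedBall hd hρ hx),
        H.bound _ (add_mem_ball_of_mem_closedBall hd hρ hh hx)]
    refine (setLIntegral_mono' Metric.isClosed_closedBall.measurableSet hle).trans ?_
    rw [lintegral_const, Measure.restrict_apply_univ]
    refine (mul_le_mul_right (volume_closedBall_le x₀ (by linarith [H.radius_le_one])) _).trans ?_
    rw [← ENNReal.ofReal_mul (by positivity)]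
    refine ENNReal.ofReal_le_ofReal ?_
    rw [Real.mul_rpow (by norm_num) hM0.le]
    simp only [iteratedExponent, Function.iterate_zero, id_eq, zero_mul, Real.rpow_zero, neg_zero,
      mul_one]
    have : 0 < M ^ q := by positivity
    nlinarith
  | succ n ih =>
    obtain ⟨hσ0, hσ, C, κ, hC, hκ, hbound⟩ := ih
    obtain ⟨C', hC', hstep⟩ := exists_incrementBound_improved E hsp hq hσ0 hσ
    rw [iteratedExponent_succ]
    refine ⟨hσ0.trans (le_improvedExponent hq hσ), improvedExponent_mul_lt hp E.lt_two hq hσ,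
      C' * C, (N : ℝ) + 2 + q + κ, by nlinarith, by positivity, ?_⟩
    intro x₀ R M u ρ d H hd hd1 hρ
    push_cast at hρ
    have h1 := hbound x₀ R M u (ρ + 3 * d) d H hd hd1 (by linarith)
    have hnd : 0 ≤ (n : ℝ) * d := by positivity
    have hdκ : 1 ≤ d ^ (-κ) := Real.one_le_rpow_of_pos_of_le_one_of_nonpos hd hd1 (by linarith)
    have h2 := hstep x₀ R M u (ρ + 3 * d) d (C * d ^ (-κ)) H hd hd1 (by nlinarith)
      (by nlinarith) h1
    rw [add_sub_cancel_right] at h2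
    refine h2.mono (le_of_eq ?_)
    rw [neg_add ((N : ℝ) + 2 + q), Real.rpow_add hd]
    ring

/-! ### From increment bounds to the Gagliardo seminorm -/

/-- A fractional Sobolev bound from increment bounds of higher order. -/
theorem gagliardo_rpow_le_of_incrementBound {x₀ : Euc N} {r d τ A M : ℝ} {u : Euc N → ℝ}
    (hu : Measurable u) (hq : 0 < q) (hσ : 0 < σ) (hr : r ≤ 1) (hd : 0 < d)
    (hd1 : d ≤ 1) (hA : 0 ≤ A) (hb : ∀ x ∈ Metric.ball x₀ r, |u x| ≤ M)
    (hI : IncrementBound q x₀ r d u τ A) :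
    gagliardo σ q (Metric.ball x₀ r) u ^ q ≤
      ENNReal.ofReal A * kernelMass N (σ * q) (τ * q) +
        ENNReal.ofReal ((2 * M) ^ q / d ^ ((N : ℝ) + σ * q) * unitBallVolume N ^ 2) := by
  have hV := unitBallVolume_pos N
  have hball : MeasurableSet (Metric.ball x₀ r) := Metric.isOpen_ball.measurableSet
  have hvol : volume (Metric.ball x₀ r) ≤ ENNReal.ofReal (unitBallVolume N) :=
    (measure_mono Metric.ball_subset_closedBall).trans (volume_closedBall_le x₀ hr)
  set f : Euc N × Euc N → ENNReal := fun z =>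
    ENNReal.ofReal (|u z.1 - u z.2| ^ q) / singWeight (σ * q) (z.1 - z.2) with hf
  have hfm : Measurable f := by fun_prop
  have hgag : gagliardo σ q (Metric.ball x₀ r) u ^ q =
      ∫⁻ x in Metric.ball x₀ r, ∫⁻ y in Metric.ball x₀ r, f (x, y) := by
    rw [gagliardo, ← ENNReal.rpow_mul, one_div_mul_cancel hq.ne', ENNReal.rpow_one]
    rfl
  set T := ENNReal.ofReal ((2 * M) ^ q / d ^ ((N : ℝ) + σ * q)) with hT
  have hinner : ∀ x ∈ Metric.ball x₀ r, ∫⁻ y in Metric.ball x₀ r, f (x, y) ≤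
      (∫⁻ k in Metric.closedBall (0 : Euc N) d, f (x, x + k)) +
        T * ENNReal.ofReal (unitBallVolume N) := by
    intro x hx
    -- At distance more than d from the diagonal the kernel is bounded, and boundedness of u is
    -- enough; only steps of length at most d call on the increment bound.
    have hsplit : ∀ y ∈ Metric.ball x₀ r, f (x, y) ≤
        (Metric.closedBall x d).indicator (fun y => f (x, y)) y + T := by
      intro y hy
      by_cases hxy : y ∈ Metric.closedBall x d
      · rw [indicator_of_mem hxy]; exact le_self_add
      · rw [indicator_of_notMem hxy, zero_add]
        rw [mem_closedBall_iff_norm, not_le, norm_sub_rev] at hxy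
        have hne : x - y ≠ 0 := norm_pos_iff.1 (hd.trans hxy)
        simp only [hf, hT]
        rw [ofReal_div_singWeight _ _ hne]
        have hM0 : 0 ≤ M := (abs_nonneg _).trans (hb x hx)
        refine ENNReal.ofReal_le_ofReal (div_le_div₀ (by positivity) ?_ (by positivity) ?_)
        · refine Real.rpow_le_rpow (abs_nonneg _) ?_ hq.le
          linarith [abs_sub (u x) (u y), hb x hx, hb y hy]
        · exact Real.rpow_le_rpow hd.le hxy.le (by positivity)
    calc _ ≤ ∫⁻ y in Metric.ball x₀ r,
          ((Metric.closedBall x d).indicator (fun y => f (x, y)) y + T) :=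
          setLIntegral_mono' hball hsplit
      _ ≤ (∫⁻ y, (Metric.closedBall x d).indicator (fun y => f (x, y)) y) +
          T * ENNReal.ofReal (unitBallVolume N) := by
          rw [lintegral_add_right _ measurable_const, lintegral_const, Measure.restrict_apply_univ]
          exact add_le_add (setLIntegral_le_lintegral _ _) (mul_le_mul_right hvol _)
      _ = _ := by
          congr 1
          rw [← lintegral_indicator Metric.isClosed_closedBall.measurableSet,
            ← lintegral_add_left_eq_self _ x]
          refine lintegral_congr fun k => ?_
          have : x + k ∈ Metric.closedBall x d ↔ k ∈ Metric.closedBall (0 : Euc N) d := by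
            rw [mem_closedBall_iff_norm, mem_closedBall_zero_iff, add_sub_cancel_left]
          by_cases hk : k ∈ Metric.closedBall (0 : Euc N) d
          · rw [indicator_of_mem hk, indicator_of_mem (this.2 hk)]
          · rw [indicator_of_notMem hk, indicator_of_notMem (fun h => hk (this.1 h))]
  rw [hgag]
  calc _ ≤ ∫⁻ x in Metric.ball x₀ r, ((∫⁻ k in Metric.closedBall (0 : Euc N) d, f (x, x + k)) +
        T * ENNReal.ofReal (unitBallVolume N)) := setLIntegral_mono' hball hinner
    _ ≤ (∫⁻ x in Metric.ball x₀ r, ∫⁻ k in Metric.closedBall (0 : Euc N) d, f (x, x + k)) +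
        T * ENNReal.ofReal (unitBallVolume N) * ENNReal.ofReal (unitBallVolume N) := by
        rw [lintegral_add_right _ measurable_const, lintegral_const, Measure.restrict_apply_univ]
        exact add_le_add le_rfl (mul_le_mul_right hvol _)
    _ ≤ _ := by
        refine add_le_add ?_ (le_of_eq ?_)
        · have hm : Measurable (fun z : Euc N × Euc N => f (z.1, z.1 + z.2)) := by fun_prop
          rw [lintegral_lintegral_swap (f := fun x k => f (x, x + k)) hm.aemeasurable]
          calc _ ≤ ∫⁻ k in Metric.closedBall (0 : Euc N) d, ENNReal.ofReal A *
                (ENNReal.ofReal (min 1 ‖k‖ ^ (τ * q)) / singWeight (σ * q) k) := by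
                refine setLIntegral_mono' Metric.isClosed_closedBall.measurableSet fun k hk => ?_
                rw [mem_closedBall_zero_iff] at hk
                rcases eq_or_ne k 0 with rfl | h0
                · simp [hf, Real.zero_rpow hq.ne']
                have e1 : ∀ x, f (x, x + k) =
                    ENNReal.ofReal (|u (x + k) - u x| ^ q) * (singWeight (σ * q) k)⁻¹ := by
                  intro x
                  simp only [hf]
                  rw [sub_add_cancel_left, singWeight_neg, abs_sub_comm, div_eq_mul_inv]
                simp only [e1]
                rw [lintegral_mul_const _ (by fun_prop), min_eq_right (hk.trans hd1),
                  ← mul_div_assoc, ← ENNReal.ofReal_mul hA, div_eq_mul_inv]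
                exact mul_le_mul_left ((lintegral_mono_set Metric.ball_subset_closedBall).trans
                  (hI k h0 hk)) _
            _ ≤ _ := by
                rw [lintegral_const_mul' _ _ ENNReal.ofReal_ne_top]
                exact mul_le_mul_right (setLIntegral_le_lintegral _ _) _
        -- Nothing forces M ≥ 0 when the ball is empty, and a real power of a negative number may be
        -- negative; both sides are then 0.
        · rcases le_or_gt 0 ((2 * M) ^ q / d ^ ((N : ℝ) + σ * q)) with h | h
          · rw [ENNReal.ofReal_mul h, ENNReal.ofReal_pow hV.le, pow_two, mul_assoc]
          · rw [hT, ENNReal.ofReal_of_nonpos h.le, ENNReal.ofReal_of_nonpos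
              (mul_nonpos_of_nonpos_of_nonneg h.le (by positivity))]
            simp

/-- The interior estimate for local solutions. -/
theorem exists_gagliardo_bound (E : AdmissibleExponents N p s₁ sp) (hsp : sp * p ≤ p - 1)
    (hq : p ≤ q) (hσ0 : 0 < σ) (hσ : σ < sp * p / (p - 1)) :
    ∃ C κ : ℝ, 0 < C ∧ 0 < κ ∧ ∀ (x₀ : Euc N) (R M r : ℝ) (u : Euc N → ℝ),
      LocalSolution p s₁ sp x₀ R M u → 0 < r → r < R →
      gagliardo σ q (Metric.ball x₀ r) u ^ q ≤ ENNReal.ofReal (C * M ^ q / (R - r) ^ κ) := by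
  have hp := E.one_lt
  have hq0 : 0 < q := by linarith
  have hV := unitBallVolume_pos N
  obtain ⟨n, hn⟩ := exists_lt_iteratedExponent hp E.lt_two hq (mul_pos E.sp_pos (by linarith)) hσ
  obtain ⟨-, -, C, κ, hC, hκ, hbound⟩ := exists_incrementBound_iterated E hsp hq n
  set τ := iteratedExponent p sp q n with hτ
  have hkm := kernelMass_lt_top E.one_le_dim (s := σ * q) (m := τ * q) (by positivity)
    (mul_lt_mul_of_pos_right hn hq0)
  set km := (kernelMass N (σ * q) (τ * q)).toReal with hkmdef
  have hkm0 : 0 ≤ km := ENNReal.toReal_nonneg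
  -- Chosen so that n improvement steps of 3d and the final margin 2d exhaust R − r when d = (R −
  -- r)/m.
  set m : ℝ := 3 * n + 2 with hm
  have hm0 : 0 < m := by positivity
  set κ' := κ + (N + σ * q) with hκ'
  have hκ'0 : 0 < κ' := by positivity
  set V := unitBallVolume N with hVdef
  refine ⟨(C * km + 2 ^ q * V ^ 2) * m ^ κ', κ', by positivity, hκ'0, ?_⟩
  intro x₀ R M r u H hr hrR
  have hM0 : 0 < M := by linarith [H.one_le_bound]
  have hR := H.radius_le_one
  have hRr : 0 < R - r := by linarith
  set d := (R - r) / m with hd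
  have hd0 : 0 < d := by positivity
  have hd1 : d ≤ 1 := by
    rw [hd, div_le_one hm0]
    have : (0 : ℝ) ≤ n := Nat.cast_nonneg n
    linarith
  have hmd : m * d = R - r := by rw [hd]; field_simp
  have hI := hbound x₀ R M u r d H hd0 hd1 (by rw [hm] at hmd; linarith)
  refine (gagliardo_rpow_le_of_incrementBound H.measurable hq0 hσ0 (by linarith) hd0 hd1
    (by positivity) (fun x hx => H.bound x (Metric.ball_subset_ball hrR.le hx)) hI).trans ?_
  rw [← ENNReal.ofReal_toReal hkm.ne, ← hkmdef, ← ENNReal.ofReal_mul (by positivity),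
    ← ENNReal.ofReal_add (by positivity) (by positivity)]
  refine ENNReal.ofReal_le_ofReal ?_
  rw [← hVdef]
  set K := d ^ (-κ') with hK
  have k1 : d ^ (-κ) ≤ K := Real.rpow_le_rpow_of_exponent_ge hd0 hd1 (by
    have : 0 < (N : ℝ) + σ * q := by positivity
    linarith)
  have k2 : d ^ (-((N : ℝ) + σ * q)) ≤ K := Real.rpow_le_rpow_of_exponent_ge hd0 hd1 (by linarith)
  have k3 : K = m ^ κ' / (R - r) ^ κ' := by
    rw [hK, hd, Real.rpow_neg (by positivity), Real.div_rpow hRr.le hm0.le, inv_div]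
  have hMq : 0 < M ^ q := by positivity
  calc _ = C * km * M ^ q * d ^ (-κ) + 2 ^ q * V ^ 2 * M ^ q * d ^ (-((N : ℝ) + σ * q)) := by
        rw [Real.rpow_neg hd0.le ((N : ℝ) + σ * q), Real.mul_rpow (by norm_num) hM0.le]; ring
    _ ≤ C * km * M ^ q * K + 2 ^ q * V ^ 2 * M ^ q * K := by gcongr
    _ = _ := by rw [k3]; ring

end

/-! ### Reduction of weak solutions to local solutions, and covering -/

section
variable {N : ℕ} {p s₁ sp : ℝ} {Ω : Set (Euc N)} {u : Euc N → ℝ}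

theorem MemTailSpace.aestronglyMeasurable {s : ℝ} (h : MemTailSpace s p u) :
    AEStronglyMeasurable u volume := by
  have h1 : ∀ n : ℕ, AEStronglyMeasurable u (volume.restrict (Metric.closedBall (0 : Euc N) n)) :=
    fun n => (h.1 _ (isCompact_closedBall 0 n)).1
  have h2 := AEStronglyMeasurable.iUnion h1
  have h3 : ⋃ n : ℕ, Metric.closedBall (0 : Euc N) n = univ := by
    rw [eq_univ_iff_forall]
    intro x
    obtain ⟨n, hn⟩ := exists_nat_ge ‖x‖
    exact mem_iUnion.2 ⟨n, by rwa [mem_closedBall_zero_iff]⟩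
  rwa [h3, Measure.restrict_univ] at h2

/-- Outside B_R(x₀) the quantity 1 + ‖x‖ is at most c‖x − x₀‖, so the tail kernel is dominated by
the weight of the tail space. -/
theorem MemTailSpace.tail_lt_top {s : ℝ} (h : MemTailSpace s p u) (hp : 1 < p) (hs : 0 < s)
    (x₀ : Euc N) {R : ℝ} (hR : 0 < R) : tail s p u x₀ R < ⊤ := by
  have hsp : 0 < s * p := mul_pos hs (by linarith)
  have hexp : 0 < (N : ℝ) + s * p := by positivity
  set c := (1 + ‖x₀‖) / R + 1 with hc
  have hc0 : 0 < c := by positivity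
  have hle : ∀ x ∈ (Metric.ball x₀ R)ᶜ, ENNReal.ofReal (|u x| ^ (p - 1)) /
        ENNReal.ofReal (‖x - x₀‖ ^ ((N : ℝ) + s * p)) ≤
      ENNReal.ofReal (c ^ ((N : ℝ) + s * p)) * (ENNReal.ofReal (|u x| ^ (p - 1)) /
        ENNReal.ofReal ((1 + ‖x‖) ^ ((N : ℝ) + s * p))) := by
    intro x hx
    have hxR : R ≤ ‖x - x₀‖ := by
      rwa [mem_compl_iff, mem_ball_iff_norm, not_lt] at hx
    have hx0 : 0 < ‖x - x₀‖ := hR.trans_le hxR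
    have h1 : 1 + ‖x‖ ≤ c * ‖x - x₀‖ := by
      have h2 : ‖x‖ ≤ ‖x - x₀‖ + ‖x₀‖ := by simpa using norm_add_le (x - x₀) x₀
      have h3 : 1 + ‖x₀‖ ≤ (1 + ‖x₀‖) / R * ‖x - x₀‖ := by
        rw [div_mul_eq_mul_div, le_div_iff₀ hR]
        exact mul_le_mul_of_nonneg_left hxR (by positivity)
      rw [hc, add_mul, one_mul]
      linarith
    rw [← ENNReal.ofReal_div_of_pos (by positivity), ← ENNReal.ofReal_div_of_pos (by positivity),
      ← ENNReal.ofReal_mul (by positivity)]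
    refine ENNReal.ofReal_le_ofReal ?_
    rw [mul_div_assoc', div_le_div_iff₀ (by positivity) (by positivity)]
    have h4 := Real.rpow_le_rpow (by positivity) h1 hexp.le
    rw [Real.mul_rpow hc0.le hx0.le] at h4
    have h5 := mul_le_mul_of_nonneg_left h4 (Real.rpow_nonneg (abs_nonneg (u x)) (p - 1))
    linarith
  have hint : ∫⁻ x in (Metric.ball x₀ R)ᶜ, ENNReal.ofReal (|u x| ^ (p - 1)) /
      ENNReal.ofReal (‖x - x₀‖ ^ ((N : ℝ) + s * p)) < ⊤ := by
    refine (setLIntegral_mono' Metric.isOpen_ball.measurableSet.compl hle).trans_lt ?_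
    rw [lintegral_const_mul' _ _ ENNReal.ofReal_ne_top]
    exact ENNReal.mul_lt_top ENNReal.ofReal_lt_top ((setLIntegral_le_lintegral _ _).trans_lt h.2)
  rw [tail]
  exact ENNReal.rpow_lt_top_of_nonneg (one_div_nonneg.2 (by linarith))
    (ENNReal.mul_lt_top ENNReal.ofReal_lt_top hint).ne

theorem gagliardo_congr {γ q : ℝ} {A : Set (Euc N)} {v : Euc N → ℝ} (h : u =ᵐ[volume] v) :
    gagliardo γ q A u = gagliardo γ q A v := by
  have h' : ∀ᵐ x ∂(volume.restrict A), u x = v x := ae_restrict_of_ae h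
  unfold gagliardo
  congr 1
  refine lintegral_congr_ae (h'.mono fun x hx => ?_)
  exact lintegral_congr_ae (h'.mono fun y hy => by simp only [hx, hy])

/-- A measurable representative that is bounded everywhere on a given set. -/
theorem exists_bounded_representative {A : Set (Euc N)} {m : ℝ} (hu : AEStronglyMeasurable u volume)
    (hA : MeasurableSet A) (hm : 0 ≤ m)
    (hb : eLpNorm u ⊤ (volume.restrict A) ≤ ENNReal.ofReal m) :
    ∃ v : Euc N → ℝ, Measurable v ∧ u =ᵐ[volume] v ∧ ∀ x ∈ A, |v x| ≤ m := by
  classical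
  have h0 := hu.ae_eq_mk
  have hmk : Measurable (hu.mk u) := hu.stronglyMeasurable_mk.measurable
  have hae : ∀ᵐ x, x ∈ A → |u x| ≤ m := by
    rw [← ae_restrict_iff' hA]
    filter_upwards [ae_le_eLpNormEssSup (f := u) (μ := volume.restrict A)] with x hx
    rw [← eLpNorm_exponent_top, ← ofReal_norm, Real.norm_eq_abs] at hx
    exact (ENNReal.ofReal_le_ofReal_iff hm).1 (hx.trans hb)
  refine ⟨A.piecewise (fun x => max (-m) (min m (hu.mk u x))) (hu.mk u), ?_, ?_, ?_⟩
  · exact Measurable.piecewise hA (by fun_prop) hmk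
  · filter_upwards [h0, hae] with x hx hxA
    by_cases hmem : x ∈ A
    · rw [piecewise_eq_of_mem _ _ _ hmem, ← hx]
      have := abs_le.1 (hxA hmem)
      rw [min_eq_right this.2, max_eq_right this.1]
    · rw [piecewise_eq_of_notMem _ _ _ hmem, hx]
  · intro x hx
    rw [piecewise_eq_of_mem _ _ _ hx, abs_le]
    exact ⟨le_max_left _ _, max_le (by linarith) (min_le_left _ _)⟩

theorem boundAndTail_lt_top {x₀ : Euc N} {R : ℝ} (hp : 1 < p) (hsp : 0 < sp)
    (hu : MemTailSpace sp p u) (hb : LocallyEssBounded Ω u) (hR : 0 < R)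
    (hball : CompactlyContained (Metric.ball x₀ R) Ω) : boundAndTail sp p u x₀ R < ⊤ :=
  ENNReal.add_lt_top.2 ⟨(hb _ Metric.isOpen_ball hball).2, hu.tail_lt_top hp hsp x₀ hR⟩

/-- A locally bounded weak solution has, on a ball, a representative that is a local solution. -/
theorem IsWeakSolution.exists_localSolution {x₀ : Euc N} {R : ℝ} (hp : 1 < p) (hsp : 0 < sp)
    (hu : IsWeakSolution p s₁ sp Ω u) (hb : LocallyEssBounded Ω u) (hR : 0 < R) (hR1 : R ≤ 1)
    (hball : CompactlyContained (Metric.ball x₀ R) Ω) :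
    ∃ v : Euc N → ℝ, u =ᵐ[volume] v ∧
      LocalSolution p s₁ sp x₀ R ((boundAndTail sp p u x₀ R).toReal + 1) v := by
  obtain ⟨hu1, hup, htail, Z, hZm, hZ, hweak⟩ := hu
  have hT := boundAndTail_lt_top hp hsp htail hb hR hball
  set T := boundAndTail sp p u x₀ R with hTdef
  -- A single constant dominates the supremum and the tail; the added 1 secures M ≥ 1.
  set M := T.toReal + 1 with hM
  have hT0 : 0 ≤ T.toReal := ENNReal.toReal_nonneg
  have hM0 : 0 < M := by linarith
  have hTM : T ≤ ENNReal.ofReal M := by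
    rw [← ENNReal.ofReal_toReal hT.ne]
    exact ENNReal.ofReal_le_ofReal (by linarith)
  obtain ⟨v, hvm, huv, hvb⟩ := exists_bounded_representative htail.aestronglyMeasurable
    (Metric.isOpen_ball (x := x₀) (ε := R)).measurableSet hM0.le
    ((le_self_add : _ ≤ T).trans hTM)
  have hp1 : 0 < p - 1 := by linarith
  have hRs : 0 < R ^ (sp * p) := Real.rpow_pos_of_pos hR _
  have htl : tail sp p u x₀ R ≤ ENNReal.ofReal M := (le_add_self : _ ≤ T).trans hTM
  refine ⟨v, huv, hvm, hR1, by linarith, hvb, ?_, ?_, ?_, Z, ?_, ?_, ?_⟩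
  · have h1 : ∫⁻ y in (Metric.ball x₀ R)ᶜ,
        ENNReal.ofReal (|v y| ^ (p - 1)) / singWeight (sp * p) (y - x₀) =
        ∫⁻ y in (Metric.ball x₀ R)ᶜ,
        ENNReal.ofReal (|u y| ^ (p - 1)) / ENNReal.ofReal (‖y - x₀‖ ^ ((N : ℝ) + sp * p)) := by
      refine lintegral_congr_ae (ae_restrict_of_ae (huv.mono fun y hy => ?_))
      simp only [hy, singWeight]
    rw [h1]
    rw [tail, one_div, ENNReal.rpow_inv_le_iff hp1,
      ENNReal.ofReal_rpow_of_nonneg hM0.le hp1.le, mul_comm,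
      ← ENNReal.le_div_iff_mul_le (Or.inl (ENNReal.ofReal_pos.2 hRs).ne')
        (Or.inl ENNReal.ofReal_ne_top), ← ENNReal.ofReal_div_of_pos hRs] at htl
    exact htl
  · rw [← gagliardo_congr huv]
    exact (hu1 _ Metric.isOpen_ball hball).2
  · rw [← gagliardo_congr huv]
    exact (hup _ Metric.isOpen_ball hball).2
  · exact hZm.1
  · have e1 := (Measure.quasiMeasurePreserving_fst (μ := (volume : Measure (Euc N)))
      (ν := (volume : Measure (Euc N)))).ae huv
    have e2 := (Measure.quasiMeasurePreserving_snd (μ := (volume : Measure (Euc N)))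
      (ν := (volume : Measure (Euc N)))).ae huv
    have hZ' : ∀ᵐ z ∂((volume : Measure (Euc N)).prod volume), Z z ∈ setSgn (u z.1 - u z.2) := hZ
    filter_upwards [e1, e2, hZ'] with z h1 h2 h3
    rwa [h1, h2] at h3
  · intro φ hφ
    have e1 := (Measure.quasiMeasurePreserving_fst (μ := (volume : Measure (Euc N)))
      (ν := (volume : Measure (Euc N)))).ae huv
    have e2 := (Measure.quasiMeasurePreserving_snd (μ := (volume : Measure (Euc N)))
      (ν := (volume : Measure (Euc N)))).ae huv
    have h := hweak φ ⟨hφ.1, hφ.2.1, hφ.2.2.1,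
      hφ.2.2.2.trans (subset_closure.trans hball.2)⟩
    rw [Measure.volume_eq_prod] at h
    rw [h]
    congr 1
    refine integral_congr_ae ?_
    filter_upwards [e1, e2] with z h1 h2
    rw [h1, h2, oddPow, show p - 1 - 1 = p - 2 by ring]

/-- Fractional Sobolev regularity on small balls implies it on compactly contained sets. -/
theorem gagliardo_lt_top_of_balls {γ q m δ : ℝ} {V : Set (Euc N)} (hq : 0 < q) (hγ : 0 < γ)
    (hu : Measurable u) (hV : IsOpen V) (hK : IsCompact (closure V)) (hδ : 0 < δ)
    (hb : ∀ x ∈ V, |u x| ≤ m)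
    (hballs : ∀ x ∈ closure V, gagliardo γ q (Metric.ball x δ) u < ⊤) :
    gagliardo γ q V u < ⊤ := by
  -- Half radii ensure that two points of V closer than δ/2 share a ball of radius δ from the finite
  -- cover. For the remaining pairs the kernel is bounded and V has finite volume.
  obtain ⟨t, htK, htfin, htcov⟩ := hK.finite_cover_balls (show 0 < δ / 2 by linarith)
  set f : Euc N × Euc N → ENNReal := fun z =>
    ENNReal.ofReal (|u z.1 - u z.2| ^ q) / singWeight (γ * q) (z.1 - z.2) with hf
  have hfm : Measurable f := by fun_prop
  have hVm := hV.measurableSet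
  have hBm : ∀ i : Euc N, MeasurableSet (Metric.ball i δ ×ˢ Metric.ball i δ) := fun i =>
    Metric.isOpen_ball.measurableSet.prod Metric.isOpen_ball.measurableSet
  set c := ENNReal.ofReal ((2 * m) ^ q / (δ / 2) ^ ((N : ℝ) + γ * q)) with hc
  have hpt : ∀ z ∈ V ×ˢ V, f z ≤
      (∑ i ∈ htfin.toFinset, (Metric.ball i δ ×ˢ Metric.ball i δ).indicator f z) + c := by
    rintro ⟨x, y⟩ ⟨hx, hy⟩
    simp only at hx hy
    rcases lt_or_ge (‖x - y‖) (δ / 2) with hxy | hxy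
    · obtain ⟨i, hi, hxi⟩ := mem_iUnion₂.1 (htcov (subset_closure hx))
      have hmem : (x, y) ∈ Metric.ball i δ ×ˢ Metric.ball i δ := by
        rw [mem_ball_iff_norm] at hxi
        constructor
        · simp only [mem_ball_iff_norm]; linarith
        · simp only [mem_ball_iff_norm]
          have := norm_sub_le_norm_sub_add_norm_sub y x i
          rw [norm_sub_rev y x] at this
          linarith
      calc f (x, y) = (Metric.ball i δ ×ˢ Metric.ball i δ).indicator f (x, y) :=
            (indicator_of_mem hmem f).symm
        _ ≤ ∑ i ∈ htfin.toFinset, (Metric.ball i δ ×ˢ Metric.ball i δ).indicator f (x, y) :=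
            Finset.single_le_sum (f := fun i =>
              (Metric.ball i δ ×ˢ Metric.ball i δ).indicator f (x, y)) (fun _ _ => zero_le)
              (htfin.mem_toFinset.2 hi)
        _ ≤ _ := le_self_add
    · have hxy0 : 0 < ‖x - y‖ := by linarith
      refine le_trans ?_ le_add_self
      simp only [hf, hc]
      rw [ofReal_div_singWeight _ _ (norm_pos_iff.1 hxy0)]
      have hm0 : 0 ≤ m := (abs_nonneg _).trans (hb x hx)
      refine ENNReal.ofReal_le_ofReal (div_le_div₀ (by positivity) ?_ (by positivity) ?_)
      · refine Real.rpow_le_rpow (abs_nonneg _) ?_ hq.le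
        linarith [abs_sub (u x) (u y), hb x hx, hb y hy]
      · exact Real.rpow_le_rpow (by linarith) hxy (by positivity)
  have hVfin : volume V < ⊤ := (measure_mono subset_closure).trans_lt hK.measure_lt_top
  have hfin : ∫⁻ z in V ×ˢ V, f z ∂(volume.prod volume) < ⊤ := by
    refine (setLIntegral_mono' (hVm.prod hVm) hpt).trans_lt ?_
    rw [lintegral_add_right _ measurable_const, lintegral_const, Measure.restrict_apply_univ,
      lintegral_finsetSum _ fun i _ => hfm.indicator (hBm i), Measure.prod_prod]
    refine ENNReal.add_lt_top.2 ⟨ENNReal.sum_lt_top.2 fun i hi => ?_,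
      ENNReal.mul_lt_top ENNReal.ofReal_lt_top (ENNReal.mul_lt_top hVfin hVfin)⟩
    refine (setLIntegral_le_lintegral _ _).trans_lt ?_
    rw [lintegral_indicator (hBm i)]
    exact lintegral_prod_lt_top_of_gagliardo hq hu
      (hballs i (htK (htfin.mem_toFinset.1 hi)))
  rw [gagliardo]
  rw [← Measure.prod_restrict, lintegral_prod _ hfm.aemeasurable] at hfin
  exact ENNReal.rpow_lt_top_of_nonneg (by positivity) hfin.ne

end

/-! ### Assembly of the theorem -/

theorem theorem1p1 (N : ℕ) (hN : 2 ≤ N) (p s₁ sp q σ : ℝ)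
    (hp : p ∈ Ioo (1 : ℝ) 2) (hs₁ : s₁ ∈ Ioo (0 : ℝ) 1)
    (hsp : sp ∈ Ioc (0 : ℝ) ((p - 1) / p)) (hq : p ≤ q)
    (hσ : σ ∈ Ico sp (sp * p / (p - 1))) :
    ∃ C κ : ℝ, 0 < C ∧ 0 < κ ∧
      ∀ Ω : Set (EuclideanSpace ℝ (Fin N)),
        IsOpen Ω → IsConnected Ω → Bornology.IsBounded Ω →
        ∀ u : EuclideanSpace ℝ (Fin N) → ℝ,
          IsWeakSolution p s₁ sp Ω u → LocallyEssBounded Ω u →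
            MemFracSobolevLoc σ q Ω u ∧
            ∀ (x₀ : EuclideanSpace ℝ (Fin N)) (R r : ℝ),
              R ∈ Ioo (0 : ℝ) 1 → CompactlyContained (Metric.ball x₀ R) Ω →
              r ∈ Ioo (0 : ℝ) R →
                gagliardo σ q (Metric.ball x₀ r) u ^ q ≤
                  ENNReal.ofReal C *
                    (boundAndTail sp p u x₀ R +
                      gagliardo sp p (Metric.ball x₀ R) u + 1) ^ q /
                    ENNReal.ofReal ((R - r) ^ κ) := by
  obtain ⟨hp1, hp2⟩ := hp
  obtain ⟨hsp0, hsple⟩ := hsp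
  rw [le_div_iff₀ (by linarith)] at hsple
  have hq0 : 0 < q := by linarith
  have hσ0 : 0 < σ := hsp0.trans_le hσ.1
  have E : AdmissibleExponents N p s₁ sp :=
    ⟨by omega, hp1, hp2, hs₁.1, hs₁.2, hsp0, by linarith⟩
  obtain ⟨C, κ, hC, hκ, hmain⟩ := exists_gagliardo_bound E hsple hq hσ0 hσ.2
  refine ⟨C, κ, hC, hκ, fun Ω hΩ _ _ u hu hb => ?_⟩
  have hest : ∀ (x₀ : Euc N) (R r : ℝ), R ∈ Ioo (0 : ℝ) 1 →
      CompactlyContained (Metric.ball x₀ R) Ω → r ∈ Ioo (0 : ℝ) R →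
      gagliardo σ q (Metric.ball x₀ r) u ^ q ≤
        ENNReal.ofReal (C * ((boundAndTail sp p u x₀ R).toReal + 1) ^ q / (R - r) ^ κ) := by
    intro x₀ R r hR hball hr
    obtain ⟨v, huv, hv⟩ := hu.exists_localSolution hp1 hsp0 hb hR.1 hR.2.le hball
    rw [gagliardo_congr huv]
    exact hmain x₀ R _ r v hv hr.1 hr.2
  refine ⟨fun V hV hVΩ => ?_, fun x₀ R r hR hball hr => ?_⟩
  · have hfinV : volume V < ⊤ := (measure_mono subset_closure).trans_lt hVΩ.1.measure_lt_top
    have hVtop := hb V hV hVΩ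
    refine ⟨?_, ?_⟩
    · have : IsFiniteMeasure (volume.restrict V) :=
        ⟨by rwa [Measure.restrict_apply_univ]⟩
      exact hVtop.mono_exponent le_top
    · obtain ⟨v, hvm, huv, hvb⟩ := exists_bounded_representative (A := V)
        hu.2.2.1.aestronglyMeasurable hV.measurableSet
        (ENNReal.toReal_nonneg (a := eLpNorm u ⊤ (volume.restrict V)))
        (ENNReal.ofReal_toReal hVtop.2.ne).ge
      -- Compactness of the closure of V gives one radius valid at all its points, so the local
      -- estimate applies to every ball of the cover.
      obtain ⟨δ, hδ, hδΩ⟩ := hVΩ.1.exists_cthickening_subset_open hΩ hVΩ.2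
      set R := min δ (1 / 2) with hR
      have hR0 : 0 < R := lt_min hδ (by norm_num)
      have hR1 : R < 1 := (min_le_right _ _).trans_lt (by norm_num)
      rw [gagliardo_congr huv]
      refine gagliardo_lt_top_of_balls (δ := R / 2) hq0 hσ0 hvm hV hVΩ.1 (by linarith) hvb
        fun x hx => ?_
      have hball : CompactlyContained (Metric.ball x R) Ω :=
        ⟨(isCompact_closedBall x R).of_isClosed_subset isClosed_closure
          Metric.closure_ball_subset_closedBall,
          Metric.closure_ball_subset_closedBall.trans
            ((Metric.closedBall_subset_closedBall (min_le_left _ _)).trans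
              ((Metric.closedBall_subset_cthickening hx δ).trans hδΩ))⟩
      rw [← gagliardo_congr huv]
      have := hest x R (R / 2) ⟨hR0, hR1⟩ hball ⟨by linarith, by linarith⟩
      exact (ENNReal.rpow_lt_top_iff_of_pos hq0).1 (this.trans_lt ENNReal.ofReal_lt_top)
  · have hT := boundAndTail_lt_top hp1 hsp0 hu.2.2.1 hb hR.1 hball
    have hRr : 0 < R - r := by linarith [hr.2]
    set T := boundAndTail sp p u x₀ R with hTdef
    have hT0 : 0 ≤ T.toReal := ENNReal.toReal_nonneg
    refine (hest x₀ R r hR hball hr).trans ?_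
    rw [ENNReal.ofReal_div_of_pos (Real.rpow_pos_of_pos hRr κ), ENNReal.ofReal_mul hC.le,
      ← ENNReal.ofReal_rpow_of_nonneg (by linarith) hq0.le, ENNReal.ofReal_add hT0 zero_le_one,
      ENNReal.ofReal_toReal hT.ne, ENNReal.ofReal_one]
    -- The estimate already holds with 𝒯 + 1 alone; the W^{s_p,p} seminorm on the right is a
    -- nonnegative addition.
    gcongr
    exact le_self_add
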